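/- Let $(M,g_0)$ be a smooth closed Riemannian manifold of dimension $n\ge 3$, let $3\le k\le n$ and $\tau<1$. Write $\sigma_j$ for the $j$-th elementary symmetric polynomial ($\sigma_0=1$), $\Gamma_{k-1}=\{\lambda\in\mathbb{R}^n:\sigma_j(\lambda)>0,\ 1\le j\le k-1\}$, $e=(1,\dots,1)\in\mathbb{R}^n$, $c=\sigma_k(e)/\sum_{l=0}^{k-2}\sigma_l(e)$, and $$A^{\tau}_{g_0}=\frac{1}{n-2}\Big(\mathrm{Ric}_{g_0}-\frac{\tau R_{g_0}}{2(n-1)}g_0\Big).$$ For $t\in[0,1]$ and a function $u$ on $M$ put $$U^t=\nabla^2u+\frac{1-\tau}{n-2}\,\Delta u\,g_0+\frac{2-\tau}{2}|\nabla u|^2g_0-du\otimes du-tA^{\tau}_{g_0}+(1-t)g_0,$$ where $\nabla$, $\Delta$ and $|\cdot|$ are taken with respect to $g_0$; let $\lambda(U^t)$ be the eigenvalues of $g_0^{-1}U^t$ and $\sigma_j(U^t)=\sigma_j(\lambda(U^t))$. Then for all constants $A,B,K\ge 0$ and $\delta>0$ there is a constant $C$, depending only on $(M,g_0)$, $k$,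 $\tau$, $A$, $B$, $K$, $\delta$, with the following property. Let $t\in[0,1]$, let $\alpha$ and $\alpha_0,\dots,\alpha_{k-2}$ be smooth functions on $M$ with $\|\alpha\|_{C^2(M)}\le A$, $\|\alpha_l\|_{C^2(M)}\le B$ and $\inf_M\alpha_l\ge\delta$ for $0\le l\le k-2$, and let $u\in C^3(M)$ (for example $u\in C^\infty(M)$) satisfy $\|u\|_{C^0(M)}\le K$, $\lambda(U^t)\in\Gamma_{k-1}$ at every point of $M$, and $$\frac{\sigma_k(U^t)}{\sigma_{k-1}(U^t)}-\frac{\sum_{l=0}^{k-2}\big[(1-t)c+t\alpha_l(x)\big]e^{2(k-l)u}\sigma_l(U^t)}{\sigma_{k-1}(U^t)}=-t\,\alpha(x)\,e^{2u}\qquad\text{on } M.$$ Then $$\sup_M|\nabla u|\le C.$$ -/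

import Mathlib

open scoped Manifold ContDiff NNReal ENNReal

noncomputable section

namespace KrylovConformal

/-! ### Elementary symmetric polynomials of eigenvalues -/

/-- The eigenvalues, with multiplicity, of a real matrix `A`: the multiset of the real roots of
its characteristic polynomial. It is used for matrices `g⁻¹ * W` with `g` positive definite and
`W` symmetric; these have only real eigenvalues, so that the multiset has `n` elements. -/
def eigenvalues {n : ℕ} (A : Matrix (Fin n) (Fin n) ℝ) : Multiset ℝ := A.charpoly.roots

/-- The cone `Γ_k`: all `σ_j(s)` with `1 ≤ j ≤ k` are positive. -/
def InGamma (k : ℕ) (s : Multiset ℝ) : Prop := ∀ j : ℕ, 1 ≤ j → j ≤ k → 0 < s.esymm j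

/-- The constant `c = σ_k(e) / (σ_0(e) + ⋯ + σ_{k-2}(e))`, where `e = (1, …, 1) ∈ ℝⁿ`. -/
def cConst (n k : ℕ) : ℝ :=
  (Multiset.replicate n (1 : ℝ)).esymm k /
    ∑ l ∈ Finset.range (k - 1), (Multiset.replicate n (1 : ℝ)).esymm l

/-! ### Riemannian geometry in local coordinates -/

/-- The partial derivative `∂_i f` of a function on `ℝⁿ`. -/
def pd {n : ℕ} (i : Fin n) (f : EuclideanSpace ℝ (Fin n) → ℝ) (y : EuclideanSpace ℝ (Fin n)) : ℝ :=
  fderiv ℝ f y (EuclideanSpace.single i 1)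

section Coordinates

variable {n : ℕ} {M : Type*} [TopologicalSpace M] [ChartedSpace (EuclideanSpace ℝ (Fin n)) M]

/-- The coordinate vector field `∂_i` of the chart `φ` at the point with coordinates `y`. -/
def coordVec (φ : OpenPartialHomeomorph M (EuclideanSpace ℝ (Fin n))) (i : Fin n)
    (y : EuclideanSpace ℝ (Fin n)) : TangentSpace (𝓡 n) (φ.symm y) :=
  mfderiv (𝓡 n) (𝓡 n) φ.symm y (EuclideanSpace.single i 1 : EuclideanSpace ℝ (Fin n))

variable [IsManifold (𝓡 n) ∞ M]

/-- A smooth Riemannian metric on `M`. -/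
abbrev Metric (n : ℕ) (M : Type*) [TopologicalSpace M] [ChartedSpace (EuclideanSpace ℝ (Fin n)) M]
    [IsManifold (𝓡 n) ∞ M] : Type _ :=
  Bundle.ContMDiffRiemannianMetric (𝓡 n) ∞ (EuclideanSpace ℝ (Fin n))
    (fun x : M => TangentSpace (𝓡 n) x)

variable (g : Metric n M) (φ : OpenPartialHomeomorph M (EuclideanSpace ℝ (Fin n)))

/-- The matrix `g_{ij} = g(∂_i, ∂_j)` of the metric in the chart `φ`. -/
def gMat (y : EuclideanSpace ℝ (Fin n)) : Matrix (Fin n) (Fin n) ℝ :=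
  Matrix.of fun i j => g.inner (φ.symm y) (coordVec φ i y) (coordVec φ j y)

/-- The Christoffel symbols
`Γ^m_{ij} = ½ g^{ml} (∂_i g_{jl} + ∂_j g_{il} - ∂_l g_{ij})` of the Levi-Civita connection. -/
def christoffel (m i j : Fin n) (y : EuclideanSpace ℝ (Fin n)) : ℝ :=
  (1 / 2) * ∑ l, (gMat g φ y)⁻¹ m l *
    (pd i (fun z => gMat g φ z j l) y + pd j (fun z => gMat g φ z i l) y
      - pd l (fun z => gMat g φ z i j) y)

/-- The Ricci tensor
`R_{ij} = ∂_m Γ^m_{ij} - ∂_j Γ^m_{im} + Γ^m_{ml} Γ^l_{ij} - Γ^m_{jl} Γ^l_{im}`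
(positive on round spheres). -/
def ricMat (y : EuclideanSpace ℝ (Fin n)) : Matrix (Fin n) (Fin n) ℝ :=
  Matrix.of fun i j =>
    ∑ m, (pd m (christoffel g φ m i j) y - pd j (christoffel g φ m i m) y)
      + ∑ m, ∑ l, (christoffel g φ m m l y * christoffel g φ l i j y
          - christoffel g φ m j l y * christoffel g φ l i m y)

/-- The scalar curvature `g^{ij} R_{ij}`. -/
def scal (y : EuclideanSpace ℝ (Fin n)) : ℝ :=
  ∑ i, ∑ j, (gMat g φ y)⁻¹ i j * ricMat g φ y i j

/-- The modified Schouten tensor `A^τ = (Ric - τ R / (2 (n - 1)) g) / (n - 2)`. -/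
def schoutenMat (τ : ℝ) (y : EuclideanSpace ℝ (Fin n)) : Matrix (Fin n) (Fin n) ℝ :=
  (1 / ((n : ℝ) - 2)) • (ricMat g φ y - (τ * scal g φ y / (2 * ((n : ℝ) - 1))) • gMat g φ y)

/-- The coordinate derivatives `u_i = ∂_i (u ∘ φ⁻¹)`. -/
def duVec (u : M → ℝ) (y : EuclideanSpace ℝ (Fin n)) (i : Fin n) : ℝ :=
  pd i (fun z => u (φ.symm z)) y

/-- The Hessian `(∇²u)_{ij} = ∂_i ∂_j u - Γ^m_{ij} ∂_m u`. -/
def hessMat (u : M → ℝ) (y : EuclideanSpace ℝ (Fin n)) : Matrix (Fin n) (Fin n) ℝ :=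
  Matrix.of fun i j =>
    pd i (fun z => duVec φ u z j) y - ∑ m, christoffel g φ m i j y * duVec φ u y m

/-- The Laplacian `Δu = g^{ij} (∇²u)_{ij}`. -/
def lap (u : M → ℝ) (y : EuclideanSpace ℝ (Fin n)) : ℝ :=
  ∑ i, ∑ j, (gMat g φ y)⁻¹ i j * hessMat g φ u y i j

/-- `|∇u|² = g^{ij} u_i u_j`. -/
def gradSq (u : M → ℝ) (y : EuclideanSpace ℝ (Fin n)) : ℝ :=
  ∑ i, ∑ j, (gMat g φ y)⁻¹ i j * duVec φ u y i * duVec φ u y j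

/-- The tensor
`U^t = ∇²u + (1-τ)/(n-2) Δu g + (2-τ)/2 |∇u|² g - du ⊗ du - t A^τ + (1-t) g`. -/
def UMat (τ t : ℝ) (u : M → ℝ) (y : EuclideanSpace ℝ (Fin n)) : Matrix (Fin n) (Fin n) ℝ :=
  hessMat g φ u y
    + ((1 - τ) / ((n : ℝ) - 2) * lap g φ u y) • gMat g φ y
    + ((2 - τ) / 2 * gradSq g φ u y) • gMat g φ y
    - Matrix.of (fun i j => duVec φ u y i * duVec φ u y j)
    - t • schoutenMat g φ τ y
    + (1 - t) • gMat g φ y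

/-- `λ(U^t)`, the eigenvalues of `g⁻¹ U^t`, at the point with coordinates `y`. -/
def lamU (τ t : ℝ) (u : M → ℝ) (y : EuclideanSpace ℝ (Fin n)) : Multiset ℝ :=
  eigenvalues ((gMat g φ y)⁻¹ * UMat g φ τ t u y)

/-- `u` is an admissible solution of the equation with parameter `t`: at every point, and in every
smooth chart around it (the objects do not depend on the chart), `λ(U^t) ∈ Γ_{k-1}` and
`σ_k(U^t)/σ_{k-1}(U^t) - (∑_{l=0}^{k-2} [(1-t)c + t α_l] e^{2(k-l)u} σ_l(U^t))/σ_{k-1}(U^t)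
  = - t α e^{2u}`. -/
def IsAdmissibleSolution (k : ℕ) (τ t : ℝ) (α : M → ℝ) (αl : ℕ → M → ℝ) (u : M → ℝ) : Prop :=
  ∀ φ ∈ IsManifold.maximalAtlas (𝓡 n) ∞ M, ∀ x ∈ φ.source,
    InGamma (k - 1) (lamU g φ τ t u (φ x)) ∧
    (lamU g φ τ t u (φ x)).esymm k / (lamU g φ τ t u (φ x)).esymm (k - 1)
      - (∑ l ∈ Finset.range (k - 1),
          ((1 - t) * cConst n k + t * αl l x) * Real.exp (2 * ((k : ℝ) - l) * u x)
            * (lamU g φ τ t u (φ x)).esymm l) / (lamU g φ τ t u (φ x)).esymm (k - 1)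
      = -t * α x * Real.exp (2 * u x)

/-! ### Norms -/

/-- `‖f‖_{C⁰(M)} = sup |f|`, in `[0, ∞]`. -/
def C0Norm (f : M → ℝ) : ℝ≥0∞ := ⨆ x, ‖f x‖ₑ

/-- `|∇f|` at `x` with respect to `g`: the norm of the differential, `sup {|df_x(v)| : |v|_g ≤ 1}`,
in `[0, ∞]`. -/
def gradNorm (f : M → ℝ) (x : M) : ℝ≥0∞ :=
  ⨆ (v : TangentSpace (𝓡 n) x) (_ : g.inner x v v ≤ 1), ‖mvfderiv (𝓡 n) f x v‖ₑ

/-- `|∇²f| = (g^{ia} g^{jb} f_{ij} f_{ab})^{1/2} = (tr (g⁻¹ ∇²f g⁻¹ ∇²f))^{1/2}` at `x` with respect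
to `g`, computed in the preferred chart at `x` (it does not depend on the chart). -/
def hessNorm (f : M → ℝ) (x : M) : ℝ≥0∞ :=
  let φ := chartAt (EuclideanSpace ℝ (Fin n)) x
  let H := (gMat g φ (φ x))⁻¹ * hessMat g φ f (φ x)
  ENNReal.ofReal (Real.sqrt (H * H).trace)

/-- `‖f‖_{C²(M)} = sup |f| + sup |∇f| + sup |∇²f|`, in `[0, ∞]`. -/
def C2Norm (f : M → ℝ) : ℝ≥0∞ := C0Norm f + (⨆ x, gradNorm g f x) + ⨆ x, hessNorm g f x

end Coordinates

end KrylovConformal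

end

/-!
The estimate is proved by the maximum principle, applied to
`H = |∇u|² exp (φ(u))` with `φ(s) = ½ e^{2(s-K)}`. For `|u| ≤ K` the exponential factor is bounded
above and below, so it suffices to bound `w = |∇u|²` at a maximum point of `H`. For this choice of
`φ` one has `φ'' - φ'² ≥ φ' ≥ e^{-4K} > 0`.

*Algebra.* Dividing the equation by `σ_{k-1}` makes it elliptic on `Γ_{k-1}`. If `f_i` is the
derivative in `λ_i` of `σ_k - ∑ β_l σ_l + ψ σ_{k-1}`, divided by `σ_{k-1}`, then on the solutions
`f_i ≥ 0`, `∑ f_i ≥ 1/n` and `∑ f_i λ_i ≥ -ψ` (`linCoef_nonneg`, `inv_le_sum_linCoef`,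
`neg_le_sum_mul_linCoef`). All of this follows from Newton's inequalities.

*The maximum point.* No normal coordinates are used: in a fixed chart, `τ_m` denotes a basis that is
orthonormal for `g` and diagonalizes `U^t`. At a maximum point of `H` the gradient of `w` is
`-φ' w ∇u`, and the second derivatives of `H` in the directions `τ_m` are nonpositive. These `n`
inequalities are added with the weights `f_m + a ∑ f_i`, where `a = (1-τ)/(n-2) > 0`. The third
derivatives of `u` are then those of `2 ∑ f_m D_{∇u} U^t(τ_m, τ_m)`, which the equation,
differentiated along `∇u`, bounds from below by `-C w` (`neg_le_sum_linCoef_mul_frame`): the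
derivatives of the `β_l` have the good sign for large `w`, because `β_l` contains the factor
`e^{2(k-l)u}`. The terms `(2-τ)/2 |∇u|² g` and `-du ⊗ du` of `U^t` yield the good term
`(2-τ)/2 φ' w² ∑ f_i`, the Bochner formula yields `2 a |∂²u|² ∑ f_i`, and all other terms are
`O(|∂u| |∂²u| + |∂u|³) ∑ f_i`. Hence `w` is bounded (`exists_bound_of_frame_inequalities`).

The bookkeeping is done with `Jet`, the list of the derivatives at one point. The identities for
`U^t` and its derivative are then finite sums (`Jet.frame_U`, `Jet.frame_dU`), and the lower order
terms are estimated on the space of all bounded jets (`Jet.exists_error_bound`). The derivatives of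
the `σ_j` of the eigenvalues come from those of the characteristic polynomial
(`hasDerivAt_esymm_eigenvalues`), so that no regularity of the eigenvalues is needed.
-/

namespace KrylovConformal

/-! ### Elementary symmetric polynomials of real numbers -/

section Esymm

open Polynomial

lemma esymm_zero' (s : Multiset ℝ) : s.esymm 0 = 1 := by
  simp [Multiset.esymm]

lemma esymm_cons (a : ℝ) (s : Multiset ℝ) (j : ℕ) :
    (a ::ₘ s).esymm (j + 1) = s.esymm (j + 1) + a * s.esymm j := by
  simp [Multiset.esymm, Multiset.powersetCard_cons, Multiset.sum_map_mul_left]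

lemma esymm_eq_zero_of_card_lt {s : Multiset ℝ} {j : ℕ} (h : Multiset.card s < j) :
    s.esymm j = 0 := by
  simp [Multiset.esymm, Multiset.powersetCard_eq_empty _ h]

lemma splits_derivative {p : ℝ[X]} (hp : p.Splits) : (derivative p).Splits := by
  rw [splits_iff_card_roots] at hp ⊢
  have h1 := card_roots_le_derivative p
  have h2 := card_roots' (derivative p)
  have h3 := natDegree_derivative_le p
  rcases Nat.eq_zero_or_pos p.natDegree with h | h
  · omega
  · omega

lemma splits_iterate_derivative {p : ℝ[X]} (hp : p.Splits) (m : ℕ) :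
    (derivative^[m] p).Splits := by
  induction m with
  | zero => simpa using hp
  | succ m ih => rw [Function.iterate_succ_apply']; exact splits_derivative ih

/-- For a polynomial with only real roots `p p'' ≤ p'²`: the logarithmic derivative
`∑ 1 / (x - xᵢ)` is decreasing. -/
lemma eval_mul_eval_derivative_two_le {p : ℝ[X]} (hp : p.Splits) (x : ℝ) :
    p.eval x * (derivative (derivative p)).eval x ≤ (derivative p).eval x ^ 2 := by
  have key : ∀ s : Multiset ℝ, (s.map fun a => X - C a).prod.eval x *
      (derivative (derivative (s.map fun a => X - C a).prod)).eval x ≤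
      (derivative (s.map fun a => X - C a).prod).eval x ^ 2 := by
    intro s
    induction s using Multiset.induction with
    | empty => simp
    | cons a s ih =>
      simp only [Multiset.map_cons, Multiset.prod_cons, derivative_mul, derivative_sub,
        derivative_X, derivative_C, sub_zero, one_mul, derivative_add, eval_add, eval_mul,
        eval_sub, eval_X, eval_C]
      nlinarith [mul_le_mul_of_nonneg_left ih (sq_nonneg (x - a)),
        sq_nonneg ((s.map fun a => X - C a).prod.eval x)]
  rw [hp.eq_prod_roots]
  simp only [derivative_C_mul, eval_mul, eval_C]
  nlinarith [mul_le_mul_of_nonneg_left (key p.roots) (sq_nonneg p.leadingCoeff)]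

/-- Newton's inequality (with a constant that is not optimal, but less than `1`). -/
lemma newton_esymm (s : Multiset ℝ) (j : ℕ) (hj : j + 1 ≤ Multiset.card s) :
    ((Multiset.card s : ℝ) - j) * (s.esymm (j + 2) * s.esymm j) ≤
      ((Multiset.card s : ℝ) - j - 1) * s.esymm (j + 1) ^ 2 := by
  have hc : (j : ℝ) + 1 ≤ Multiset.card s := by exact_mod_cast hj
  rcases Nat.lt_or_ge (Multiset.card s) (j + 2) with h | h
  · rw [esymm_eq_zero_of_card_lt h]
    nlinarith [mul_nonneg (by linarith : (0 : ℝ) ≤ (Multiset.card s : ℝ) - j - 1)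
      (sq_nonneg (s.esymm (j + 1)))]
  obtain ⟨m, hm⟩ := Nat.exists_eq_add_of_le h
  set p : ℝ[X] := (s.map fun a => X + C a).prod with hpdef
  have hp : p.Splits := by
    apply Splits.multisetProd
    intro f hf
    obtain ⟨a, -, rfl⟩ := Multiset.mem_map.1 hf
    exact Splits.X_add_C a
  have hcoef : ∀ i ≤ Multiset.card s, p.coeff i = s.esymm (Multiset.card s - i) := fun i hi =>
    Multiset.prod_X_add_C_coeff s hi
  have hev : ∀ i ≤ Multiset.card s, (derivative^[i] p).eval 0 =
      (i.factorial : ℝ) * s.esymm (Multiset.card s - i) := by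
    intro i hi
    rw [← coeff_zero_eq_eval_zero, coeff_iterate_derivative, ← hcoef i hi]
    simp [Nat.descFactorial_self]
  have key := eval_mul_eval_derivative_two_le (splits_iterate_derivative hp m) 0
  rw [← Function.iterate_succ_apply' derivative, ← Function.iterate_succ_apply' derivative,
    hev _ (by omega), hev _ (by omega), hev _ (by omega)] at key
  rw [show Multiset.card s - m = j + 2 by omega, show Multiset.card s - (m + 1) = j + 1 by omega,
    show Multiset.card s - (m + 1 + 1) = j by omega] at key
  rw [Nat.factorial_succ (m + 1), Nat.factorial_succ m] at key
  push_cast at key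
  have hcard : (Multiset.card s : ℝ) = j + 2 + m := by exact_mod_cast hm
  rw [hcard]
  have hf : (0 : ℝ) < (m.factorial : ℝ) ^ 2 * (m + 1) := by positivity
  refine le_of_mul_le_mul_left ?_ hf
  nlinarith [key]

lemma esymm_mul_esymm_le_sq (s : Multiset ℝ) (j : ℕ) :
    s.esymm (j + 2) * s.esymm j ≤ s.esymm (j + 1) ^ 2 := by
  rcases Nat.lt_or_ge (Multiset.card s) (j + 1) with h | h
  · rw [esymm_eq_zero_of_card_lt (show Multiset.card s < j + 2 by omega)]
    nlinarith [sq_nonneg (s.esymm (j + 1))]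
  · have hc : (j : ℝ) + 1 ≤ Multiset.card s := by exact_mod_cast h
    have h1 := newton_esymm s j h
    refine le_of_mul_le_mul_left (h1.trans ?_) (by linarith : (0 : ℝ) < (Multiset.card s : ℝ) - j)
    nlinarith [sq_nonneg (s.esymm (j + 1))]

/-- Removing one entry from a tuple with positive `σ_1, …, σ_m` leaves `σ_1, …, σ_{m-1}`
positive. -/
lemma esymm_pos_of_cons {a : ℝ} {s : Multiset ℝ} {m : ℕ}
    (h : ∀ j, 1 ≤ j → j ≤ m → 0 < (a ::ₘ s).esymm j) :
    ∀ j, j < m → 0 < s.esymm j := by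
  intro j
  induction j with
  | zero => intro _; rw [esymm_zero']; exact one_pos
  | succ j ih =>
    intro hj
    have h0 := ih (by omega)
    have h1 := h (j + 1) (by omega) (by omega)
    have h2 := h (j + 2) (by omega) (by omega)
    rw [esymm_cons] at h1 h2
    have hN := esymm_mul_esymm_le_sq s j
    by_contra hneg
    push Not at hneg
    have ha : 0 < a := by
      by_contra ha
      push Not at ha
      nlinarith
    -- otherwise `s.esymm (j + 2)` and `a * s.esymm j` would be so large that Newton fails
    have h3 : 0 < a * s.esymm j := mul_pos ha h0
    have h4 : -s.esymm (j + 1) < a * s.esymm j := by linarith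
    have h5 : a * -s.esymm (j + 1) < s.esymm (j + 2) := by linarith
    have h6 : 0 ≤ -s.esymm (j + 1) := by linarith
    have h7 : a * s.esymm (j + 1) ^ 2 < a * (s.esymm (j + 2) * s.esymm j) := by
      calc a * s.esymm (j + 1) ^ 2 = (a * -s.esymm (j + 1)) * -s.esymm (j + 1) := by ring
        _ ≤ (a * -s.esymm (j + 1)) * (a * s.esymm j) :=
            mul_le_mul_of_nonneg_left h4.le (mul_nonneg ha.le h6)
        _ < s.esymm (j + 2) * (a * s.esymm j) := mul_lt_mul_of_pos_right h5 h3
        _ = _ := by ring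
    exact absurd (lt_of_mul_lt_mul_left h7 ha.le) (not_lt.2 hN)

/-- Log-concavity over several steps: `σ_l σ_{m+1} ≤ σ_{l+1} σ_m` for `l < m`. -/
lemma esymm_mul_esymm_le {s : Multiset ℝ} {m : ℕ} (h : ∀ j, j ≤ m → 0 < s.esymm j) {l : ℕ}
    (hl : l < m) : s.esymm l * s.esymm (m + 1) ≤ s.esymm (l + 1) * s.esymm m := by
  induction m with
  | zero => omega
  | succ m ih =>
    have hN := esymm_mul_esymm_le_sq s m
    rcases Nat.lt_or_ge l m with h1 | h1
    · have h2 := ih (fun j hj => h j (by omega)) h1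
      have hm := h m (by omega)
      have hm1 := h (m + 1) le_rfl
      have hl0 := h l (by omega)
      refine le_of_mul_le_mul_right ?_ hm
      calc s.esymm l * s.esymm (m + 1 + 1) * s.esymm m
          = s.esymm l * (s.esymm (m + 2) * s.esymm m) := by ring
        _ ≤ s.esymm l * s.esymm (m + 1) ^ 2 := mul_le_mul_of_nonneg_left hN hl0.le
        _ = (s.esymm l * s.esymm (m + 1)) * s.esymm (m + 1) := by ring
        _ ≤ (s.esymm (l + 1) * s.esymm m) * s.esymm (m + 1) :=
            mul_le_mul_of_nonneg_right h2 hm1.le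
        _ = _ := by ring
    · obtain rfl : l = m := by omega
      linarith [hN, sq (s.esymm (l + 1)), mul_comm (s.esymm l) (s.esymm (l + 1 + 1))]

end Esymm

section Tuple

open Polynomial

variable {n : ℕ}

/-- `σ_j(x)` of a tuple `x`. -/
noncomputable def sig (x : Fin n → ℝ) (j : ℕ) : ℝ := (Finset.univ.val.map x).esymm j

/-- `σ_{j;i}(x)`: the value of `σ_j` on the tuple `x` without its `i`-th entry. -/
noncomputable def sigErase (x : Fin n → ℝ) (j : ℕ) (i : Fin n) : ℝ :=
  (((Finset.univ : Finset (Fin n)).erase i).val.map x).esymm j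

/-- `∂σ_j/∂x_i`, which is `σ_{j-1;i}`, and `0` for `j = 0`. -/
noncomputable def sigDeriv (x : Fin n → ℝ) : ℕ → Fin n → ℝ
  | 0, _ => 0
  | j + 1, i => sigErase x j i

lemma map_univ_eq_cons (x : Fin n → ℝ) (i : Fin n) :
    Finset.univ.val.map x =
      x i ::ₘ (((Finset.univ : Finset (Fin n)).erase i).val.map x) := by
  rw [← Multiset.map_cons, ← Finset.insert_val_of_notMem (Finset.notMem_erase i _),
    Finset.insert_erase (Finset.mem_univ i)]

lemma sig_zero (x : Fin n → ℝ) : sig x 0 = 1 := esymm_zero' _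

lemma sig_succ (x : Fin n → ℝ) (j : ℕ) (i : Fin n) :
    sig x (j + 1) = sigErase x (j + 1) i + x i * sigErase x j i := by
  unfold sig sigErase
  rw [map_univ_eq_cons x i, esymm_cons]

lemma sum_sigErase (x : Fin n → ℝ) (j : ℕ) :
    ∑ i, sigErase x j i = ((n : ℝ) - j) * sig x j := by
  classical
  have hcard : ∀ i : Fin n,
      Multiset.card ((((Finset.univ : Finset (Fin n)).erase i).val.map x)) = n - 1 := by
    intro i; simp
  rcases Nat.lt_or_ge j n with h | h
  · -- compare coefficients in `p' = ∑ i, ∏ j ≠ i, (X + x j)` for `p = ∏ i, (X + x i)`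
    have hp : Polynomial.derivative (∏ i, (X + C (x i))) =
        ∑ i, ∏ j ∈ (Finset.univ : Finset (Fin n)).erase i, (X + C (x j)) := by
      rw [Polynomial.derivative_prod_finset]
      simp
    have hc := congrArg (fun q => Polynomial.coeff q (n - 1 - j)) hp
    simp only [Polynomial.finsetSum_coeff, Polynomial.coeff_derivative] at hc
    have h1 : ∀ i : Fin n, (∏ j ∈ (Finset.univ : Finset (Fin n)).erase i,
        (X + C (x j))).coeff (n - 1 - j) = sigErase x j i := by
      intro i
      have := Multiset.prod_X_add_C_coeff' ((Finset.univ : Finset (Fin n)).erase i).val x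
        (k := n - 1 - j) (by simp)
      rw [show ∏ j ∈ (Finset.univ : Finset (Fin n)).erase i, (X + C (x j)) =
        (((Finset.univ : Finset (Fin n)).erase i).val.map fun j => X + C (x j)).prod from rfl, this]
      unfold sigErase
      congr 1
      simp
      omega
    have h2 : (∏ i, (X + C (x i))).coeff (n - 1 - j + 1) = sig x j := by
      have := Multiset.prod_X_add_C_coeff' (Finset.univ : Finset (Fin n)).val x
        (k := n - 1 - j + 1) (by simp; omega)
      rw [show ∏ i, (X + C (x i)) =
        ((Finset.univ : Finset (Fin n)).val.map fun j => X + C (x j)).prod from rfl, this]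
      unfold sig
      congr 1
      simp
      omega
    simp only [h1, h2] at hc
    rw [← hc, Nat.sub_sub, Nat.cast_sub (by omega)]
    push_cast
    ring
  · have h1 : ∀ i : Fin n, sigErase x j i = 0 := fun i =>
      esymm_eq_zero_of_card_lt (by rw [hcard]; have := i.pos; omega)
    simp only [h1, Finset.sum_const_zero]
    rcases h.eq_or_lt with rfl | h
    · simp
    · rw [sig, esymm_eq_zero_of_card_lt (by simpa using h), mul_zero]

/-- Euler's identity for the homogeneous polynomial `σ_j`. -/
lemma sum_mul_sigDeriv (x : Fin n → ℝ) (j : ℕ) :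
    ∑ i, x i * sigDeriv x j i = j * sig x j := by
  cases j with
  | zero => simp [sigDeriv]
  | succ j =>
    have h1 := sum_sigErase x (j + 1)
    have h2 : ∑ i, (sigErase x (j + 1) i + x i * sigErase x j i) = n * sig x (j + 1) := by
      rw [Finset.sum_congr rfl fun i _ => (sig_succ x j i).symm]
      simp
    rw [Finset.sum_add_distrib, h1] at h2
    simp only [sigDeriv]
    linarith

/-- The diagonal entries of the linearized operator: the derivative in `x_i` of
`σ_{m+2} - ∑ β_l σ_l + ψ σ_{m+1}`, divided by `σ_{m+1}`. -/
noncomputable def linCoef (x : Fin n → ℝ) (m : ℕ) (β : ℕ → ℝ) (ψ : ℝ) (i : Fin n) : ℝ :=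
  (sigDeriv x (m + 2) i - ∑ l ∈ Finset.range (m + 1), β l * sigDeriv x l i
    + ψ * sigDeriv x (m + 1) i) / sig x (m + 1)

variable {x : Fin n → ℝ} {m : ℕ} {β : ℕ → ℝ} {ψ : ℝ}

lemma sigErase_pos (hΓ : ∀ j, 1 ≤ j → j ≤ m + 1 → 0 < sig x j) (i : Fin n) (j : ℕ) (hj : j ≤ m) :
    0 < sigErase x j i := by
  refine esymm_pos_of_cons (a := x i) (m := m + 1) ?_ j (by omega)
  intro j h1 h2
  rw [← map_univ_eq_cons x i]
  exact hΓ j h1 h2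

/-- On `Γ_{m+1}` each `-σ_l/σ_{m+1}` is nondecreasing in every variable, so that the growth of
`σ_{m+2}/σ_{m+1}` bounds `linCoef` from below; the last step is Newton's inequality for the
remaining `n - 1` entries. -/
lemma sq_div_le_linCoef (hn : m + 2 ≤ n) (hΓ : ∀ j, 1 ≤ j → j ≤ m + 1 → 0 < sig x j)
    (hβ : ∀ l ≤ m, 0 ≤ β l)
    (heq : sig x (m + 2) - ∑ l ∈ Finset.range (m + 1), β l * sig x l + ψ * sig x (m + 1) = 0)
    (i : Fin n) :
    (sigErase x (m + 1) i / sig x (m + 1)) ^ 2 / ((n : ℝ) - m - 1) ≤ linCoef x m β ψ i := by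
  have hs : 0 < sig x (m + 1) := hΓ (m + 1) (by omega) le_rfl
  have hpos := sigErase_pos hΓ i
  have hnm : (m : ℝ) + 2 ≤ n := by exact_mod_cast hn
  set s := (((Finset.univ : Finset (Fin n)).erase i).val.map x) with hsdef
  have hcard : Multiset.card s = n - 1 := by simp [hsdef]
  have hcard' : (Multiset.card s : ℝ) = n - 1 := by
    rw [hcard, Nat.cast_sub (by omega)]; simp
  have hN := newton_esymm s m (by omega)
  rw [hcard'] at hN
  change ((n : ℝ) - 1 - m) * (sigErase x (m + 2) i * sigErase x m i) ≤
    ((n : ℝ) - 1 - m - 1) * sigErase x (m + 1) i ^ 2 at hN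
  have hsum : 0 ≤ ∑ l ∈ Finset.range (m + 1),
      β l * (sig x l * sigErase x m i - sigDeriv x l i * sig x (m + 1)) := by
    refine Finset.sum_nonneg fun l hl => ?_
    have hl' : l ≤ m := by have := Finset.mem_range.1 hl; omega
    refine mul_nonneg (hβ l hl') ?_
    cases l with
    | zero =>
      simp only [sigDeriv, sig_zero, zero_mul, sub_zero, one_mul]
      exact (hpos m le_rfl).le
    | succ l =>
      have h := esymm_mul_esymm_le (s := s) (m := m) hpos (l := l) (by omega)
      change sigErase x l i * sigErase x (m + 1) i ≤ sigErase x (l + 1) i * sigErase x m i at h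
      simp only [sigDeriv]
      rw [sig_succ x l i, sig_succ x m i]
      nlinarith
  have hnum : sig x (m + 1) * (linCoef x m β ψ i * sig x (m + 1)) =
      (sigErase x (m + 1) i ^ 2 - sigErase x (m + 2) i * sigErase x m i) +
      ∑ l ∈ Finset.range (m + 1),
        β l * (sig x l * sigErase x m i - sigDeriv x l i * sig x (m + 1)) := by
    have e1 : linCoef x m β ψ i * sig x (m + 1) = sigErase x (m + 1) i -
        ∑ l ∈ Finset.range (m + 1), β l * sigDeriv x l i + ψ * sigErase x m i := by
      rw [linCoef, div_mul_cancel₀ _ hs.ne']; rfl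
    have e2 : ∑ l ∈ Finset.range (m + 1),
        β l * (sig x l * sigErase x m i - sigDeriv x l i * sig x (m + 1)) =
        (∑ l ∈ Finset.range (m + 1), β l * sig x l) * sigErase x m i -
        (∑ l ∈ Finset.range (m + 1), β l * sigDeriv x l i) * sig x (m + 1) := by
      rw [Finset.sum_mul, Finset.sum_mul, ← Finset.sum_sub_distrib]
      exact Finset.sum_congr rfl fun l _ => by ring
    have e3 := sig_succ x (m + 1) i
    have e4 := sig_succ x m i
    rw [e1, e2]
    have e5 : ψ * sig x (m + 1) =
      ∑ l ∈ Finset.range (m + 1), β l * sig x l - sig x (m + 2) := by linarith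
    calc _ = sig x (m + 1) * sigErase x (m + 1) i -
          (∑ l ∈ Finset.range (m + 1), β l * sigDeriv x l i) * sig x (m + 1)
          + (ψ * sig x (m + 1)) * sigErase x m i := by ring
      _ = _ := by rw [e5, e3, e4]; ring
  have hd : (0 : ℝ) < (n : ℝ) - m - 1 := by linarith
  rw [div_pow, div_div, div_le_iff₀ (by positivity)]
  have : sigErase x (m + 1) i ^ 2 ≤
      ((n : ℝ) - m - 1) * (sig x (m + 1) * (linCoef x m β ψ i * sig x (m + 1))) := by
    rw [hnum]
    nlinarith [mul_nonneg hd.le hsum]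
  nlinarith

lemma linCoef_nonneg (hn : m + 2 ≤ n) (hΓ : ∀ j, 1 ≤ j → j ≤ m + 1 → 0 < sig x j)
    (hβ : ∀ l ≤ m, 0 ≤ β l)
    (heq : sig x (m + 2) - ∑ l ∈ Finset.range (m + 1), β l * sig x l + ψ * sig x (m + 1) = 0)
    (i : Fin n) : 0 ≤ linCoef x m β ψ i := by
  have hnm : (m : ℝ) + 2 ≤ n := by exact_mod_cast hn
  refine le_trans (div_nonneg (sq_nonneg _) (by linarith)) (sq_div_le_linCoef hn hΓ hβ heq i)

/-- Uniform positivity of the trace of the linearized operator. It follows from `sq_div_le_linCoef`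
and the Cauchy–Schwarz inequality, as `∑ σ_{m+1;i} = (n - m - 1) σ_{m+1}`. -/
lemma inv_le_sum_linCoef (hn : m + 2 ≤ n) (hΓ : ∀ j, 1 ≤ j → j ≤ m + 1 → 0 < sig x j)
    (hβ : ∀ l ≤ m, 0 ≤ β l)
    (heq : sig x (m + 2) - ∑ l ∈ Finset.range (m + 1), β l * sig x l + ψ * sig x (m + 1) = 0) :
    (n : ℝ)⁻¹ ≤ ∑ i, linCoef x m β ψ i := by
  have hnm : (m : ℝ) + 2 ≤ n := by exact_mod_cast hn
  have hm0 : (0 : ℝ) ≤ m := Nat.cast_nonneg m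
  have hn0 : (0 : ℝ) < n := by linarith
  have hd : (0 : ℝ) < (n : ℝ) - m - 1 := by linarith
  have hs : 0 < sig x (m + 1) := hΓ (m + 1) (by omega) le_rfl
  have h1 : ∑ i, (sigErase x (m + 1) i / sig x (m + 1)) = (n : ℝ) - m - 1 := by
    rw [← Finset.sum_div, sum_sigErase, mul_div_assoc, div_self hs.ne']
    push_cast; ring
  have h3 : (∑ i, (sigErase x (m + 1) i / sig x (m + 1))) ^ 2 ≤
      n * ∑ i, (sigErase x (m + 1) i / sig x (m + 1)) ^ 2 := by
    have := sq_sum_le_card_mul_sum_sq (s := (Finset.univ : Finset (Fin n)))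
      (f := fun i => sigErase x (m + 1) i / sig x (m + 1))
    simpa using this
  rw [h1] at h3
  have h4 : (∑ i, (sigErase x (m + 1) i / sig x (m + 1)) ^ 2) / ((n : ℝ) - m - 1) ≤
      ∑ i, linCoef x m β ψ i := by
    rw [Finset.sum_div]
    exact Finset.sum_le_sum fun i _ => sq_div_le_linCoef hn hΓ hβ heq i
  refine le_trans ?_ h4
  rw [inv_eq_one_div, div_le_div_iff₀ hn0 hd]
  nlinarith

/-- A lower bound of the linearized operator on `x` itself, by homogeneity of the `σ_j`. -/
lemma neg_le_sum_mul_linCoef (hΓ : ∀ j, 1 ≤ j → j ≤ m + 1 → 0 < sig x j)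
    (hβ : ∀ l ≤ m, 0 ≤ β l)
    (heq : sig x (m + 2) - ∑ l ∈ Finset.range (m + 1), β l * sig x l + ψ * sig x (m + 1) = 0) :
    -ψ ≤ ∑ i, x i * linCoef x m β ψ i := by
  have hs : 0 < sig x (m + 1) := hΓ (m + 1) (by omega) le_rfl
  have h1 : (∑ i, x i * linCoef x m β ψ i) * sig x (m + 1) =
      ∑ i, x i * sigDeriv x (m + 2) i
      - ∑ l ∈ Finset.range (m + 1), β l * ∑ i, x i * sigDeriv x l i
      + ψ * ∑ i, x i * sigDeriv x (m + 1) i := by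
    simp only [Finset.sum_mul, Finset.mul_sum]
    rw [Finset.sum_comm (s := Finset.range (m + 1)), ← Finset.sum_sub_distrib,
      ← Finset.sum_add_distrib]
    refine Finset.sum_congr rfl fun i _ => ?_
    rw [linCoef, mul_assoc, div_mul_cancel₀ _ hs.ne', mul_add, mul_sub, Finset.mul_sum]
    have : ∑ l ∈ Finset.range (m + 1), β l * (x i * sigDeriv x l i) =
        ∑ l ∈ Finset.range (m + 1), x i * (β l * sigDeriv x l i) :=
      Finset.sum_congr rfl fun l _ => by ring
    rw [this]; ring
  simp only [sum_mul_sigDeriv] at h1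
  have h2 : 0 ≤ ∑ l ∈ Finset.range (m + 1), ((m : ℝ) + 2 - l) * (β l * sig x l) := by
    refine Finset.sum_nonneg fun l hl => ?_
    have hl' : l ≤ m := by have := Finset.mem_range.1 hl; omega
    have hl'' : (l : ℝ) ≤ m := by exact_mod_cast hl'
    refine mul_nonneg (by linarith) (mul_nonneg (hβ l hl') ?_)
    rcases Nat.eq_zero_or_pos l with rfl | h
    · rw [sig_zero]; exact zero_le_one
    · exact (hΓ l h (by omega)).le
  have h3 : ∑ l ∈ Finset.range (m + 1), ((m : ℝ) + 2 - l) * (β l * sig x l) =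
      (m + 2) * ∑ l ∈ Finset.range (m + 1), β l * sig x l -
      ∑ l ∈ Finset.range (m + 1), β l * (l * sig x l) := by
    rw [Finset.mul_sum, ← Finset.sum_sub_distrib]
    exact Finset.sum_congr rfl fun l _ => by ring
  refine le_of_mul_le_mul_right ?_ hs
  rw [h1]
  push_cast
  nlinarith

end Tuple

/-! ### Derivatives of the elementary symmetric polynomials of the eigenvalues -/

section EigenDeriv

open Polynomial

variable {n : ℕ}

/-- Jacobi's formula at a diagonal matrix. -/
lemma hasDerivAt_det_of_eq_diagonal {A : ℝ → Matrix (Fin n) (Fin n) ℝ}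
    {A' : Matrix (Fin n) (Fin n) ℝ} {d : Fin n → ℝ} {s₀ : ℝ}
    (h0 : A s₀ = Matrix.diagonal d) (hA : ∀ i j, HasDerivAt (fun s => A s i j) (A' i j) s₀) :
    HasDerivAt (fun s => (A s).det)
      (∑ i, A' i i * ∏ j ∈ (Finset.univ : Finset (Fin n)).erase i, d j) s₀ := by
  classical
  have h1 : ∀ σ : Equiv.Perm (Fin n), HasDerivAt
      (fun s => (Equiv.Perm.sign σ : ℤ) • ∏ i, A s (σ i) i)
      ((Equiv.Perm.sign σ : ℤ) • ∑ i, (∏ j ∈ (Finset.univ : Finset (Fin n)).erase i,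
        A s₀ (σ j) j) • A' (σ i) i) s₀ := by
    intro σ
    have := HasDerivAt.fun_finsetProd (u := Finset.univ) (fun i _ => hA (σ i) i)
    simpa only [zsmul_eq_mul] using this.const_mul _
  have h2 := HasDerivAt.fun_sum (u := Finset.univ) (fun σ _ => h1 σ)
  have h3 : (fun s => (A s).det) =
      fun s => ∑ σ : Equiv.Perm (Fin n), (Equiv.Perm.sign σ : ℤ) • ∏ i, A s (σ i) i := by
    funext s
    rw [Matrix.det_apply]
    rfl
  rw [h3]
  refine h2.congr_deriv ?_
  rw [Finset.sum_eq_single (1 : Equiv.Perm (Fin n))]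
  · simp only [Equiv.Perm.sign_one, Equiv.Perm.one_apply, h0, Matrix.diagonal_apply_eq]
    simp [mul_comm]
  · -- a nontrivial permutation moves two indices, so every term keeps an off-diagonal factor
    intro σ _ hσ
    have : ∀ i, (∏ j ∈ (Finset.univ : Finset (Fin n)).erase i, A s₀ (σ j) j) = 0 := by
      intro i
      obtain ⟨j, hj, hji⟩ : ∃ j, σ j ≠ j ∧ j ≠ i := by
        by_contra hcon
        push Not at hcon
        apply hσ
        ext1 j
        by_contra hj
        have e1 := hcon j hj
        have e2 := hcon (σ j) (fun h => hj (σ.injective h))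
        exact hj (by rw [e2, e1]; rfl)
      exact Finset.prod_eq_zero (Finset.mem_erase.2 ⟨hji, Finset.mem_univ j⟩)
        (by rw [h0, Matrix.diagonal_apply_ne _ hj])
    simp [this]
  · intro h; exact absurd (Finset.mem_univ _) h

/-- Coefficients of polynomials of bounded degree are differentiable if all values are. -/
lemma hasDerivAt_coeff_of_eval {p : ℝ → ℝ[X]} {q : ℝ[X]} {N : ℕ} {s₀ : ℝ}
    (hp : ∀ s, (p s).natDegree ≤ N) (hq : q.natDegree ≤ N)
    (h : ∀ z, HasDerivAt (fun s => (p s).eval z) (q.eval z) s₀) (m : ℕ) :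
    HasDerivAt (fun s => (p s).coeff m) (q.coeff m) s₀ := by
  classical
  have hinj : Set.InjOn (fun i : ℕ => (i : ℝ)) (Finset.range (N + 1)) :=
    Nat.cast_injective.injOn
  have key : ∀ r : ℝ[X], r.natDegree ≤ N → r.coeff m = ∑ i ∈ Finset.range (N + 1),
      r.eval (i : ℝ) * (Lagrange.basis (Finset.range (N + 1)) (fun i : ℕ => (i : ℝ)) i).coeff m := by
    intro r hr
    have hdeg : r.degree < (Finset.range (N + 1)).card := by
      rw [Finset.card_range]
      exact lt_of_le_of_lt degree_le_natDegree (by exact_mod_cast Nat.lt_succ_of_le hr)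
    conv_lhs => rw [Lagrange.eq_interpolate hinj hdeg]
    simp [Lagrange.interpolate_apply, finsetSum_coeff]
  rw [key q hq]
  simp_rw [fun s => key (p s) (hp s)]
  exact HasDerivAt.fun_sum fun i _ => (h i).mul_const _

/-- For a curve of diagonalizable matrices, the derivative of `σ_j` of the eigenvalues at a
parameter where the matrix is diagonal in the basis given by the columns of `T`. -/
lemma hasDerivAt_esymm_eigenvalues {B : ℝ → Matrix (Fin n) (Fin n) ℝ}
    {B' T R : Matrix (Fin n) (Fin n) ℝ} {x : Fin n → ℝ} {s₀ : ℝ} (hTR : T * R = 1)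
    (h0 : R * B s₀ * T = Matrix.diagonal x)
    (hB : ∀ i j, HasDerivAt (fun s => B s i j) (B' i j) s₀)
    (hsplit : ∀ᶠ s in nhds s₀, (B s).charpoly.Splits) {j : ℕ} (hj : j ≤ n) :
    HasDerivAt (fun s => (eigenvalues (B s)).esymm j)
      (∑ i, sigDeriv x j i * (R * B' * T) i i) s₀ := by
  classical
  have hconj : ∀ s, (B s).charpoly = (R * B s * T).charpoly := by
    intro s
    rw [Matrix.charpoly_mul_comm, ← Matrix.mul_assoc, hTR, Matrix.one_mul]
  have hX : ∀ i j, HasDerivAt (fun s => (R * B s * T) i j) ((R * B' * T) i j) s₀ := by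
    intro i j
    simp only [Matrix.mul_apply]
    refine HasDerivAt.fun_sum fun k _ => HasDerivAt.mul_const ?_ _
    exact HasDerivAt.fun_sum fun l _ => (hB l k).const_mul _
  set q : ℝ[X] := ∑ i, C (-(R * B' * T) i i) *
    ∏ j ∈ (Finset.univ : Finset (Fin n)).erase i, (X - C (x j)) with hq
  have hev : ∀ z, HasDerivAt (fun s => (B s).charpoly.eval z) (q.eval z) s₀ := by
    intro z
    simp_rw [hconj, Matrix.eval_charpoly]
    have := hasDerivAt_det_of_eq_diagonal
      (A := fun s => Matrix.scalar (Fin n) z - R * B s * T) (A' := -(R * B' * T))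
      (d := fun i => z - x i) (s₀ := s₀)
      (by simp only [h0, Matrix.scalar_apply, Matrix.diagonal_sub])
      (by
        intro i j
        simp only [Matrix.sub_apply, Matrix.neg_apply]
        exact (hX i j).const_sub _)
    refine this.congr_deriv ?_
    rw [hq, eval_finsetSum]
    refine Finset.sum_congr rfl fun i _ => ?_
    simp [eval_prod]
  have hdeg : ∀ s, (B s).charpoly.natDegree ≤ n := by
    intro s; rw [Matrix.charpoly_natDegree_eq_dim]; simp
  have hqdeg' : ∀ i, (∏ j ∈ (Finset.univ : Finset (Fin n)).erase i,
      (X - C (x j))).natDegree = n - 1 := by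
    intro i
    rw [natDegree_prod_of_monic _ _ fun j _ => monic_X_sub_C _]
    simp
  have hqdeg : q.natDegree ≤ n := by
    refine natDegree_sum_le_of_forall_le _ _ fun i _ => ?_
    refine (natDegree_C_mul_le _ _).trans ?_
    rw [hqdeg']; omega
  have hco := hasDerivAt_coeff_of_eval hdeg hqdeg hev (n - j)
  have hval : (fun s => (eigenvalues (B s)).esymm j) =ᶠ[nhds s₀]
      fun s => (-1) ^ j * (B s).charpoly.coeff (n - j) := by
    filter_upwards [hsplit] with s hs
    have hd : (B s).charpoly.natDegree = n := by
      rw [Matrix.charpoly_natDegree_eq_dim]; simp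
    rw [coeff_eq_esymm_roots_of_splits hs (by omega), hd,
      (Matrix.charpoly_monic _).leadingCoeff, one_mul, show n - (n - j) = j by omega,
      ← mul_assoc, ← mul_pow]
    simp [eigenvalues]
  refine HasDerivAt.congr_of_eventuallyEq ?_ hval
  refine (hco.const_mul _).congr_deriv ?_
  rw [hq, finsetSum_coeff, Finset.mul_sum]
  refine Finset.sum_congr rfl fun i _ => ?_
  rw [coeff_C_mul]
  cases j with
  | zero =>
    rw [coeff_eq_zero_of_natDegree_lt (by rw [hqdeg']; have := i.pos; omega)]
    simp [sigDeriv]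
  | succ j =>
    have h1 := Multiset.prod_X_sub_C_coeff
      (((Finset.univ : Finset (Fin n)).erase i).val.map x) (k := n - (j + 1)) (by simp; omega)
    rw [Multiset.map_map] at h1
    change (∏ j ∈ (Finset.univ : Finset (Fin n)).erase i, (X - C (x j))).coeff _ = _ at h1
    rw [h1]
    have h2 : Multiset.card (((Finset.univ : Finset (Fin n)).erase i).val.map x) - (n - (j + 1))
        = j := by simp; omega
    rw [h2]
    simp only [sigDeriv, sigErase]
    have h3 : ((-1 : ℝ) ^ j) * (-1) ^ j = 1 := by rw [← mul_pow]; simp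
    rw [pow_succ]
    linear_combination ((R * B' * T) i i *
      (((Finset.univ : Finset (Fin n)).erase i).val.map x).esymm j) * h3

end EigenDeriv

section Diagonalize

variable {n : ℕ}

open Matrix

/-- The spectral theorem for a real symmetric matrix. -/
lemma exists_orthogonal_diagonalization {A : Matrix (Fin n) (Fin n) ℝ} (hA : Aᵀ = A) :
    ∃ (Q : Matrix (Fin n) (Fin n) ℝ), Qᵀ * Q = 1 ∧
      ∃ (h : A.IsHermitian), Qᵀ * A * Q = Matrix.diagonal h.eigenvalues := by
  have h : A.IsHermitian := by rw [IsHermitian, conjTranspose_eq_transpose_of_trivial]; exact hA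
  have h1 : star (h.eigenvectorUnitary : Matrix (Fin n) (Fin n) ℝ) * h.eigenvectorUnitary = 1 :=
    Unitary.coe_star_mul_self _
  have hst : star (h.eigenvectorUnitary : Matrix (Fin n) (Fin n) ℝ) =
      (h.eigenvectorUnitary : Matrix (Fin n) (Fin n) ℝ)ᵀ := by
    rw [star_eq_conjTranspose, conjTranspose_eq_transpose_of_trivial]
  refine ⟨h.eigenvectorUnitary, by rw [← hst]; exact h1, h, ?_⟩
  have h2 := h.conjStarAlgAut_star_eigenvectorUnitary
  rw [Unitary.conjStarAlgAut_star_apply] at h2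
  rw [← hst, h2]
  rfl

/-- A symmetric form `U` is diagonal in a suitable orthonormal basis of an inner product `g`; the
columns of `T` are the basis. -/
lemma exists_simultaneous_diagonalization {g U : Matrix (Fin n) (Fin n) ℝ} (hg : g.PosDef)
    (hU : Uᵀ = U) : ∃ (T : Matrix (Fin n) (Fin n) ℝ) (x : Fin n → ℝ),
      Tᵀ * g * T = 1 ∧ T * Tᵀ = g⁻¹ ∧ Tᵀ * U * T = Matrix.diagonal x := by
  have hgT : gᵀ = g := by
    have := hg.1
    rwa [IsHermitian, conjTranspose_eq_transpose_of_trivial] at this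
  obtain ⟨Q, hQ, h, hQg⟩ := exists_orthogonal_diagonalization hgT
  have hpos : ∀ i, 0 < h.eigenvalues i := fun i => hg.eigenvalues_pos i
  set D : Matrix (Fin n) (Fin n) ℝ := diagonal fun i => (Real.sqrt (h.eigenvalues i))⁻¹ with hD
  have hDT : Dᵀ = D := by rw [hD, diagonal_transpose]
  have hD1 : D * diagonal h.eigenvalues * D = 1 := by
    rw [hD, diagonal_mul_diagonal, diagonal_mul_diagonal, ← diagonal_one]
    congr 1
    funext i
    have h1 := Real.mul_self_sqrt (hpos i).le
    have h2 := (Real.sqrt_pos.2 (hpos i)).ne'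
    field_simp
    nlinarith
  have hT1 : (Q * D)ᵀ * g * (Q * D) = 1 := by
    rw [transpose_mul, hDT, ← hD1, ← hQg]
    simp only [Matrix.mul_assoc]
  obtain ⟨Q2, hQ2, h2, hQ2U⟩ := exists_orthogonal_diagonalization
    (A := (Q * D)ᵀ * U * (Q * D)) (by
      simp only [transpose_mul, transpose_transpose, hU, Matrix.mul_assoc])
  have hT : (Q * D * Q2)ᵀ * g * (Q * D * Q2) = 1 := by
    rw [transpose_mul (Q * D) Q2,
      show Q2ᵀ * (Q * D)ᵀ * g * (Q * D * Q2) = Q2ᵀ * ((Q * D)ᵀ * g * (Q * D)) * Q2 by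
        simp only [Matrix.mul_assoc], hT1, Matrix.mul_one, hQ2]
  refine ⟨Q * D * Q2, h2.eigenvalues, hT, ?_, ?_⟩
  · have h3 : (Q * D * Q2) * ((Q * D * Q2)ᵀ * g) = 1 := mul_eq_one_comm.1 hT
    exact (inv_eq_left_inv (by rw [← h3, Matrix.mul_assoc])).symm
  · rw [← hQ2U, transpose_mul (Q * D) Q2]
    simp only [Matrix.mul_assoc]

lemma charpoly_inv_mul_eq_prod {g U T : Matrix (Fin n) (Fin n) ℝ} {x : Fin n → ℝ}
    (hT : T * Tᵀ = g⁻¹) (hU : Tᵀ * U * T = Matrix.diagonal x) :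
    (g⁻¹ * U).charpoly = ∏ i, (Polynomial.X - Polynomial.C (x i)) := by
  rw [← hT, Matrix.mul_assoc, charpoly_mul_comm, hU, charpoly_diagonal]

lemma splits_charpoly_inv_mul {g U : Matrix (Fin n) (Fin n) ℝ} (hg : g.PosDef) (hU : Uᵀ = U) :
    (g⁻¹ * U).charpoly.Splits := by
  obtain ⟨T, x, -, h2, h3⟩ := exists_simultaneous_diagonalization hg hU
  rw [charpoly_inv_mul_eq_prod h2 h3]
  exact Polynomial.Splits.prod fun i _ => Polynomial.Splits.X_sub_C _

lemma esymm_eigenvalues_inv_mul {g U T : Matrix (Fin n) (Fin n) ℝ} {x : Fin n → ℝ}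
    (hT : T * Tᵀ = g⁻¹) (hU : Tᵀ * U * T = Matrix.diagonal x) (j : ℕ) :
    (eigenvalues (g⁻¹ * U)).esymm j = sig x j := by
  rw [eigenvalues, charpoly_inv_mul_eq_prod hT hU, sig]
  congr 1
  have := Polynomial.roots_multiset_prod_X_sub_C (Finset.univ.val.map x)
  rwa [Multiset.map_map] at this

end Diagonalize

/-! ### The metric in a chart -/

section Chart

variable {n : ℕ} {M : Type*} [TopologicalSpace M] [ChartedSpace (EuclideanSpace ℝ (Fin n)) M]
  [IsManifold (𝓡 n) ∞ M]

variable (g : Metric n M) {φ : OpenPartialHomeomorph M (EuclideanSpace ℝ (Fin n))}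

lemma contMDiffOn_coordVec (hφ : φ ∈ IsManifold.maximalAtlas (𝓡 n) ∞ M) (i : Fin n) :
    ContMDiffOn (𝓡 n) (𝓡 n).tangent ∞
      (fun y => Bundle.TotalSpace.mk' (EuclideanSpace ℝ (Fin n))
        (E := fun x : M => TangentSpace (𝓡 n) x) (φ.symm y) (coordVec φ i y)) φ.target := by
  have h1 : ContMDiffOn (𝓡 n) (𝓡 n) ∞ φ.symm φ.target := contMDiffOn_symm_of_mem_maximalAtlas hφ
  have hu : UniqueMDiffOn (𝓡 n) φ.target := φ.open_target.uniqueMDiffOn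
  have h2 := h1.contMDiffOn_tangentMapWithin (m := ∞) (by simp) hu
  have h3 : ContMDiffOn (𝓡 n) (𝓡 n).tangent ∞
      (fun y : EuclideanSpace ℝ (Fin n) => (Bundle.TotalSpace.mk' (EuclideanSpace ℝ (Fin n))
        (E := fun x : EuclideanSpace ℝ (Fin n) => TangentSpace (𝓡 n) x) y
          (EuclideanSpace.single i 1 : EuclideanSpace ℝ (Fin n)))) φ.target := by
    refine (contMDiffOn_vectorSpace_iff_contDiffOn (𝕜 := ℝ) (E := EuclideanSpace ℝ (Fin n))).2 ?_
    exact contDiffOn_const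
  have h4 := h2.comp h3 (fun y hy => hy)
  refine h4.congr fun y hy => ?_
  simp only [Function.comp, tangentMapWithin, coordVec]
  rw [mfderivWithin_of_isOpen φ.open_target hy]

lemma contDiffOn_gMat (hφ : φ ∈ IsManifold.maximalAtlas (𝓡 n) ∞ M) (i j : Fin n) :
    ContDiffOn ℝ ∞ (fun y => gMat g φ y i j) φ.target := by
  rw [← contMDiffOn_iff_contDiffOn]
  have h1 : ContMDiffOn (𝓡 n) (𝓡 n) ∞ φ.symm φ.target := contMDiffOn_symm_of_mem_maximalAtlas hφ
  have h2 := g.contMDiff.comp_contMDiffOn h1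
  have h3 := ContMDiffOn.clm_bundle_apply₂ (E₃ := Bundle.Trivial M ℝ) (F₃ := ℝ) h2
    (contMDiffOn_coordVec hφ i) (contMDiffOn_coordVec hφ j)
  intro y hy
  have h4 := h3 y hy
  simp only [Bundle.contMDiffWithinAt_totalSpace] at h4
  exact h4.2

omit [IsManifold (𝓡 n) ∞ M] in
lemma mdifferentiable_of_mem_maximalAtlas (hφ : φ ∈ IsManifold.maximalAtlas (𝓡 n) ∞ M) :
    φ.MDifferentiable (𝓡 n) (𝓡 n) :=
  ⟨(contMDiffOn_of_mem_maximalAtlas hφ).mdifferentiableOn (by simp),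
    (contMDiffOn_symm_of_mem_maximalAtlas hφ).mdifferentiableOn (by simp)⟩

/-- The tangent vector at `φ⁻¹(y)` with components `c` in the chart `φ`. -/
noncomputable def chartVec (φ : OpenPartialHomeomorph M (EuclideanSpace ℝ (Fin n)))
    (y c : EuclideanSpace ℝ (Fin n)) : TangentSpace (𝓡 n) (φ.symm y) :=
  mfderiv (𝓡 n) (𝓡 n) φ.symm y c

omit [IsManifold (𝓡 n) ∞ M] in
lemma chartVec_eq_sum (y c : EuclideanSpace ℝ (Fin n)) :
    chartVec φ y c = ∑ i, c i • coordVec φ i y := by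
  have hc : c = ∑ i, c i • (EuclideanSpace.single i 1 : EuclideanSpace ℝ (Fin n)) := by
    ext j
    simp [Finset.sum_apply, Pi.single_apply]
  let D : EuclideanSpace ℝ (Fin n) →L[ℝ] EuclideanSpace ℝ (Fin n) :=
    mfderiv (𝓡 n) (𝓡 n) φ.symm y
  have h : D c = ∑ i, c i • D (EuclideanSpace.single i 1) := by
    conv_lhs => rw [hc, map_sum]
    simp only [map_smul]
  exact h

lemma inner_chartVec (y c : EuclideanSpace ℝ (Fin n)) :
    g.inner (φ.symm y) (chartVec φ y c) (chartVec φ y c) = ∑ i, ∑ j, gMat g φ y i j * c i * c j := by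
  rw [chartVec_eq_sum]
  simp only [map_sum, map_smul, sum_apply, smul_apply, smul_eq_mul, gMat, Matrix.of_apply,
    Finset.mul_sum]
  rw [Finset.sum_comm]
  refine Finset.sum_congr rfl fun i _ => Finset.sum_congr rfl fun j _ => ?_
  ring

lemma gMat_symm (y : EuclideanSpace ℝ (Fin n)) (i j : Fin n) : gMat g φ y i j = gMat g φ y j i :=
  g.symm _ _ _

lemma posDef_gMat (hφ : φ ∈ IsManifold.maximalAtlas (𝓡 n) ∞ M) {y : EuclideanSpace ℝ (Fin n)}
    (hy : y ∈ φ.target) : (gMat g φ y).PosDef := by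
  refine Matrix.PosDef.of_dotProduct_mulVec_pos ?_ ?_
  · ext i j
    simp only [Matrix.conjTranspose_apply, star_trivial]
    exact gMat_symm g y j i
  · intro c hc
    have hinj := (mdifferentiable_of_mem_maximalAtlas hφ).symm.mfderiv_injective (x := y) hy
    have hne : chartVec φ y (WithLp.toLp 2 c) ≠ 0 := by
      intro h
      apply hc
      have : (WithLp.toLp 2 c : EuclideanSpace ℝ (Fin n)) = 0 := by
        apply hinj
        refine Eq.trans h ?_
        exact (map_zero (mfderiv (𝓡 n) (𝓡 n) φ.symm y)).symm
      funext i
      simpa using congrArg (fun v : EuclideanSpace ℝ (Fin n) => v i) this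
    have := g.pos _ _ hne
    rw [inner_chartVec] at this
    simp only [dotProduct, Matrix.mulVec, star_trivial, Pi.star_apply, Finset.mul_sum]
    refine this.trans_eq (Finset.sum_congr rfl fun i _ => Finset.sum_congr rfl fun j _ => ?_)
    simp; ring

end Chart

/-! ### The length of the gradient -/

section GradNorm

open Matrix

/-- The Cauchy–Schwarz inequality for the pairing of a vector and a covector. -/
lemma dotProduct_sq_le_of_posDef {n : ℕ} {g : Matrix (Fin n) (Fin n) ℝ} (hg : g.PosDef)
    (c v : Fin n → ℝ) : (c ⬝ᵥ v) ^ 2 ≤ (c ⬝ᵥ g *ᵥ c) * (v ⬝ᵥ g⁻¹ *ᵥ v) := by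
  obtain ⟨T, -, h1, h2, -⟩ := exists_simultaneous_diagonalization hg (U := 0) (by simp)
  have h3 : T * (Tᵀ * g) = 1 := mul_eq_one_comm.1 h1
  have h4 : gᵀ * T * Tᵀ = 1 := by
    have := congrArg transpose h3
    simpa [transpose_mul, Matrix.mul_assoc] using this
  have hsymm : gᵀ = g := by
    have := hg.1
    rwa [IsHermitian, conjTranspose_eq_transpose_of_trivial] at this
  have e1 : c ⬝ᵥ v = ((Tᵀ * g) *ᵥ c) ⬝ᵥ (Tᵀ *ᵥ v) := by
    rw [dotProduct_mulVec, vecMul_mulVec]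
    simp [transpose_mul, h4]
  have e2 : c ⬝ᵥ g *ᵥ c = ((Tᵀ * g) *ᵥ c) ⬝ᵥ ((Tᵀ * g) *ᵥ c) := by
    have : (Tᵀ * g)ᵀ * (Tᵀ * g) = g := by
      rw [transpose_mul, transpose_transpose, hsymm, Matrix.mul_assoc, h3, Matrix.mul_one]
    rw [dotProduct_mulVec ((Tᵀ * g) *ᵥ c), vecMul_mulVec, this, ← dotProduct_mulVec]
  have e3 : v ⬝ᵥ g⁻¹ *ᵥ v = (Tᵀ *ᵥ v) ⬝ᵥ (Tᵀ *ᵥ v) := by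
    rw [dotProduct_mulVec (Tᵀ *ᵥ v), vecMul_mulVec, transpose_transpose, h2, ← dotProduct_mulVec]
  rw [e1, e2, e3]
  simp only [dotProduct]
  have := Finset.sum_mul_sq_le_sq_mul_sq Finset.univ ((Tᵀ * g) *ᵥ c) (Tᵀ *ᵥ v)
  simpa only [sq] using this

variable {n : ℕ} {M : Type*} [TopologicalSpace M] [ChartedSpace (EuclideanSpace ℝ (Fin n)) M]
  [IsManifold (𝓡 n) ∞ M]

variable (g : Metric n M) {φ : OpenPartialHomeomorph M (EuclideanSpace ℝ (Fin n))}

lemma gradSq_eq_dotProduct (u : M → ℝ) (y : EuclideanSpace ℝ (Fin n)) :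
    gradSq g φ u y = duVec φ u y ⬝ᵥ (gMat g φ y)⁻¹ *ᵥ duVec φ u y := by
  simp only [gradSq, dotProduct, mulVec, Finset.mul_sum]
  exact Finset.sum_congr rfl fun i _ => Finset.sum_congr rfl fun j _ => by ring

lemma fderiv_apply_eq_sum_pd (f : EuclideanSpace ℝ (Fin n) → ℝ) (y c : EuclideanSpace ℝ (Fin n)) :
    fderiv ℝ f y c = ∑ i, c i * pd i f y := by
  have hc : c = ∑ i, c i • (EuclideanSpace.single i 1 : EuclideanSpace ℝ (Fin n)) := by
    ext j
    simp [Finset.sum_apply, Pi.single_apply]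
  conv_lhs => rw [hc, map_sum]
  simp only [map_smul, smul_eq_mul, pd]

omit [IsManifold (𝓡 n) ∞ M] in
lemma mvfderiv_chartVec (hφ : φ ∈ IsManifold.maximalAtlas (𝓡 n) ∞ M)
    {y : EuclideanSpace ℝ (Fin n)} (hy : y ∈ φ.target) {u : M → ℝ}
    (hu : MDifferentiableAt (𝓡 n) 𝓘(ℝ, ℝ) u (φ.symm y)) (c : EuclideanSpace ℝ (Fin n)) :
    mvfderiv (𝓡 n) u (φ.symm y) (chartVec φ y c) = ∑ i, c i * duVec φ u y i := by
  have h1 := (mdifferentiable_of_mem_maximalAtlas hφ).mdifferentiableAt_symm hy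
  have h2 := mfderiv_comp y hu h1
  have h3 : fderiv ℝ (fun z => u (φ.symm z)) y c = ∑ i, c i * duVec φ u y i :=
    fderiv_apply_eq_sum_pd _ y c
  rw [← h3, ← mfderiv_eq_fderiv]
  change _ = (mfderiv (𝓡 n) 𝓘(ℝ, ℝ) (u ∘ φ.symm) y) c
  rw [h2]
  rfl

omit [IsManifold (𝓡 n) ∞ M] in
lemma chartVec_surjective (hφ : φ ∈ IsManifold.maximalAtlas (𝓡 n) ∞ M)
    {y : EuclideanSpace ℝ (Fin n)} (hy : y ∈ φ.target) :
    Function.Surjective (chartVec φ y) :=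
  (mdifferentiable_of_mem_maximalAtlas hφ).symm.mfderiv_surjective (x := y) hy

lemma inner_chartVec_eq_dotProduct (y : EuclideanSpace ℝ (Fin n)) (c : Fin n → ℝ) :
    g.inner (φ.symm y) (chartVec φ y (WithLp.toLp 2 c)) (chartVec φ y (WithLp.toLp 2 c)) =
      c ⬝ᵥ gMat g φ y *ᵥ c := by
  rw [inner_chartVec]
  simp only [dotProduct, mulVec, Finset.mul_sum]
  exact Finset.sum_congr rfl fun i _ => Finset.sum_congr rfl fun j _ => by ring

lemma gMat_mulVec_inv_mulVec (hφ : φ ∈ IsManifold.maximalAtlas (𝓡 n) ∞ M)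
    {y : EuclideanSpace ℝ (Fin n)} (hy : y ∈ φ.target) (v : Fin n → ℝ) :
    gMat g φ y *ᵥ ((gMat g φ y)⁻¹ *ᵥ v) = v := by
  have hd : IsUnit (gMat g φ y).det := (isUnit_iff_isUnit_det _).1 (posDef_gMat g hφ hy).isUnit
  rw [mulVec_mulVec, mul_nonsing_inv _ hd, one_mulVec]

lemma gradSq_nonneg (hφ : φ ∈ IsManifold.maximalAtlas (𝓡 n) ∞ M)
    {y : EuclideanSpace ℝ (Fin n)} (hy : y ∈ φ.target) (u : M → ℝ) : 0 ≤ gradSq g φ u y := by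
  rw [gradSq_eq_dotProduct]
  have := (posDef_gMat g hφ hy).inv.posSemidef.dotProduct_mulVec_nonneg (duVec φ u y)
  simpa using this

/-- The bound of `df` on the gradient of another function that `|∇f| ≤ B` provides. -/
lemma abs_sum_mul_duVec_le (hφ : φ ∈ IsManifold.maximalAtlas (𝓡 n) ∞ M)
    {y : EuclideanSpace ℝ (Fin n)} (hy : y ∈ φ.target) {f : M → ℝ}
    (hf : MDifferentiableAt (𝓡 n) 𝓘(ℝ, ℝ) f (φ.symm y)) {B : ℝ≥0}
    (hB : gradNorm g f (φ.symm y) ≤ B) (u : M → ℝ) :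
    |∑ i, ((gMat g φ y)⁻¹ *ᵥ duVec φ u y) i * duVec φ f y i| ≤ B * Real.sqrt (gradSq g φ u y) := by
  set q := (gMat g φ y)⁻¹ *ᵥ duVec φ u y with hq
  set w := gradSq g φ u y with hw
  have hw0 : 0 ≤ w := gradSq_nonneg g hφ hy u
  have hqq : q ⬝ᵥ gMat g φ y *ᵥ q = w := by
    rw [hq, gMat_mulVec_inv_mulVec g hφ hy, hw, gradSq_eq_dotProduct, dotProduct_comm]
  rcases hw0.eq_or_lt with h0 | hpos
  · have h1 := dotProduct_sq_le_of_posDef (posDef_gMat g hφ hy) q (duVec φ f y)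
    rw [hqq, ← h0, zero_mul] at h1
    have h2 : q ⬝ᵥ duVec φ f y = 0 := by nlinarith [sq_nonneg (q ⬝ᵥ duVec φ f y)]
    simp only [dotProduct] at h2
    rw [h2, ← h0]; simp
  · have hs : 0 < Real.sqrt w := Real.sqrt_pos.2 hpos
    have h1 : ‖mvfderiv (𝓡 n) f (φ.symm y)
        (chartVec φ y (WithLp.toLp 2 ((Real.sqrt w)⁻¹ • q)))‖ₑ ≤ (B : ℝ≥0∞) := by
      refine le_trans ?_ hB
      refine le_iSup₂_of_le (chartVec φ y (WithLp.toLp 2 ((Real.sqrt w)⁻¹ • q))) ?_ le_rfl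
      rw [inner_chartVec_eq_dotProduct, mulVec_smul, dotProduct_smul, smul_dotProduct, hqq]
      simp only [smul_eq_mul]
      rw [← mul_assoc, ← mul_inv, Real.mul_self_sqrt hw0, inv_mul_cancel₀ hpos.ne']
    rw [mvfderiv_chartVec hφ hy hf] at h1
    have h2 : |∑ i, (Real.sqrt w)⁻¹ * q i * duVec φ f y i| ≤ B := by
      rw [Real.enorm_eq_ofReal_abs] at h1
      simpa [ENNReal.ofReal_le_coe] using h1
    have h3 : ∑ i, (Real.sqrt w)⁻¹ * q i * duVec φ f y i =
        (Real.sqrt w)⁻¹ * ∑ i, q i * duVec φ f y i := by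
      rw [Finset.mul_sum]; exact Finset.sum_congr rfl fun i _ => by ring
    rw [h3, abs_mul, abs_of_pos (inv_pos.2 hs)] at h2
    rw [inv_mul_le_iff₀ hs] at h2
    linarith

/-- In any chart the length of the differential is `(g^{ij} u_i u_j)^{1/2}`. -/
lemma gradNorm_eq_sqrt_gradSq (hφ : φ ∈ IsManifold.maximalAtlas (𝓡 n) ∞ M)
    {y : EuclideanSpace ℝ (Fin n)} (hy : y ∈ φ.target) {u : M → ℝ}
    (hu : MDifferentiableAt (𝓡 n) 𝓘(ℝ, ℝ) u (φ.symm y)) :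
    gradNorm g u (φ.symm y) = ENNReal.ofReal (Real.sqrt (gradSq g φ u y)) := by
  have hg := posDef_gMat g hφ hy
  have hw0 : 0 ≤ gradSq g φ u y := gradSq_nonneg g hφ hy u
  have hle : gradNorm g u (φ.symm y) ≤ ENNReal.ofReal (Real.sqrt (gradSq g φ u y)) := by
    refine iSup₂_le fun v hv => ?_
    obtain ⟨c, rfl⟩ := chartVec_surjective hφ hy v
    have hc : chartVec φ y c = chartVec φ y (WithLp.toLp 2 (c : Fin n → ℝ)) := rfl
    rw [hc, inner_chartVec_eq_dotProduct] at hv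
    rw [mvfderiv_chartVec hφ hy hu, Real.enorm_eq_ofReal_abs]
    refine ENNReal.ofReal_le_ofReal (Real.abs_le_sqrt ?_)
    have h1 := dotProduct_sq_le_of_posDef hg c (duVec φ u y)
    rw [← gradSq_eq_dotProduct] at h1
    exact h1.trans (mul_le_of_le_one_left hw0 hv)
  refine le_antisymm hle ?_
  -- the supremum is attained in the direction of the gradient
  have hfin : gradNorm g u (φ.symm y) ≠ ⊤ := ne_top_of_le_ne_top ENNReal.ofReal_ne_top hle
  have h1 := abs_sum_mul_duVec_le g hφ hy hu (B := (gradNorm g u (φ.symm y)).toNNReal)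
    (by rw [ENNReal.coe_toNNReal hfin]) u
  have h2 : ∑ i, ((gMat g φ y)⁻¹ *ᵥ duVec φ u y) i * duVec φ u y i = gradSq g φ u y := by
    rw [gradSq_eq_dotProduct, dotProduct_comm]; rfl
  rw [h2, abs_of_nonneg hw0] at h1
  have h3 : Real.sqrt (gradSq g φ u y) ≤ (gradNorm g u (φ.symm y)).toNNReal := by
    rcases hw0.eq_or_lt with h0 | hpos
    · rw [← h0, Real.sqrt_zero]; positivity
    · have hs : 0 < Real.sqrt (gradSq g φ u y) := Real.sqrt_pos.2 hpos
      refine le_of_mul_le_mul_right ?_ hs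
      rwa [Real.mul_self_sqrt hw0]
  calc ENNReal.ofReal (Real.sqrt (gradSq g φ u y))
      ≤ ENNReal.ofReal ((gradNorm g u (φ.symm y)).toNNReal : ℝ) := ENNReal.ofReal_le_ofReal h3
    _ = _ := by rw [ENNReal.ofReal_coe_nnreal, ENNReal.coe_toNNReal hfin]

end GradNorm

/-! ### Partial derivatives -/

section PartialDerivatives

variable {n : ℕ} {f f₁ f₂ : EuclideanSpace ℝ (Fin n) → ℝ} {y : EuclideanSpace ℝ (Fin n)}
  {O : Set (EuclideanSpace ℝ (Fin n))}

lemma pd_mul (i : Fin n) (h₁ : DifferentiableAt ℝ f₁ y) (h₂ : DifferentiableAt ℝ f₂ y) :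
    pd i (fun z => f₁ z * f₂ z) y = pd i f₁ y * f₂ y + f₁ y * pd i f₂ y := by
  simp only [pd]
  rw [fderiv_fun_mul h₁ h₂]
  simp
  ring

lemma pd_const_mul (i : Fin n) (c : ℝ) (h : DifferentiableAt ℝ f y) :
    pd i (fun z => c * f z) y = c * pd i f y := by
  simp only [pd]
  rw [fderiv_const_mul h]
  simp

lemma pd_sum {ι : Type*} (i : Fin n) {s : Finset ι} {F : ι → EuclideanSpace ℝ (Fin n) → ℝ}
    (h : ∀ a ∈ s, DifferentiableAt ℝ (F a) y) :
    pd i (fun z => ∑ a ∈ s, F a z) y = ∑ a ∈ s, pd i (F a) y := by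
  simp only [pd]
  rw [fderiv_fun_sum h]
  simp

lemma pd_congr (i : Fin n) (h : f₁ =ᶠ[nhds y] f₂) : pd i f₁ y = pd i f₂ y := by
  simp only [pd, h.fderiv_eq]

lemma contDiffOn_pd {m m' : ℕ∞ω} (hO : IsOpen O) (hf : ContDiffOn ℝ m' f O)
    (hm : m + 1 ≤ m') (i : Fin n) : ContDiffOn ℝ m (pd i f) O :=
  (hf.fderiv_of_isOpen hO hm).clm_apply contDiffOn_const

/-- Partial derivatives of a `C²` function commute. -/
lemma pd_comm (hO : IsOpen O) (hf : ContDiffOn ℝ 2 f O) (hy : y ∈ O) (i j : Fin n) :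
    pd i (pd j f) y = pd j (pd i f) y := by
  have hat : ContDiffAt ℝ 2 f y := hf.contDiffAt (hO.mem_nhds hy)
  have hsymm : IsSymmSndFDerivAt ℝ f y := hat.isSymmSndFDerivAt (by simp)
  have hd : DifferentiableAt ℝ (fderiv ℝ f) y :=
    (hat.fderiv_right (m := 1) (by norm_num)).differentiableAt (by norm_num)
  have key : ∀ a b : Fin n, pd a (pd b f) y =
      fderiv ℝ (fderiv ℝ f) y (EuclideanSpace.single a 1) (EuclideanSpace.single b 1) := by
    intro a b
    unfold pd
    rw [fderiv_clm_apply hd (differentiableAt_const _)]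
    simp
  rw [key, key]
  exact hsymm _ _

end PartialDerivatives

/-! ### Smoothness and symmetry of the tensors -/

section Tensors

open Matrix

variable {n : ℕ} {M : Type*} [TopologicalSpace M] [ChartedSpace (EuclideanSpace ℝ (Fin n)) M]

omit [ChartedSpace (EuclideanSpace ℝ (Fin n)) M] in
lemma contDiffOn_matrix_det {A : EuclideanSpace ℝ (Fin n) → Matrix (Fin n) (Fin n) ℝ}
    {O : Set (EuclideanSpace ℝ (Fin n))} (hA : ∀ i j, ContDiffOn ℝ ∞ (fun y => A y i j) O) :
    ContDiffOn ℝ ∞ (fun y => (A y).det) O := by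
  simp only [Matrix.det_apply']
  exact ContDiffOn.sum fun σ _ => contDiffOn_const.mul (contDiffOn_prod fun i _ => hA _ _)

lemma contDiffOn_matrix_inv {A : EuclideanSpace ℝ (Fin n) → Matrix (Fin n) (Fin n) ℝ}
    {O : Set (EuclideanSpace ℝ (Fin n))} (hA : ∀ i j, ContDiffOn ℝ ∞ (fun y => A y i j) O)
    (hdet : ∀ y ∈ O, (A y).det ≠ 0) (i j : Fin n) :
    ContDiffOn ℝ ∞ (fun y => (A y)⁻¹ i j) O := by
  have h1 : ContDiffOn ℝ ∞ (fun y => (A y).adjugate i j) O := by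
    simp only [Matrix.adjugate_apply]
    refine contDiffOn_matrix_det fun a b => ?_
    by_cases h : a = j
    · subst h
      simp only [Matrix.updateRow_self]
      exact contDiffOn_const
    · simp only [Matrix.updateRow_ne h]
      exact hA a b
  have h2 := (contDiffOn_matrix_det hA).inv hdet
  refine (h2.mul h1).congr fun y hy => ?_
  rw [Matrix.inv_def, Matrix.smul_apply, smul_eq_mul, Ring.inverse_eq_inv']
  rfl

variable [IsManifold (𝓡 n) ∞ M]

variable (g : Metric n M) {φ : OpenPartialHomeomorph M (EuclideanSpace ℝ (Fin n))}

lemma contDiffOn_gInv (hφ : φ ∈ IsManifold.maximalAtlas (𝓡 n) ∞ M) (i j : Fin n) :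
    ContDiffOn ℝ ∞ (fun y => (gMat g φ y)⁻¹ i j) φ.target :=
  contDiffOn_matrix_inv (contDiffOn_gMat g hφ) (fun _ hy => (posDef_gMat g hφ hy).det_pos.ne') i j

lemma contDiffOn_christoffel (hφ : φ ∈ IsManifold.maximalAtlas (𝓡 n) ∞ M) (m i j : Fin n) :
    ContDiffOn ℝ ∞ (christoffel g φ m i j) φ.target := by
  have hd : ∀ a b c, ContDiffOn ℝ ∞ (pd a (fun z => gMat g φ z b c)) φ.target := fun a b c =>
    contDiffOn_pd φ.open_target (contDiffOn_gMat g hφ b c) (by simp) a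
  unfold christoffel
  exact contDiffOn_const.mul (ContDiffOn.sum fun l _ =>
    (contDiffOn_gInv g hφ m l).mul (((hd _ _ _).add (hd _ _ _)).sub (hd _ _ _)))

lemma contDiffOn_ricMat (hφ : φ ∈ IsManifold.maximalAtlas (𝓡 n) ∞ M) (i j : Fin n) :
    ContDiffOn ℝ ∞ (fun y => ricMat g φ y i j) φ.target := by
  have hc := contDiffOn_christoffel g hφ
  have hd : ∀ a b c d, ContDiffOn ℝ ∞ (pd a (christoffel g φ b c d)) φ.target := fun a b c d =>
    contDiffOn_pd φ.open_target (hc b c d) (by simp) a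
  simp only [ricMat, Matrix.of_apply]
  exact (ContDiffOn.sum fun m _ => (hd _ _ _ _).sub (hd _ _ _ _)).add
    (ContDiffOn.sum fun m _ => ContDiffOn.sum fun l _ =>
      ((hc _ _ _).mul (hc _ _ _)).sub ((hc _ _ _).mul (hc _ _ _)))

lemma contDiffOn_schoutenMat (hφ : φ ∈ IsManifold.maximalAtlas (𝓡 n) ∞ M) (τ : ℝ) (i j : Fin n) :
    ContDiffOn ℝ ∞ (fun y => schoutenMat g φ τ y i j) φ.target := by
  have hs : ContDiffOn ℝ ∞ (scal g φ) φ.target := by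
    unfold scal
    exact ContDiffOn.sum fun a _ => ContDiffOn.sum fun b _ =>
      (contDiffOn_gInv g hφ a b).mul (contDiffOn_ricMat g hφ a b)
  simp only [schoutenMat, Matrix.smul_apply, Matrix.sub_apply, smul_eq_mul]
  exact contDiffOn_const.mul ((contDiffOn_ricMat g hφ i j).sub
    (((contDiffOn_const.mul hs).div_const _).mul (contDiffOn_gMat g hφ i j)))

omit [IsManifold (𝓡 n) ∞ M] in
lemma contDiffOn_comp_symm (hφ : φ ∈ IsManifold.maximalAtlas (𝓡 n) ∞ M) {u : M → ℝ} {m : ℕ∞ω}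
    (hm : m ≤ (∞ : ℕ∞ω)) (hu : ContMDiff (𝓡 n) 𝓘(ℝ, ℝ) m u) :
    ContDiffOn ℝ m (fun z => u (φ.symm z)) φ.target := by
  rw [← contMDiffOn_iff_contDiffOn]
  exact hu.comp_contMDiffOn ((contMDiffOn_symm_of_mem_maximalAtlas hφ).of_le hm)

lemma gInv_symm (y : EuclideanSpace ℝ (Fin n)) (i j : Fin n) :
    (gMat g φ y)⁻¹ i j = (gMat g φ y)⁻¹ j i := by
  have h : (gMat g φ y)ᵀ = gMat g φ y := by ext a b; exact gMat_symm g y b a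
  have h2 : ((gMat g φ y)⁻¹)ᵀ = (gMat g φ y)⁻¹ := by rw [transpose_nonsing_inv, h]
  exact congrFun (congrFun h2 j) i

lemma christoffel_symm (m i j : Fin n) (y : EuclideanSpace ℝ (Fin n)) :
    christoffel g φ m i j y = christoffel g φ m j i y := by
  simp only [christoffel]
  congr 1
  refine Finset.sum_congr rfl fun l _ => ?_
  have : (fun z => gMat g φ z i j) = fun z => gMat g φ z j i := by
    funext z; exact gMat_symm g z i j
  rw [this]
  ring

/-- The contraction `Γ^m_{im} = ½ g^{ml} ∂_i g_{ml}` of the Christoffel symbols. -/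
lemma sum_christoffel_contract (i : Fin n) (y : EuclideanSpace ℝ (Fin n)) :
    ∑ m, christoffel g φ m i m y =
      (1 / 2) * ∑ m, ∑ l, (gMat g φ y)⁻¹ m l * pd i (fun z => gMat g φ z m l) y := by
  simp only [christoffel]
  rw [← Finset.mul_sum]
  congr 1
  have h1 : ∑ m, ∑ l, (gMat g φ y)⁻¹ m l * pd l (fun z => gMat g φ z i m) y =
      ∑ m, ∑ l, (gMat g φ y)⁻¹ m l * pd m (fun z => gMat g φ z i l) y := by
    rw [Finset.sum_comm]
    exact Finset.sum_congr rfl fun m _ => Finset.sum_congr rfl fun l _ => by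
      rw [gInv_symm g y l m]
  have h2 : ∀ m l, (gMat g φ y)⁻¹ m l * (pd i (fun z => gMat g φ z m l) y
      + pd m (fun z => gMat g φ z i l) y - pd l (fun z => gMat g φ z i m) y) =
      (gMat g φ y)⁻¹ m l * pd i (fun z => gMat g φ z m l) y +
      ((gMat g φ y)⁻¹ m l * pd m (fun z => gMat g φ z i l) y -
      (gMat g φ y)⁻¹ m l * pd l (fun z => gMat g φ z i m) y) := fun m l => by ring
  simp only [h2, Finset.sum_add_distrib, Finset.sum_sub_distrib, h1, sub_self, add_zero]

/-- The derivative `∂_j(g⁻¹) = -g⁻¹ (∂_j g) g⁻¹`. -/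
lemma pd_gInv (hφ : φ ∈ IsManifold.maximalAtlas (𝓡 n) ∞ M) {y : EuclideanSpace ℝ (Fin n)}
    (hy : y ∈ φ.target) (j : Fin n) :
    (Matrix.of fun a b => pd j (fun z => (gMat g φ z)⁻¹ a b) y) =
      -((gMat g φ y)⁻¹ * (Matrix.of fun a b => pd j (fun z => gMat g φ z a b) y)
        * (gMat g φ y)⁻¹) := by
  have hunit : ∀ z ∈ φ.target, IsUnit (gMat g φ z).det := fun z hz =>
    (isUnit_iff_isUnit_det _).1 (posDef_gMat g hφ hz).isUnit
  have dS : ∀ a b, DifferentiableAt ℝ (fun z => (gMat g φ z)⁻¹ a b) y := fun a b =>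
    ((contDiffOn_gInv g hφ a b).contDiffAt (φ.open_target.mem_nhds hy)).differentiableAt (by simp)
  have dg : ∀ a b, DifferentiableAt ℝ (fun z => gMat g φ z a b) y := fun a b =>
    ((contDiffOn_gMat g hφ a b).contDiffAt (φ.open_target.mem_nhds hy)).differentiableAt (by simp)
  set dSm := (Matrix.of fun a b => pd j (fun z => (gMat g φ z)⁻¹ a b) y) with hdS
  set dgm := (Matrix.of fun a b => pd j (fun z => gMat g φ z a b) y) with hdg
  have h1 : dSm * gMat g φ y + (gMat g φ y)⁻¹ * dgm = 0 := by
    ext a b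
    simp only [Matrix.add_apply, Matrix.mul_apply, hdS, hdg, Matrix.of_apply, Matrix.zero_apply]
    rw [← Finset.sum_add_distrib]
    have h2 : pd j (fun z => ∑ l, (gMat g φ z)⁻¹ a l * gMat g φ z l b) y = 0 := by
      rw [pd_congr (f₂ := fun _ => (1 : Matrix (Fin n) (Fin n) ℝ) a b) j]
      · simp [pd]
      · filter_upwards [φ.open_target.mem_nhds hy] with z hz
        rw [← Matrix.mul_apply, nonsing_inv_mul _ (hunit z hz)]
    rw [pd_sum j fun l _ => (dS a l).fun_mul (dg l b)] at h2
    rw [← h2]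
    exact Finset.sum_congr rfl fun l _ => (pd_mul j (dS a l) (dg l b)).symm
  have h3 : dSm * gMat g φ y * (gMat g φ y)⁻¹ = dSm := by
    rw [Matrix.mul_assoc, mul_nonsing_inv _ (hunit y hy), Matrix.mul_one]
  rw [← h3, eq_neg_of_add_eq_zero_left h1, neg_mul]

/-- The Ricci tensor is symmetric. The only term of its coordinate formula for which this is not
visible is `∂_j Γ^m_{im}`; see `sum_christoffel_contract`. -/
lemma ricMat_symm (hφ : φ ∈ IsManifold.maximalAtlas (𝓡 n) ∞ M) {y : EuclideanSpace ℝ (Fin n)}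
    (hy : y ∈ φ.target) (i j : Fin n) : ricMat g φ y i j = ricMat g φ y j i := by
  have hO := φ.open_target
  have hat : ∀ {f : EuclideanSpace ℝ (Fin n) → ℝ}, ContDiffOn ℝ ∞ f φ.target →
      DifferentiableAt ℝ f y := fun hf =>
    (hf.contDiffAt (hO.mem_nhds hy)).differentiableAt (by simp)
  -- `∂_j Γ^m_{im} = ½ ∂_j (g^{ml} ∂_i g_{ml})` is symmetric in `i` and `j`
  have key : ∀ a b, ∑ m, pd b (christoffel g φ m a m) y =
      (1 / 2) * (∑ m, ∑ l, (gMat g φ y)⁻¹ m l * pd b (pd a (fun z => gMat g φ z m l)) y -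
        ((gMat g φ y)⁻¹ * (Matrix.of fun p q => pd b (fun z => gMat g φ z p q) y)
        * (gMat g φ y)⁻¹ * (Matrix.of fun p q => pd a (fun z => gMat g φ z p q) y)).trace) := by
    intro a b
    have hpd : ∀ m l, ContDiffOn ℝ ∞ (pd a (fun z => gMat g φ z m l)) φ.target := fun m l =>
      contDiffOn_pd hO (contDiffOn_gMat g hφ m l) (by simp) a
    rw [← pd_sum b fun m _ => hat (contDiffOn_christoffel g hφ m a m)]
    simp only [sum_christoffel_contract]
    rw [pd_const_mul _ _ (DifferentiableAt.fun_sum fun m _ => DifferentiableAt.fun_sum fun l _ =>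
      (hat (contDiffOn_gInv g hφ m l)).fun_mul (hat (hpd m l))),
      pd_sum _ (fun m _ => DifferentiableAt.fun_sum fun l _ =>
      (hat (contDiffOn_gInv g hφ m l)).fun_mul (hat (hpd m l)))]
    congr 1
    have h1 : ∀ m, pd b (fun z => ∑ l, (gMat g φ z)⁻¹ m l *
        pd a (fun z => gMat g φ z m l) z) y =
        ∑ l, ((Matrix.of fun a b' => pd b (fun z => (gMat g φ z)⁻¹ a b') y) m l *
          pd a (fun z => gMat g φ z m l) y +
          (gMat g φ y)⁻¹ m l * pd b (pd a (fun z => gMat g φ z m l)) y) := by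
      intro m
      rw [pd_sum _ fun l _ => (hat (contDiffOn_gInv g hφ m l)).fun_mul (hat (hpd m l))]
      exact Finset.sum_congr rfl fun l _ => pd_mul _ (hat (contDiffOn_gInv g hφ m l))
        (hat (hpd m l))
    simp only [h1, Finset.sum_add_distrib]
    rw [pd_gInv g hφ hy b, add_comm, sub_eq_add_neg]
    congr 1
    rw [← Matrix.trace_neg]
    simp only [Matrix.trace, Matrix.diag_apply]
    refine Finset.sum_congr rfl fun m _ => ?_
    rw [Matrix.neg_apply (_ * _), Matrix.mul_apply, ← Finset.sum_neg_distrib]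
    refine Finset.sum_congr rfl fun l _ => ?_
    have : (fun z => gMat g φ z m l) = fun z => gMat g φ z l m := by
      funext z; exact gMat_symm g z m l
    rw [this, Matrix.neg_apply, neg_mul]
    rfl
  have key2 : ∑ m, pd j (christoffel g φ m i m) y = ∑ m, pd i (christoffel g φ m j m) y := by
    rw [key i j, key j i]
    congr 1
    congr 1
    · refine Finset.sum_congr rfl fun m _ => Finset.sum_congr rfl fun l _ => ?_
      rw [pd_comm hO ((contDiffOn_gMat g hφ m l).of_le (by norm_cast)) hy]
    · rw [Matrix.mul_assoc, Matrix.trace_mul_comm, ← Matrix.mul_assoc]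
  simp only [ricMat, Matrix.of_apply, Finset.sum_sub_distrib]
  have h3 : ∀ m, christoffel g φ m i j = christoffel g φ m j i := fun m => by
    funext z; exact christoffel_symm g m i j z
  have h4 : ∑ m, ∑ l, christoffel g φ m j l y * christoffel g φ l i m y =
      ∑ m, ∑ l, christoffel g φ m i l y * christoffel g φ l j m y := by
    rw [Finset.sum_comm]
    exact Finset.sum_congr rfl fun m _ => Finset.sum_congr rfl fun l _ => mul_comm _ _
  rw [key2, h4]
  simp only [h3]

lemma hessMat_symm (hφ : φ ∈ IsManifold.maximalAtlas (𝓡 n) ∞ M) {y : EuclideanSpace ℝ (Fin n)}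
    (hy : y ∈ φ.target) {u : M → ℝ} (hu : ContMDiff (𝓡 n) 𝓘(ℝ, ℝ) 3 u) (i j : Fin n) :
    hessMat g φ u y i j = hessMat g φ u y j i := by
  have hu' := contDiffOn_comp_symm hφ (by norm_cast) hu
  simp only [hessMat, Matrix.of_apply]
  congr 1
  · exact pd_comm φ.open_target (hu'.of_le (by norm_num)) hy i j
  · exact Finset.sum_congr rfl fun m _ => by rw [christoffel_symm]

lemma transpose_UMat (hφ : φ ∈ IsManifold.maximalAtlas (𝓡 n) ∞ M)
    {y : EuclideanSpace ℝ (Fin n)} (hy : y ∈ φ.target) {u : M → ℝ}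
    (hu : ContMDiff (𝓡 n) 𝓘(ℝ, ℝ) 3 u) (τ t : ℝ) :
    (UMat g φ τ t u y)ᵀ = UMat g φ τ t u y := by
  ext i j
  simp only [UMat, schoutenMat, Matrix.transpose_apply, Matrix.add_apply, Matrix.sub_apply,
    Matrix.smul_apply, Matrix.of_apply, smul_eq_mul]
  rw [hessMat_symm g hφ hy hu j i, gMat_symm g y j i, ricMat_symm g hφ hy j i,
    mul_comm (duVec φ u y j)]

end Tensors

/-! ### The inequality at a maximum point, in an orthonormal frame -/

section Scalar

/-- The inequalities of the maximum principle, summed with the weights `f i + a F`. -/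
lemma sum_frame_inequality {n : ℕ} {a b F w p q : ℝ} {f Q V N y e₁ e₂ e₃ z x : Fin n → ℝ}
    (hF : F = ∑ i, f i) (hf : ∀ i, 0 ≤ f i + a * F) (hwy : w = ∑ i, y i ^ 2)
    (hx : ∀ i, x i = V i + a * ∑ j, V j + b * w - y i ^ 2 + e₂ i)
    (hz : ∀ i, z i = Q i + a * ∑ j, Q j - b * (p * w ^ 2) + p * w * y i ^ 2 + e₁ i)
    (hmax : ∀ i, 2 * Q i + 2 * N i + e₃ i + w * q * y i ^ 2 + w * p * V i ≤ 0) :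
    2 * ∑ i, f i * z i + w * p * ∑ i, f i * x i + b * p * w ^ 2 * F + w * q * (a * F * w)
      + w * (q - p) * ∑ i, f i * y i ^ 2 + 2 * ∑ i, (f i + a * F) * N i ≤
    2 * ∑ i, f i * e₁ i - ∑ i, (f i + a * F) * e₃ i + w * p * ∑ i, f i * e₂ i := by
  have hsum : ∑ i, (f i + a * F) * (2 * Q i + 2 * N i + e₃ i + w * q * y i ^ 2 + w * p * V i) ≤ 0 :=
    Finset.sum_nonpos fun i _ => mul_nonpos_of_nonneg_of_nonpos (hf i) (hmax i)
  have weight : ∀ X : Fin n → ℝ, ∑ i, (f i + a * F) * X i = ∑ i, f i * X i + a * F * ∑ i, X i := by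
    intro X
    simp only [add_mul, Finset.sum_add_distrib]
    rw [← Finset.mul_sum]
  have hz' : ∑ i, f i * z i = ∑ i, f i * Q i + F * (a * ∑ j, Q j) - F * (b * (p * w ^ 2))
      + p * w * ∑ i, f i * y i ^ 2 + ∑ i, f i * e₁ i := by
    generalize hS : a * ∑ j, Q j = S at hz
    have : ∀ i, f i * z i =
        f i * Q i + f i * S - f i * (b * (p * w ^ 2)) + p * w * (f i * y i ^ 2) + f i * e₁ i :=
      fun i => by rw [hz i]; ring
    simp only [this, Finset.sum_add_distrib, Finset.sum_sub_distrib]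
    rw [← Finset.mul_sum, ← Finset.sum_mul, ← Finset.sum_mul, ← hF]
  have hx' : ∑ i, f i * x i = ∑ i, f i * V i + F * (a * ∑ j, V j) + F * (b * w)
        - ∑ i, f i * y i ^ 2 + ∑ i, f i * e₂ i := by
    generalize hS : a * ∑ j, V j = S at hx
    have : ∀ i, f i * x i = f i * V i + f i * S + f i * (b * w) - f i * y i ^ 2 + f i * e₂ i :=
      fun i => by rw [hx i]; ring
    simp only [this, Finset.sum_add_distrib, Finset.sum_sub_distrib]
    rw [← Finset.sum_mul, ← Finset.sum_mul, ← hF]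
  have hsplit : ∑ i, (f i + a * F) * (2 * Q i + 2 * N i + e₃ i + w * q * y i ^ 2 + w * p * V i) =
      2 * ∑ i, (f i + a * F) * Q i + 2 * ∑ i, (f i + a * F) * N i + ∑ i, (f i + a * F) * e₃ i
      + w * q * ∑ i, (f i + a * F) * y i ^ 2 + w * p * ∑ i, (f i + a * F) * V i := by
    generalize a * F = S
    simp only [Finset.mul_sum, ← Finset.sum_add_distrib]
    exact Finset.sum_congr rfl fun i _ => by ring
  rw [hsplit, weight Q, weight V, weight fun i => y i ^ 2, ← hwy] at hsum
  rw [hz', hx']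
  linarith

/-- The conclusion of the maximum principle, in terms of components in a frame that is orthonormal
for `g` and diagonalizes `U`. Here `r = |du|` and `ρ = |∂²u|` in the coordinates, `w = |∇u|²`,
`y i`, `V i` are the components of `du`, `∂²u`, and `Q i` those of the derivative of `∂²u` along
`∇u`; `f` is the diagonal of the linearized operator, `x i` and `z i` are the components of `U`
and of its derivative along `∇u`. The numbers `p` and `q` stand for `φ'` and `φ'' - φ'²`, where
`w * exp (φ u)` is the function that is maximal. The term `b p w²` grows like `r⁴`, the sum of the
`N i` controls `ρ²`, and by Young's inequality they absorb the errors, which are `O(r ρ + r³)`. -/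
lemma exists_bound_of_frame_inequalities {n : ℕ} {a b κ c₁ C₂ cN f₀ C₀ C₁ : ℝ} (ha : 0 < a)
    (hb : 0 < b) (hκ : 0 < κ) (hc₁ : 0 < c₁) (hC₂ : 0 ≤ C₂) (hcN : 0 < cN) (hf₀ : 0 < f₀)
    (hC₀ : 0 ≤ C₀) (hC₁ : 0 ≤ C₁) :
    ∃ C : ℝ, ∀ (f Q V N y e₁ e₂ e₃ z x : Fin n → ℝ) (r ρ w p q : ℝ),
      (∀ i, 0 ≤ f i) → f₀ ≤ ∑ i, f i → 1 ≤ r → 0 ≤ ρ → c₁ * r ^ 2 ≤ w → w ≤ C₂ * r ^ 2 →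
      w = ∑ i, y i ^ 2 → κ ≤ p → p ≤ 1 → p ≤ q →
      (∀ i, 0 ≤ N i) → cN * ρ ^ 2 ≤ ∑ i, N i →
      (∀ i, |e₁ i| ≤ C₀ * (r * (ρ + r ^ 2))) → (∀ i, |e₂ i| ≤ C₀ * r) →
      (∀ i, |e₃ i| ≤ C₀ * (r * (ρ + r))) →
      (∀ i, x i = V i + a * ∑ j, V j + b * w - y i ^ 2 + e₂ i) →
      (∀ i, z i = Q i + a * ∑ j, Q j - b * (p * w ^ 2) + p * w * y i ^ 2 + e₁ i) →
      (∀ i, 2 * Q i + 2 * N i + e₃ i + w * q * y i ^ 2 + w * p * V i ≤ 0) →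
      -C₁ ≤ ∑ i, f i * x i → -(C₁ * w) ≤ ∑ i, f i * z i → r ≤ C := by
  set D : ℝ := C₀ * (3 + n * a + C₂) with hD
  set G : ℝ := 3 * C₁ * C₂ / f₀ with hG
  set γ : ℝ := 2 * a * cN with hγ
  have hγ0 : 0 < γ := by positivity
  have hD0 : 0 ≤ D := by positivity
  have hG0 : 0 ≤ G := by positivity
  refine ⟨(D + G + D ^ 2 / (4 * γ)) / (κ * b * c₁ ^ 2), ?_⟩
  intro f Q V N y e₁ e₂ e₃ z x r ρ w p q hf hF hr hρ hw1 hw2 hwy hp hp1 hpq hN hNs he1 he2 he3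
    hx hz hmax hfx hfz
  set F := ∑ i, f i with hFdef
  have hF0 : 0 < F := lt_of_lt_of_le hf₀ hF
  have hr0 : 0 < r := by linarith
  have hp0 : 0 < p := lt_of_lt_of_le hκ hp
  have hw0 : 0 ≤ w := le_trans (by positivity) hw1
  set E : ℝ := r * ρ + r ^ 3 with hE
  have hE0 : 0 ≤ E := by positivity
  have hsum := sum_frame_inequality (a := a) (b := b) hFdef
    (fun i => add_nonneg (hf i) (by positivity)) hwy hx hz hmax
  -- the error terms
  have hr23 : r ^ 2 ≤ r ^ 3 := pow_le_pow_right₀ hr (by norm_num)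
  have hs1 : ∑ i, f i * e₁ i ≤ F * (C₀ * E) := by
    rw [hFdef, Finset.sum_mul]
    refine Finset.sum_le_sum fun i _ => mul_le_mul_of_nonneg_left ?_ (hf i)
    refine (le_abs_self _).trans ((he1 i).trans_eq ?_)
    rw [hE]; ring
  have hs2 : ∑ i, f i * e₂ i ≤ F * (C₀ * r) := by
    rw [hFdef, Finset.sum_mul]
    exact Finset.sum_le_sum fun i _ => mul_le_mul_of_nonneg_left
      ((le_abs_self _).trans (he2 i)) (hf i)
  have hs3 : -((1 + n * a) * F * (C₀ * E)) ≤ ∑ i, (f i + a * F) * e₃ i := by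
    have h1 : ∑ i, (f i + a * F) * -(C₀ * E) ≤ ∑ i, (f i + a * F) * e₃ i := by
      refine Finset.sum_le_sum fun i _ => mul_le_mul_of_nonneg_left ?_
        (add_nonneg (hf i) (by positivity))
      have := (abs_le.1 (he3 i)).1
      refine le_trans (neg_le_neg (mul_le_mul_of_nonneg_left ?_ hC₀)) this
      have h3 : r * (ρ + r) = r * ρ + r ^ 2 := by ring
      rw [hE, h3]; linarith
    have h2 : ∑ i, (f i + a * F) * -(C₀ * E) = -((1 + n * a) * F * (C₀ * E)) := by
      rw [← Finset.sum_mul, Finset.sum_add_distrib, ← hFdef, Finset.sum_const, Finset.card_univ,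
        Fintype.card_fin, nsmul_eq_mul]
      ring
    rwa [h2] at h1
  have hsN : a * F * (cN * ρ ^ 2) ≤ ∑ i, (f i + a * F) * N i := by
    refine (mul_le_mul_of_nonneg_left hNs (by positivity)).trans ?_
    rw [Finset.mul_sum]
    exact Finset.sum_le_sum fun i _ => mul_le_mul_of_nonneg_right
      (by linarith [hf i]) (hN i)
  have hfy : 0 ≤ ∑ i, f i * y i ^ 2 := Finset.sum_nonneg fun i _ => mul_nonneg (hf i) (sq_nonneg _)
  have hwp : 0 ≤ w * p := by positivity
  have hs2' : w * p * ∑ i, f i * e₂ i ≤ C₂ * (F * (C₀ * E)) := by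
    have h1 : w * p * ∑ i, f i * e₂ i ≤ w * p * (F * (C₀ * r)) := mul_le_mul_of_nonneg_left hs2 hwp
    have h2 : w * p ≤ C₂ * r ^ 2 := (mul_le_of_le_one_right hw0 hp1).trans hw2
    have h3 : w * p * (F * (C₀ * r)) ≤ C₂ * r ^ 2 * (F * (C₀ * r)) :=
      mul_le_mul_of_nonneg_right h2 (by positivity)
    have h4 : C₂ * r ^ 2 * (F * (C₀ * r)) ≤ C₂ * (F * (C₀ * E)) := by
      have : C₂ * r ^ 2 * (F * (C₀ * r)) = C₂ * (F * (C₀ * r ^ 3)) := by ring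
      rw [this]
      refine mul_le_mul_of_nonneg_left (mul_le_mul_of_nonneg_left (mul_le_mul_of_nonneg_left ?_ hC₀)
        hF0.le) hC₂
      exact le_add_of_nonneg_left (mul_nonneg hr0.le hρ)
    linarith
  have hfx' : -(C₁ * w) ≤ w * p * ∑ i, f i * x i := by
    have h1 : w * p * -C₁ ≤ w * p * ∑ i, f i * x i := mul_le_mul_of_nonneg_left hfx hwp
    have h2 : w * p * C₁ ≤ w * C₁ := by
      have : w * p ≤ w := mul_le_of_le_one_right hw0 hp1
      exact mul_le_mul_of_nonneg_right this hC₁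
    linarith
  have hqq : 0 ≤ w * (q - p) * ∑ i, f i * y i ^ 2 :=
    mul_nonneg (mul_nonneg hw0 (by linarith)) hfy
  have hqq' : 0 ≤ w * q * (a * F * w) := by
    have : 0 ≤ q := by linarith
    positivity
  have hmain : b * p * w ^ 2 * F + γ * ρ ^ 2 * F ≤ D * F * E + 3 * (C₁ * w) := by
    have hDE : D * F * E = 2 * (F * (C₀ * E)) + (1 + n * a) * F * (C₀ * E)
      + C₂ * (F * (C₀ * E)) := by rw [hD]; ring
    have hγρ : γ * ρ ^ 2 * F = 2 * (a * F * (cN * ρ ^ 2)) := by rw [hγ]; ring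
    rw [hDE, hγρ]
    linarith
  have hGF : 3 * (C₁ * w) ≤ G * r ^ 2 * F := by
    have h1 : 3 * (C₁ * w) ≤ 3 * C₁ * C₂ * r ^ 2 := by
      have := mul_le_mul_of_nonneg_left hw2 hC₁
      linarith
    have h2 : 3 * C₁ * C₂ * r ^ 2 = G * r ^ 2 * f₀ := by rw [hG]; field_simp
    have h3 : G * r ^ 2 * f₀ ≤ G * r ^ 2 * F := mul_le_mul_of_nonneg_left hF (by positivity)
    linarith
  have hw4 : κ * b * c₁ ^ 2 * r ^ 4 ≤ b * p * w ^ 2 := by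
    have h1 : (c₁ * r ^ 2) ^ 2 ≤ w ^ 2 := pow_le_pow_left₀ (by positivity) hw1 2
    calc κ * b * c₁ ^ 2 * r ^ 4 = κ * (b * (c₁ * r ^ 2) ^ 2) := by ring
      _ ≤ p * (b * w ^ 2) := mul_le_mul hp (mul_le_mul_of_nonneg_left h1 hb.le)
          (by positivity) hp0.le
      _ = _ := by ring
  have hdiv : κ * b * c₁ ^ 2 * r ^ 4 + γ * ρ ^ 2 ≤ D * E + G * r ^ 2 := by
    refine le_of_mul_le_mul_right ?_ hF0
    have := mul_le_mul_of_nonneg_right hw4 hF0.le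
    linarith
  have hyoung : D * (r * ρ) ≤ γ * ρ ^ 2 + D ^ 2 / (4 * γ) * r ^ 2 := by
    have h1 : 0 ≤ (2 * γ * ρ - D * r) ^ 2 / (4 * γ) := by positivity
    have h2 : (2 * γ * ρ - D * r) ^ 2 / (4 * γ) =
        γ * ρ ^ 2 + D ^ 2 / (4 * γ) * r ^ 2 - D * (r * ρ) := by
      field_simp; ring
    linarith
  have hfin : κ * b * c₁ ^ 2 * r ^ 4 ≤ (D + G + D ^ 2 / (4 * γ)) * r ^ 3 := by
    have h1 : (G + D ^ 2 / (4 * γ)) * r ^ 2 ≤ (G + D ^ 2 / (4 * γ)) * r ^ 3 :=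
      mul_le_mul_of_nonneg_left hr23 (by positivity)
    rw [hE] at hdiv
    linarith
  rw [le_div_iff₀ (by positivity)]
  refine le_of_mul_le_mul_right ?_ (show 0 < r ^ 3 by positivity)
  have h1 : r * (κ * b * c₁ ^ 2) * r ^ 3 = κ * b * c₁ ^ 2 * r ^ 4 := by ring
  rw [h1]
  exact hfin

end Scalar

/-! ### The derivatives of the data at one point -/

/-- The values at one point, in a chart, of the quantities that enter the estimate: the metric `g`,
its inverse `S`, the tensor `A^τ`, the Christoffel symbols `Γ m i j`, their partial derivatives
(`D` denotes a derivative, whose index comes first), the partial derivatives `v`, `V`, `W` of `u` of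
order `1`, `2`, `3`, the matrix `T` of a frame (its columns are the vectors), and `t`. -/
structure Jet (n : ℕ) where
  g : Fin n → Fin n → ℝ
  S : Fin n → Fin n → ℝ
  A : Fin n → Fin n → ℝ
  T : Fin n → Fin n → ℝ
  V : Fin n → Fin n → ℝ
  Dg : Fin n → Fin n → Fin n → ℝ
  DS : Fin n → Fin n → Fin n → ℝ
  DA : Fin n → Fin n → Fin n → ℝ
  Γ : Fin n → Fin n → Fin n → ℝ
  W : Fin n → Fin n → Fin n → ℝ
  DDS : Fin n → Fin n → Fin n → Fin n → ℝ
  DΓ : Fin n → Fin n → Fin n → Fin n → ℝ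
  v : Fin n → ℝ
  t : ℝ

namespace Jet

variable {n : ℕ} (J : Jet n) (a b : ℝ)

/-- The components of the gradient of `u`. -/
noncomputable def q (k : Fin n) : ℝ := ∑ l, J.S k l * J.v l

/-- `|∇u|²`. -/
noncomputable def w : ℝ := ∑ k, ∑ l, J.S k l * J.v k * J.v l

/-- The size of the first derivatives of `u` in the chart. -/
noncomputable def r : ℝ := ∑ i, |J.v i|

/-- The size of the second derivatives of `u` in the chart. -/
noncomputable def ρ : ℝ := ∑ i, ∑ j, |J.V i j|

/-- The derivative along the gradient of `u` of a quantity with partial derivatives `X k`. -/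
noncomputable def along (X : Fin n → ℝ) : ℝ := ∑ k, J.q k * X k

/-- The derivative of `∂_i u` along the gradient. -/
noncomputable def dv (i : Fin n) : ℝ := J.along fun k => J.V k i

/-- The terms of first order in `u` in the Hessian. -/
noncomputable def Γv (i j : Fin n) : ℝ := ∑ m, J.Γ m i j * J.v m

/-- The derivative of `Γv` along the gradient. -/
noncomputable def dΓv (i j : Fin n) : ℝ :=
  ∑ m, (J.along (fun k => J.DΓ k m i j) * J.v m + J.Γ m i j * J.dv m)

/-- The Hessian of `u`. -/
noncomputable def h (i j : Fin n) : ℝ := J.V i j - J.Γv i j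

/-- The derivative of the second derivatives of `u` along the gradient. -/
noncomputable def dV (i j : Fin n) : ℝ := J.along fun k => J.W k i j

/-- The derivative of the metric along the gradient. -/
noncomputable def dg (i j : Fin n) : ℝ := J.along fun k => J.Dg k i j

/-- The derivative of the inverse metric along the gradient. -/
noncomputable def dS (i j : Fin n) : ℝ := J.along fun k => J.DS k i j

/-- The derivative of `A^τ` along the gradient. -/
noncomputable def dA (i j : Fin n) : ℝ := J.along fun k => J.DA k i j

/-- The Laplacian of `u`. -/
noncomputable def lap : ℝ := ∑ i, ∑ j, J.S i j * J.h i j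

/-- The derivative of the Laplacian along the gradient. -/
noncomputable def dlap : ℝ :=
  ∑ i, ∑ j, (J.dS i j * J.h i j + J.S i j * (J.dV i j - J.dΓv i j))

/-- The derivative of `|∇u|²` along the gradient. -/
noncomputable def dw : ℝ := ∑ k, ∑ l, ((J.dS k l * J.v k + J.S k l * J.dv k) * J.v l
  + J.S k l * J.v k * J.dv l)

/-- The tensor `U^t`, with `a` and `b` in place of `(1-τ)/(n-2)` and `(2-τ)/2`. -/
noncomputable def U (i j : Fin n) : ℝ :=
  J.h i j + a * J.lap * J.g i j + b * J.w * J.g i j - J.v i * J.v j - J.t * J.A i j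
    + (1 - J.t) * J.g i j

/-- The derivative of `U^t` along the gradient. -/
noncomputable def dU (i j : Fin n) : ℝ :=
  (J.dV i j - J.dΓv i j) + (a * J.dlap * J.g i j + a * J.lap * J.dg i j)
    + (b * J.dw * J.g i j + b * J.w * J.dg i j)
    - (J.dv i * J.v j + J.v i * J.dv j) - J.t * J.dA i j + (1 - J.t) * J.dg i j

/-- The diagonal components `X(τ_m, τ_m)` of a bilinear form in the frame. -/
noncomputable def frame (X : Fin n → Fin n → ℝ) (m : Fin n) : ℝ :=
  ∑ i, ∑ j, J.T i m * X i j * J.T j m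

/-- The components of `du` in the frame. -/
noncomputable def y (m : Fin n) : ℝ := ∑ i, J.T i m * J.v i

/-- The derivative of `∂_k u` in the direction of the `m`-th vector of the frame. -/
noncomputable def Vτ (m k : Fin n) : ℝ := ∑ i, J.T i m * J.V i k

/-- The second derivative of `∂_k u` in the direction of the `m`-th vector of the frame. -/
noncomputable def Wτ (m k : Fin n) : ℝ := ∑ i, ∑ j, J.T i m * J.T j m * J.W i j k

/-- The derivative of the inverse metric in the direction of the `m`-th vector of the frame. -/
noncomputable def Sτ (m k l : Fin n) : ℝ := ∑ i, J.T i m * J.DS i k l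

/-- The second derivative of the inverse metric in the direction of the `m`-th vector of the
frame. -/
noncomputable def Sττ (m k l : Fin n) : ℝ := ∑ i, ∑ j, J.T i m * J.T j m * J.DDS i j k l

/-- The quadratic term `|∇_{τ_m} du|²` of the Bochner formula (for coordinate derivatives). -/
noncomputable def N (m : Fin n) : ℝ := ∑ k, ∑ l, J.S k l * J.Vτ m k * J.Vτ m l

/-- The lower order terms of the derivative of `U^t` along the gradient. -/
noncomputable def e₁ (m : Fin n) : ℝ :=
  J.frame (fun i j => ∑ k, ∑ l, J.g i k * J.dS k l * J.U a b l j) m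
    - J.frame J.dΓv m + a * ∑ i, ∑ j, (J.dS i j * J.h i j - J.S i j * J.dΓv i j)
    + (a * J.lap + b * J.w + (1 - J.t)) * J.frame J.dg m
    + (∑ i, J.T i m * ∑ k, ∑ l, J.DS i k l * J.v k * J.v l) * J.y m - J.t * J.frame J.dA m

/-- The lower order terms of `U^t`. -/
noncomputable def e₂ (m : Fin n) : ℝ :=
  -J.frame J.Γv m - a * (∑ i, ∑ j, J.S i j * J.Γv i j) - J.t * J.frame J.A m
    + (1 - J.t) * J.frame J.g m

/-- The lower order terms of the second derivatives of `|∇u|²`. -/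
noncomputable def e₃ (m : Fin n) : ℝ :=
  ∑ k, ∑ l, (J.Sττ m k l * J.v k * J.v l + 4 * (J.Sτ m k l * J.Vτ m k * J.v l))

/-- The jet is bounded by `Λ`, except for the derivatives of `u`, and its frame is orthonormal. -/
structure Bounded (Λ : ℝ) : Prop where
  g_le : ∀ i j, |J.g i j| ≤ Λ
  S_le : ∀ i j, |J.S i j| ≤ Λ
  A_le : ∀ i j, |J.A i j| ≤ Λ
  Dg_le : ∀ k i j, |J.Dg k i j| ≤ Λ
  DS_le : ∀ k i j, |J.DS k i j| ≤ Λ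
  DA_le : ∀ k i j, |J.DA k i j| ≤ Λ
  Γ_le : ∀ m i j, |J.Γ m i j| ≤ Λ
  DDS_le : ∀ k l i j, |J.DDS k l i j| ≤ Λ
  DΓ_le : ∀ k m i j, |J.DΓ k m i j| ≤ Λ
  t_mem : J.t ∈ Set.Icc (0 : ℝ) 1
  S_symm : ∀ i j, J.S i j = J.S j i
  V_symm : ∀ i j, J.V i j = J.V j i
  W_symm : ∀ i j k, J.W i j k = J.W k i j
  frame_g : ∀ m p, ∑ i, ∑ j, J.T i m * J.g i j * J.T j p = if m = p then 1 else 0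
  sum_T : ∀ i j, ∑ m, J.T i m * J.T j m = J.S i j
  sum_gT : ∀ i j, ∑ m, (∑ k, J.g i k * J.T k m) * J.T j m = if i = j then 1 else 0

variable {J a b}

section Identities

variable {Λ : ℝ} (hJ : J.Bounded Λ)

lemma frame_add (X Y : Fin n → Fin n → ℝ) (m : Fin n) :
    J.frame (fun i j => X i j + Y i j) m = J.frame X m + J.frame Y m := by
  simp only [frame, mul_add, add_mul, Finset.sum_add_distrib]

lemma frame_sub (X Y : Fin n → Fin n → ℝ) (m : Fin n) :
    J.frame (fun i j => X i j - Y i j) m = J.frame X m - J.frame Y m := by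
  simp only [frame, mul_sub, sub_mul, Finset.sum_sub_distrib]

lemma frame_const_mul (c : ℝ) (X : Fin n → Fin n → ℝ) (m : Fin n) :
    J.frame (fun i j => c * X i j) m = c * J.frame X m := by
  simp only [frame, Finset.mul_sum]
  exact Finset.sum_congr rfl fun i _ => Finset.sum_congr rfl fun j _ => by ring

lemma frame_mul (X Y : Fin n → ℝ) (m : Fin n) :
    J.frame (fun i j => X i * Y j) m = (∑ i, J.T i m * X i) * ∑ j, J.T j m * Y j := by
  simp only [frame, Finset.sum_mul_sum]
  exact Finset.sum_congr rfl fun i _ => Finset.sum_congr rfl fun j _ => by ring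

include hJ

lemma frame_g_self (m : Fin n) : J.frame J.g m = 1 := by
  have := hJ.frame_g m m
  simpa [frame] using this

/-- The trace with respect to `g` in the frame. -/
lemma sum_S_mul (X : Fin n → Fin n → ℝ) : ∑ i, ∑ j, J.S i j * X i j = ∑ m, J.frame X m := by
  have : ∀ i j, J.S i j * X i j = ∑ m, J.T i m * X i j * J.T j m := by
    intro i j
    rw [← hJ.sum_T i j, Finset.sum_mul]
    exact Finset.sum_congr rfl fun m _ => by ring
  simp only [this, frame]
  rw [Finset.sum_comm' (t' := Finset.univ) (s' := fun _ => Finset.univ) (by simp)]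
  conv_lhs => rw [Finset.sum_comm]
  rw [Finset.sum_comm]
  conv_lhs =>
    enter [2, i]
    rw [Finset.sum_comm]
  rw [Finset.sum_comm]
  conv_rhs =>
    enter [2, m]
    rw [Finset.sum_comm]

lemma w_eq_sum_sq : J.w = ∑ m, J.y m ^ 2 := by
  have h := sum_S_mul hJ fun i j => J.v i * J.v j
  simp only [frame_mul] at h
  rw [w]
  refine Eq.trans ?_ (h.trans ?_)
  · exact Finset.sum_congr rfl fun i _ => Finset.sum_congr rfl fun j _ => by ring
  · exact Finset.sum_congr rfl fun m _ => by rw [y]; ring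

lemma N_eq_sum_sq (m : Fin n) : J.N m = ∑ p, (∑ k, J.T k p * J.Vτ m k) ^ 2 := by
  have h := sum_S_mul hJ fun i j => J.Vτ m i * J.Vτ m j
  simp only [frame_mul] at h
  rw [N]
  refine Eq.trans ?_ (h.trans ?_)
  · exact Finset.sum_congr rfl fun i _ => Finset.sum_congr rfl fun j _ => by ring
  · exact Finset.sum_congr rfl fun m _ => by ring

omit hJ in
lemma sum_q_mul_v : ∑ k, J.q k * J.v k = J.w := by
  simp only [q, w, Finset.sum_mul]
  exact Finset.sum_congr rfl fun k _ => Finset.sum_congr rfl fun l _ => by ring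

/-- The components of `U^t` in the frame. -/
lemma frame_U (m : Fin n) : J.frame (J.U a b) m =
    J.frame J.V m + a * ∑ p, J.frame J.V p + b * J.w - J.y m ^ 2 + J.e₂ a m := by
  have h1 : J.frame J.h m = J.frame J.V m - J.frame J.Γv m := frame_sub _ _ _
  have h2 : J.lap = ∑ p, J.frame J.V p - ∑ i, ∑ j, J.S i j * J.Γv i j := by
    rw [← sum_S_mul hJ]
    simp only [lap, h, mul_sub, Finset.sum_sub_distrib]
  have h3 : J.frame (fun i j => J.v i * J.v j) m = J.y m ^ 2 := by
    rw [frame_mul, sq]; rfl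
  unfold U
  rw [frame_add, frame_sub, frame_sub, frame_add, frame_add, frame_const_mul, frame_const_mul,
    frame_const_mul, frame_const_mul, h1, h2, h3, e₂, frame_g_self hJ]
  ring

/-- At a critical point of the test function `|∇u|²` decreases along the gradient at a rate
proportional to `|∇u|⁴`. -/
lemma dw_eq {p : ℝ}
    (hcrit : ∀ i, ∑ k, ∑ l, J.DS i k l * J.v k * J.v l + 2 * J.dv i = -(p * J.w * J.v i)) :
    J.dw = -(p * J.w ^ 2) := by
  have h1 : ∑ k, ∑ l, J.dS k l * J.v k * J.v l =
      ∑ i, J.q i * ∑ k, ∑ l, J.DS i k l * J.v k * J.v l := by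
    simp only [dS, along, Finset.mul_sum, Finset.sum_mul]
    rw [Finset.sum_comm' (t' := Finset.univ) (s' := fun _ => Finset.univ) (by simp)]
    conv_rhs => rw [Finset.sum_comm]
    conv_rhs =>
      enter [2, k]
      rw [Finset.sum_comm]
    rw [Finset.sum_comm]
    exact Finset.sum_congr rfl fun k _ => Finset.sum_congr rfl fun l _ =>
      Finset.sum_congr rfl fun i _ => by ring
  have h2 : ∑ k, ∑ l, J.S k l * J.dv k * J.v l = ∑ i, J.q i * J.dv i := by
    simp only [q, Finset.sum_mul]
    exact Finset.sum_congr rfl fun k _ => Finset.sum_congr rfl fun l _ => by ring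
  have h3 : ∑ k, ∑ l, J.S k l * J.v k * J.dv l = ∑ i, J.q i * J.dv i := by
    rw [← h2, Finset.sum_comm]
    exact Finset.sum_congr rfl fun k _ => Finset.sum_congr rfl fun l _ => by
      rw [hJ.S_symm]; ring
  have h4 : J.dw = ∑ k, ∑ l, J.dS k l * J.v k * J.v l + ∑ k, ∑ l, J.S k l * J.dv k * J.v l
      + ∑ k, ∑ l, J.S k l * J.v k * J.dv l := by
    simp only [dw, add_mul, Finset.sum_add_distrib]
  have h5 : ∑ i, J.q i * (∑ k, ∑ l, J.DS i k l * J.v k * J.v l + 2 * J.dv i) =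
      -(p * J.w * J.w) := by
    have h7 : ∀ i, J.q i * -(p * J.w * J.v i) = -(p * J.w) * (J.q i * J.v i) := fun i => by ring
    simp only [hcrit, h7]
    rw [← Finset.mul_sum, sum_q_mul_v]
    ring
  have h6 : ∑ i, J.q i * (∑ k, ∑ l, J.DS i k l * J.v k * J.v l + 2 * J.dv i) =
      ∑ i, J.q i * ∑ k, ∑ l, J.DS i k l * J.v k * J.v l + 2 * ∑ i, J.q i * J.dv i := by
    rw [Finset.mul_sum, ← Finset.sum_add_distrib]
    exact Finset.sum_congr rfl fun i _ => by ring
  rw [h4, h1, h2, h3]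
  linarith

/-- The components in the frame of the derivative of `g⁻¹ U^t` along the gradient, at a critical
point of the test function. -/
lemma frame_dU {p : ℝ}
    (hcrit : ∀ i, ∑ k, ∑ l, J.DS i k l * J.v k * J.v l + 2 * J.dv i = -(p * J.w * J.v i))
    (m : Fin n) :
    J.frame (fun i j => (∑ k, ∑ l, J.g i k * J.dS k l * J.U a b l j) + J.dU a b i j) m =
      J.frame J.dV m + a * ∑ s, J.frame J.dV s - b * (p * J.w ^ 2) + p * J.w * J.y m ^ 2
        + J.e₁ a b m := by
  have h2 : J.dlap = ∑ s, J.frame J.dV s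
      + ∑ i, ∑ j, (J.dS i j * J.h i j - J.S i j * J.dΓv i j) := by
    rw [← sum_S_mul hJ, ← Finset.sum_add_distrib]
    refine Finset.sum_congr rfl fun i _ => ?_
    rw [← Finset.sum_add_distrib]
    exact Finset.sum_congr rfl fun j _ => by ring
  have h3 : ∀ i, J.dv i = -(1 / 2) * (p * J.w * J.v i)
      - (1 / 2) * ∑ k, ∑ l, J.DS i k l * J.v k * J.v l := fun i => by linarith [hcrit i]
  have h4 : ∑ i, J.T i m * J.dv i = -(1 / 2) * (p * J.w * J.y m)
      - (1 / 2) * ∑ i, J.T i m * ∑ k, ∑ l, J.DS i k l * J.v k * J.v l := by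
    generalize hX : (fun i => ∑ k, ∑ l, J.DS i k l * J.v k * J.v l) = X at *
    have hX' : ∀ i, ∑ k, ∑ l, J.DS i k l * J.v k * J.v l = X i := fun i => congrFun hX i
    simp only [hX'] at h3 ⊢
    simp only [h3, y, Finset.mul_sum]
    rw [← Finset.sum_sub_distrib]
    exact Finset.sum_congr rfl fun i _ => by ring
  have h5 : J.frame (fun i j => J.dv i * J.v j) m = (∑ i, J.T i m * J.dv i) * J.y m :=
    frame_mul _ _ _
  have h6 : J.frame (fun i j => J.v i * J.dv j) m = J.y m * ∑ i, J.T i m * J.dv i :=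
    frame_mul _ _ _
  unfold dU
  rw [frame_add, frame_add, frame_sub, frame_sub, frame_add, frame_add, frame_add, frame_add,
    frame_add, frame_sub, frame_const_mul, frame_const_mul, frame_const_mul, frame_const_mul,
    frame_const_mul, frame_const_mul, h5, h6, h4, h2, dw_eq hJ hcrit, e₁, frame_g_self hJ]
  ring

/-- The third derivatives in the maximum principle are those in the differentiated equation. -/
lemma sum_S_mul_Wτ (m : Fin n) :
    ∑ k, ∑ l, J.S k l * J.Wτ m k * J.v l = J.frame J.dV m := by
  have h1 : ∑ k, ∑ l, J.S k l * J.Wτ m k * J.v l = ∑ k, J.q k * J.Wτ m k := by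
    simp only [q, Finset.sum_mul]
    exact Finset.sum_congr rfl fun k _ => Finset.sum_congr rfl fun l _ => by ring
  rw [h1]
  simp only [Wτ, frame, dV, along, Finset.mul_sum, Finset.sum_mul]
  rw [Finset.sum_comm]
  refine Finset.sum_congr rfl fun i _ => ?_
  rw [Finset.sum_comm]
  refine Finset.sum_congr rfl fun j _ => Finset.sum_congr rfl fun k _ => ?_
  rw [hJ.W_symm i j k]
  ring

end Identities

end Jet

/-! ### Bounds of the lower order terms -/

namespace Jet

open Asymptotics Filter

/-- The jets with bounded coefficients and not too small first derivatives. The bounds below are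
statements of the form `f = O(g)` on this type. -/
abbrev BddJet (n : ℕ) (Λ : ℝ) : Type := {J : Jet n // J.Bounded Λ ∧ 1 ≤ J.r}

section BigO

variable {ι κ : Type*}

lemma isBigO_top_of_le {f g : ι → ℝ} (hf : ∀ x, 0 ≤ f x) (h : ∀ x, f x ≤ g x) : f =O[⊤] g :=
  isBigO_of_le _ fun x => by
    rw [Real.norm_eq_abs, Real.norm_eq_abs, abs_of_nonneg (hf x)]
    exact (h x).trans (le_abs_self _)

lemma isBigO_one_of_abs_le {f : ι → ℝ} {C : ℝ} (h : ∀ x, |f x| ≤ C) :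
    f =O[⊤] fun _ => (1 : ℝ) :=
  isBigO_top.2 ⟨C, fun x => by simpa using h x⟩

lemma IsBigO.one_mul' {f₁ f₂ g : ι → ℝ} (h₁ : f₁ =O[⊤] fun _ => (1 : ℝ)) (h₂ : f₂ =O[⊤] g) :
    (fun x => f₁ x * f₂ x) =O[⊤] g := by
  simpa using h₁.mul h₂

lemma IsBigO.mul_one' {f₁ f₂ g : ι → ℝ} (h₁ : f₁ =O[⊤] g) (h₂ : f₂ =O[⊤] fun _ => (1 : ℝ)) :
    (fun x => f₁ x * f₂ x) =O[⊤] g := by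
  simpa using h₁.mul h₂

end BigO

variable {n : ℕ} {Λ : ℝ}

lemma r_nonneg (J : Jet n) : 0 ≤ J.r := Finset.sum_nonneg fun _ _ => abs_nonneg _

lemma rho_nonneg (J : Jet n) : 0 ≤ J.ρ :=
  Finset.sum_nonneg fun _ _ => Finset.sum_nonneg fun _ _ => abs_nonneg _

lemma abs_T_le {J : Jet n} (hJ : J.Bounded Λ) (i m : Fin n) : |J.T i m| ≤ Λ + 1 := by
  have h1 : J.T i m * J.T i m ≤ J.S i i := by
    rw [← hJ.sum_T i i]
    exact Finset.single_le_sum (f := fun m => J.T i m * J.T i m)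
      (fun m _ => mul_self_nonneg _) (Finset.mem_univ m)
  have h2 := (le_abs_self _).trans (hJ.S_le i i)
  have h3 : 0 ≤ Λ := (abs_nonneg _).trans (hJ.S_le i i)
  exact abs_le_of_sq_le_sq (by nlinarith) (by linarith)

section Bounds

variable (n Λ)

lemma isBigO_T (i m : Fin n) :
    (fun J : BddJet n Λ => J.1.T i m) =O[⊤] fun _ => (1 : ℝ) :=
  isBigO_one_of_abs_le fun J => abs_T_le J.2.1 i m

lemma isBigO_S (i j : Fin n) :
    (fun J : BddJet n Λ => J.1.S i j) =O[⊤] fun _ => (1 : ℝ) :=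
  isBigO_one_of_abs_le fun J => J.2.1.S_le i j

lemma isBigO_g (i j : Fin n) :
    (fun J : BddJet n Λ => J.1.g i j) =O[⊤] fun _ => (1 : ℝ) :=
  isBigO_one_of_abs_le fun J => J.2.1.g_le i j

lemma isBigO_t : (fun J : BddJet n Λ => J.1.t) =O[⊤] fun _ => (1 : ℝ) :=
  isBigO_one_of_abs_le (C := 1) fun J => by
    rw [abs_of_nonneg J.2.1.t_mem.1]; exact J.2.1.t_mem.2

lemma isBigO_one_sub_t : (fun J : BddJet n Λ => 1 - J.1.t) =O[⊤] fun _ => (1 : ℝ) :=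
  (isBigO_refl _ _).sub (isBigO_t n Λ)

lemma isBigO_v (i : Fin n) : (fun J : BddJet n Λ => J.1.v i) =O[⊤] fun J => J.1.r :=
  isBigO_of_le _ fun J => by
    rw [Real.norm_eq_abs, Real.norm_eq_abs, abs_of_nonneg J.1.r_nonneg]
    exact Finset.single_le_sum (f := fun i => |J.1.v i|) (fun _ _ => abs_nonneg _)
      (Finset.mem_univ i)

lemma isBigO_V (i j : Fin n) : (fun J : BddJet n Λ => J.1.V i j) =O[⊤] fun J => J.1.ρ :=
  isBigO_of_le _ fun J => by
    rw [Real.norm_eq_abs, Real.norm_eq_abs, abs_of_nonneg J.1.rho_nonneg]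
    refine le_trans ?_ (Finset.single_le_sum (f := fun i => ∑ j, |J.1.V i j|)
      (fun _ _ => Finset.sum_nonneg fun _ _ => abs_nonneg _) (Finset.mem_univ i))
    exact Finset.single_le_sum (f := fun j => |J.1.V i j|) (fun _ _ => abs_nonneg _)
      (Finset.mem_univ j)

lemma isBigO_q (k : Fin n) : (fun J : BddJet n Λ => J.1.q k) =O[⊤] fun J => J.1.r :=
  IsBigO.fun_sum fun l _ => IsBigO.one_mul' (isBigO_S n Λ k l) (isBigO_v n Λ l)

lemma isBigO_along_one {X : BddJet n Λ → Fin n → ℝ}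
    (hX : ∀ k, (fun J => X J k) =O[⊤] fun _ => (1 : ℝ)) :
    (fun J : BddJet n Λ => J.1.along (X J)) =O[⊤] fun J => J.1.r :=
  IsBigO.fun_sum fun k _ => IsBigO.mul_one' (isBigO_q n Λ k) (hX k)

lemma isBigO_frame {X : BddJet n Λ → Fin n → Fin n → ℝ} {f : BddJet n Λ → ℝ}
    (hX : ∀ i j, (fun J => X J i j) =O[⊤] f) (m : Fin n) :
    (fun J : BddJet n Λ => J.1.frame (X J) m) =O[⊤] f :=
  IsBigO.fun_sum fun i _ => IsBigO.fun_sum fun j _ =>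
    IsBigO.mul_one' (IsBigO.one_mul' (isBigO_T n Λ i m) (hX i j)) (isBigO_T n Λ j m)

lemma isBigO_dg (i j : Fin n) : (fun J : BddJet n Λ => J.1.dg i j) =O[⊤] fun J => J.1.r :=
  isBigO_along_one n Λ fun k => isBigO_one_of_abs_le fun J => J.2.1.Dg_le k i j

lemma isBigO_dS (i j : Fin n) : (fun J : BddJet n Λ => J.1.dS i j) =O[⊤] fun J => J.1.r :=
  isBigO_along_one n Λ fun k => isBigO_one_of_abs_le fun J => J.2.1.DS_le k i j

lemma isBigO_dA (i j : Fin n) : (fun J : BddJet n Λ => J.1.dA i j) =O[⊤] fun J => J.1.r :=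
  isBigO_along_one n Λ fun k => isBigO_one_of_abs_le fun J => J.2.1.DA_le k i j

lemma isBigO_dv (i : Fin n) : (fun J : BddJet n Λ => J.1.dv i) =O[⊤] fun J => J.1.r * J.1.ρ := by
  unfold dv along
  exact IsBigO.fun_sum fun k _ => (isBigO_q n Λ k).mul (isBigO_V n Λ k i)

lemma isBigO_Γv (i j : Fin n) : (fun J : BddJet n Λ => J.1.Γv i j) =O[⊤] fun J => J.1.r :=
  IsBigO.fun_sum fun m _ => IsBigO.one_mul' (isBigO_one_of_abs_le fun J => J.2.1.Γ_le m i j)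
    (isBigO_v n Λ m)

lemma isBigO_w : (fun J : BddJet n Λ => J.1.w) =O[⊤] fun J => J.1.r ^ 2 := by
  have : (fun J : BddJet n Λ => J.1.w) =O[⊤] fun J => J.1.r * J.1.r :=
    IsBigO.fun_sum fun k _ => IsBigO.fun_sum fun l _ =>
      (IsBigO.one_mul' (isBigO_S n Λ k l) (isBigO_v n Λ k)).mul (isBigO_v n Λ l)
  simpa only [sq] using this

lemma isBigO_r_add : (fun J : BddJet n Λ => J.1.r) =O[⊤] fun J => J.1.ρ + J.1.r :=
  isBigO_top_of_le (fun J => J.1.r_nonneg) fun J => by linarith [J.1.rho_nonneg]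

lemma isBigO_h (i j : Fin n) :
    (fun J : BddJet n Λ => J.1.h i j) =O[⊤] fun J => J.1.ρ + J.1.r :=
  ((isBigO_V n Λ i j).trans (isBigO_top_of_le (fun J => J.1.rho_nonneg) fun J => by
    linarith [J.1.r_nonneg])).sub ((isBigO_Γv n Λ i j).trans (isBigO_r_add n Λ))

lemma isBigO_lap : (fun J : BddJet n Λ => J.1.lap) =O[⊤] fun J => J.1.ρ + J.1.r :=
  IsBigO.fun_sum fun i _ => IsBigO.fun_sum fun j _ => IsBigO.one_mul' (isBigO_S n Λ i j) (isBigO_h n Λ i j)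

lemma r_le_sq (J : BddJet n Λ) : J.1.r ≤ J.1.r ^ 2 := by nlinarith [J.2.2]

lemma one_isBigO_sq : (fun _ : BddJet n Λ => (1 : ℝ)) =O[⊤] fun J => J.1.r ^ 2 :=
  isBigO_top_of_le (fun _ => zero_le_one) fun J => by nlinarith [J.2.2]

lemma one_isBigO_r : (fun _ : BddJet n Λ => (1 : ℝ)) =O[⊤] fun J => J.1.r :=
  isBigO_top_of_le (fun _ => zero_le_one) fun J => J.2.2

lemma add_isBigO : (fun J : BddJet n Λ => J.1.ρ + J.1.r) =O[⊤] fun J => J.1.ρ + J.1.r ^ 2 :=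
  isBigO_top_of_le (fun J => add_nonneg J.1.rho_nonneg J.1.r_nonneg) fun J => by
    linarith [r_le_sq n Λ J]

lemma sq_isBigO : (fun J : BddJet n Λ => J.1.r ^ 2) =O[⊤] fun J => J.1.ρ + J.1.r ^ 2 :=
  isBigO_top_of_le (fun J => sq_nonneg _) fun J => by linarith [J.1.rho_nonneg]

lemma isBigO_U (a b : ℝ) (i j : Fin n) :
    (fun J : BddJet n Λ => J.1.U a b i j) =O[⊤] fun J => J.1.ρ + J.1.r ^ 2 := by
  have hv2 : (fun J : BddJet n Λ => J.1.v i * J.1.v j) =O[⊤] fun J => J.1.r ^ 2 := by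
    simpa only [sq] using (isBigO_v n Λ i).mul (isBigO_v n Λ j)
  have hA : (fun J : BddJet n Λ => J.1.A i j) =O[⊤] fun _ => (1 : ℝ) :=
    isBigO_one_of_abs_le fun J => J.2.1.A_le i j
  have s1 := (one_isBigO_sq n Λ).trans (sq_isBigO n Λ)
  exact ((((((isBigO_h n Λ i j).trans (add_isBigO n Λ)).add
    (IsBigO.mul_one' (((isBigO_lap n Λ).const_mul_left a).trans (add_isBigO n Λ))
      (isBigO_g n Λ i j))).add
    (IsBigO.mul_one' (((isBigO_w n Λ).const_mul_left b).trans (sq_isBigO n Λ))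
      (isBigO_g n Λ i j))).sub (hv2.trans (sq_isBigO n Λ))).sub
    ((IsBigO.one_mul' (isBigO_t n Λ) hA).trans s1)).add
    ((IsBigO.one_mul' (isBigO_one_sub_t n Λ) (isBigO_g n Λ i j)).trans s1)

lemma isBigO_dΓv (i j : Fin n) :
    (fun J : BddJet n Λ => J.1.dΓv i j) =O[⊤] fun J => J.1.r * (J.1.ρ + J.1.r ^ 2) := by
  refine IsBigO.fun_sum fun m _ => IsBigO.add ?_ ?_
  · have h1 : (fun J : BddJet n Λ => J.1.along fun k => J.1.DΓ k m i j) =O[⊤] fun J => J.1.r :=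
      isBigO_along_one n Λ fun k => isBigO_one_of_abs_le fun J => J.2.1.DΓ_le k m i j
    exact h1.mul ((isBigO_v n Λ m).trans ((isBigO_r_add n Λ).trans (add_isBigO n Λ)))
  · refine (IsBigO.one_mul' (isBigO_one_of_abs_le fun J => J.2.1.Γ_le m i j)
      (isBigO_dv n Λ m)).trans ?_
    exact (isBigO_refl _ _).mul (isBigO_top_of_le (fun J => J.1.rho_nonneg) fun J => by
      nlinarith [sq_nonneg J.1.r])

lemma isBigO_y (m : Fin n) : (fun J : BddJet n Λ => J.1.y m) =O[⊤] fun J => J.1.r :=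
  IsBigO.fun_sum fun i _ => IsBigO.one_mul' (isBigO_T n Λ i m) (isBigO_v n Λ i)

lemma isBigO_e₂ (a : ℝ) (m : Fin n) :
    (fun J : BddJet n Λ => J.1.e₂ a m) =O[⊤] fun J => J.1.r := by
  have hA : ∀ i j, (fun J : BddJet n Λ => J.1.A i j) =O[⊤] fun _ => (1 : ℝ) := fun i j =>
    isBigO_one_of_abs_le fun J => J.2.1.A_le i j
  have s1 := one_isBigO_r n Λ
  exact (((isBigO_frame n Λ (fun i j => isBigO_Γv n Λ i j) m).neg_left.sub
    (IsBigO.const_mul_left (IsBigO.fun_sum fun i _ => IsBigO.fun_sum fun j _ =>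
      IsBigO.one_mul' (isBigO_S n Λ i j) (isBigO_Γv n Λ i j)) a)).sub
    ((IsBigO.one_mul' (isBigO_t n Λ) (isBigO_frame n Λ hA m)).trans s1)).add
    ((IsBigO.one_mul' (isBigO_one_sub_t n Λ) (isBigO_frame n Λ (isBigO_g n Λ) m)).trans s1)

lemma isBigO_e₃ (m : Fin n) :
    (fun J : BddJet n Λ => J.1.e₃ m) =O[⊤] fun J => J.1.r * (J.1.ρ + J.1.r) := by
  refine IsBigO.fun_sum fun k _ => IsBigO.fun_sum fun l _ => IsBigO.add ?_ ?_
  · have h1 : (fun J : BddJet n Λ => J.1.Sττ m k l) =O[⊤] fun _ => (1 : ℝ) :=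
      IsBigO.fun_sum fun i _ => IsBigO.fun_sum fun j _ => IsBigO.mul_one'
        (IsBigO.mul_one' (isBigO_T n Λ i m) (isBigO_T n Λ j m))
        (isBigO_one_of_abs_le fun J => J.2.1.DDS_le i j k l)
    exact (IsBigO.one_mul' h1 (isBigO_v n Λ k)).mul ((isBigO_v n Λ l).trans (isBigO_r_add n Λ))
  · refine IsBigO.const_mul_left ?_ 4
    have h1 : (fun J : BddJet n Λ => J.1.Sτ m k l) =O[⊤] fun _ => (1 : ℝ) :=
      IsBigO.fun_sum fun i _ => IsBigO.mul_one' (isBigO_T n Λ i m)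
        (isBigO_one_of_abs_le fun J => J.2.1.DS_le i k l)
    have h2 : (fun J : BddJet n Λ => J.1.Vτ m k) =O[⊤] fun J => J.1.ρ :=
      IsBigO.fun_sum fun i _ => IsBigO.one_mul' (isBigO_T n Λ i m) (isBigO_V n Λ i k)
    have h3 := (IsBigO.one_mul' h1 h2).mul (isBigO_v n Λ l)
    refine h3.trans (isBigO_top_of_le (fun J => mul_nonneg J.1.rho_nonneg J.1.r_nonneg) fun J => ?_)
    nlinarith [sq_nonneg J.1.r]

lemma isBigO_e₁ (a b : ℝ) (m : Fin n) :
    (fun J : BddJet n Λ => J.1.e₁ a b m) =O[⊤] fun J => J.1.r * (J.1.ρ + J.1.r ^ 2) := by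
  have s0 : (fun J : BddJet n Λ => J.1.r) =O[⊤] fun J => J.1.r * (J.1.ρ + J.1.r ^ 2) := by
    simpa using (isBigO_refl (fun J : BddJet n Λ => J.1.r) ⊤).mul
      ((one_isBigO_sq n Λ).trans (sq_isBigO n Λ))
  have t1 : (fun J : BddJet n Λ => J.1.frame
      (fun i j => ∑ k, ∑ l, J.1.g i k * J.1.dS k l * J.1.U a b l j) m) =O[⊤]
      fun J => J.1.r * (J.1.ρ + J.1.r ^ 2) :=
    isBigO_frame n Λ (fun i j => IsBigO.fun_sum fun k _ => IsBigO.fun_sum fun l _ =>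
      (IsBigO.one_mul' (isBigO_g n Λ i k) (isBigO_dS n Λ k l)).mul (isBigO_U n Λ a b l j)) m
  have t2 := isBigO_frame n Λ (isBigO_dΓv n Λ) m
  have t3 : (fun J : BddJet n Λ => a * ∑ i, ∑ j, (J.1.dS i j * J.1.h i j
      - J.1.S i j * J.1.dΓv i j)) =O[⊤] fun J => J.1.r * (J.1.ρ + J.1.r ^ 2) :=
    IsBigO.const_mul_left (IsBigO.fun_sum fun i _ => IsBigO.fun_sum fun j _ =>
      ((isBigO_dS n Λ i j).mul ((isBigO_h n Λ i j).trans (add_isBigO n Λ))).sub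
      (IsBigO.one_mul' (isBigO_S n Λ i j) (isBigO_dΓv n Λ i j))) a
  have t4 : (fun J : BddJet n Λ => (a * J.1.lap + b * J.1.w + (1 - J.1.t)) *
      J.1.frame J.1.dg m) =O[⊤] fun J => J.1.r * (J.1.ρ + J.1.r ^ 2) := by
    have h1 : (fun J : BddJet n Λ => a * J.1.lap + b * J.1.w + (1 - J.1.t)) =O[⊤]
        fun J => J.1.ρ + J.1.r ^ 2 :=
      ((((isBigO_lap n Λ).const_mul_left a).trans (add_isBigO n Λ)).add
        (((isBigO_w n Λ).const_mul_left b).trans (sq_isBigO n Λ))).add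
        ((isBigO_one_sub_t n Λ).trans ((one_isBigO_sq n Λ).trans (sq_isBigO n Λ)))
    have h2 := h1.mul (isBigO_frame n Λ (isBigO_dg n Λ) m)
    exact h2.congr_right fun J => mul_comm _ _
  have t5 : (fun J : BddJet n Λ => (∑ i, J.1.T i m * ∑ k, ∑ l, J.1.DS i k l * J.1.v k * J.1.v l)
      * J.1.y m) =O[⊤] fun J => J.1.r * (J.1.ρ + J.1.r ^ 2) := by
    have h1 : (fun J : BddJet n Λ => ∑ i, J.1.T i m * ∑ k, ∑ l, J.1.DS i k l * J.1.v k * J.1.v l)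
        =O[⊤] fun J => J.1.r * J.1.r :=
      IsBigO.fun_sum fun i _ => IsBigO.one_mul' (isBigO_T n Λ i m) (IsBigO.fun_sum fun k _ =>
        IsBigO.fun_sum fun l _ => (IsBigO.one_mul' (isBigO_one_of_abs_le fun J => J.2.1.DS_le i k l)
          (isBigO_v n Λ k)).mul (isBigO_v n Λ l))
    have h2 : (fun J : BddJet n Λ => J.1.r * J.1.r) =O[⊤] fun J => J.1.ρ + J.1.r ^ 2 := by
      simpa only [sq] using sq_isBigO n Λ
    exact ((h1.trans h2).mul (isBigO_y n Λ m)).congr_right fun J => mul_comm _ _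
  have hdA := isBigO_frame n Λ (isBigO_dA n Λ) m
  exact ((((t1.sub t2).add t3).add t4).add t5).sub
    ((IsBigO.one_mul' (isBigO_t n Λ) hdA).trans s0)

end Bounds

lemma exists_common_bound {ι κ : Type*} [Fintype κ] {f : κ → ι → ℝ} {h : ι → ℝ}
    (hh : ∀ x, 0 ≤ h x) (hf : ∀ m, f m =O[⊤] h) : ∃ C : ℝ, 0 ≤ C ∧ ∀ m x, |f m x| ≤ C * h x := by
  choose C hC using fun m => isBigO_top.1 (hf m)
  refine ⟨∑ m, |C m|, Finset.sum_nonneg fun _ _ => abs_nonneg _, fun m x => ?_⟩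
  have h1 := hC m x
  rw [Real.norm_eq_abs, Real.norm_eq_abs, abs_of_nonneg (hh x)] at h1
  refine h1.trans (mul_le_mul_of_nonneg_right ?_ (hh x))
  exact (le_abs_self _).trans (Finset.single_le_sum (f := fun m => |C m|)
    (fun _ _ => abs_nonneg _) (Finset.mem_univ m))

/-- The lower order terms are of lower order: quadratic terms in `ρ` do not occur in them, and terms
of order zero in `ρ` are at most cubic in `r`. -/
lemma exists_error_bound (n : ℕ) (a b Λ : ℝ) : ∃ C : ℝ, 0 ≤ C ∧ ∀ J : Jet n, J.Bounded Λ →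
    1 ≤ J.r → ∀ m, |J.e₁ a b m| ≤ C * (J.r * (J.ρ + J.r ^ 2)) ∧ |J.e₂ a m| ≤ C * J.r ∧
      |J.e₃ m| ≤ C * (J.r * (J.ρ + J.r)) := by
  have p1 : ∀ J : BddJet n Λ, 0 ≤ J.1.r * (J.1.ρ + J.1.r ^ 2) := fun J =>
    mul_nonneg J.1.r_nonneg (add_nonneg J.1.rho_nonneg (sq_nonneg _))
  have p3 : ∀ J : BddJet n Λ, 0 ≤ J.1.r * (J.1.ρ + J.1.r) := fun J =>
    mul_nonneg J.1.r_nonneg (add_nonneg J.1.rho_nonneg J.1.r_nonneg)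
  obtain ⟨C1, h1, H1⟩ := exists_common_bound p1 (isBigO_e₁ n Λ a b)
  obtain ⟨C2, h2, H2⟩ := exists_common_bound (fun J => J.1.r_nonneg) (isBigO_e₂ n Λ a)
  obtain ⟨C3, h3, H3⟩ := exists_common_bound p3 (isBigO_e₃ n Λ)
  refine ⟨C1 + C2 + C3, by positivity, fun J hJ hr m => ⟨?_, ?_, ?_⟩⟩
  · exact (H1 m ⟨J, hJ, hr⟩).trans (mul_le_mul_of_nonneg_right (by linarith) (p1 ⟨J, hJ, hr⟩))
  · exact (H2 m ⟨J, hJ, hr⟩).trans (mul_le_mul_of_nonneg_right (by linarith) J.r_nonneg)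
  · exact (H3 m ⟨J, hJ, hr⟩).trans (mul_le_mul_of_nonneg_right (by linarith) (p3 ⟨J, hJ, hr⟩))

/-- `|∇u|²` is comparable with the sum of squares of the partial derivatives, and the quadratic term
of the Bochner formula bounds the second derivatives. -/
lemma exists_comparison (n : ℕ) (Λ : ℝ) : ∃ c₁ C₂ cN : ℝ, 0 < c₁ ∧ 0 ≤ C₂ ∧ 0 < cN ∧
    ∀ J : Jet n, J.Bounded Λ → 1 ≤ J.r →
      c₁ * J.r ^ 2 ≤ J.w ∧ J.w ≤ C₂ * J.r ^ 2 ∧ cN * J.ρ ^ 2 ≤ ∑ m, J.N m := by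
  have hgT : ∀ i m, (fun J : BddJet n Λ => ∑ k, J.1.g i k * J.1.T k m) =O[⊤] fun _ => (1 : ℝ) :=
    fun i m => IsBigO.fun_sum fun k _ => IsBigO.mul_one' (isBigO_g n Λ i k) (isBigO_T n Λ k m)
  have hw0 : ∀ J : BddJet n Λ, 0 ≤ J.1.w := fun J => by
    rw [w_eq_sum_sq J.2.1]; exact Finset.sum_nonneg fun _ _ => sq_nonneg _
  have hN0 : ∀ J : BddJet n Λ, 0 ≤ ∑ m, J.1.N m := fun J =>
    Finset.sum_nonneg fun m _ => by
      rw [N_eq_sum_sq J.2.1]; exact Finset.sum_nonneg fun _ _ => sq_nonneg _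
  -- a covector is recovered from its components in the frame
  have expand : ∀ (J : BddJet n Λ) (X : Fin n → ℝ) (i : Fin n),
      X i = ∑ m, (∑ k, J.1.g i k * J.1.T k m) * ∑ j, J.1.T j m * X j := by
    intro J X i
    have h1 : ∀ m, (∑ k, J.1.g i k * J.1.T k m) * ∑ j, J.1.T j m * X j =
        ∑ j, (∑ k, J.1.g i k * J.1.T k m) * J.1.T j m * X j := fun m => by
      rw [Finset.mul_sum]; exact Finset.sum_congr rfl fun j _ => by ring
    simp only [h1]
    rw [Finset.sum_comm]
    simp only [← Finset.sum_mul, J.2.1.sum_gT]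
    simp
  have hr : (fun J : BddJet n Λ => J.1.r) =O[⊤] fun J => Real.sqrt J.1.w := by
    refine IsBigO.fun_sum fun i _ => IsBigO.abs_left ?_
    refine IsBigO.congr_left (f₁ := fun J : BddJet n Λ =>
      ∑ m, (∑ k, J.1.g i k * J.1.T k m) * J.1.y m) ?_ fun J => (expand J J.1.v i).symm
    refine IsBigO.fun_sum fun m _ => IsBigO.one_mul' (hgT i m) (isBigO_of_le _ fun J => ?_)
    rw [Real.norm_eq_abs, Real.norm_eq_abs, abs_of_nonneg (Real.sqrt_nonneg _)]
    refine Real.abs_le_sqrt ?_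
    rw [w_eq_sum_sq J.2.1]
    exact Finset.single_le_sum (f := fun m => J.1.y m ^ 2) (fun _ _ => sq_nonneg _)
      (Finset.mem_univ m)
  have hρ : (fun J : BddJet n Λ => J.1.ρ) =O[⊤] fun J => Real.sqrt (∑ m, J.1.N m) := by
    refine IsBigO.fun_sum fun i _ => IsBigO.fun_sum fun j _ => IsBigO.abs_left ?_
    refine IsBigO.congr_left (f₁ := fun J : BddJet n Λ =>
      ∑ m, (∑ k, J.1.g i k * J.1.T k m) * ∑ p, (∑ k, J.1.g j k * J.1.T k p) *
        ∑ k, J.1.T k p * J.1.Vτ m k) ?_ fun J => ?_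
    · refine IsBigO.fun_sum fun m _ => IsBigO.one_mul' (hgT i m) (IsBigO.fun_sum fun p _ =>
        IsBigO.one_mul' (hgT j p) (isBigO_of_le _ fun J => ?_))
      rw [Real.norm_eq_abs, Real.norm_eq_abs, abs_of_nonneg (Real.sqrt_nonneg _)]
      refine Real.abs_le_sqrt ?_
      refine le_trans ?_ (Finset.single_le_sum (f := fun m => J.1.N m) (fun m _ => by
        rw [N_eq_sum_sq J.2.1]; exact Finset.sum_nonneg fun _ _ => sq_nonneg _) (Finset.mem_univ m))
      rw [N_eq_sum_sq J.2.1]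
      exact Finset.single_le_sum (f := fun p => (∑ k, J.1.T k p * J.1.Vτ m k) ^ 2)
        (fun _ _ => sq_nonneg _) (Finset.mem_univ p)
    · rw [expand J (fun i => J.1.V i j) i]
      refine Finset.sum_congr rfl fun m _ => ?_
      congr 1
      exact (expand J (J.1.Vτ m) j).symm
  obtain ⟨C2, hC2⟩ := isBigO_top.1 (isBigO_w n Λ)
  obtain ⟨C1, hC1⟩ := isBigO_top.1 hr
  obtain ⟨C3, hC3⟩ := isBigO_top.1 hρ
  have key : ∀ {C s x : ℝ}, 0 ≤ s → 0 ≤ x → ‖s‖ ≤ C * ‖Real.sqrt x‖ →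
      (C ^ 2 + 1)⁻¹ * s ^ 2 ≤ x := by
    intro C s x hs hx h
    rw [Real.norm_eq_abs, Real.norm_eq_abs, abs_of_nonneg (Real.sqrt_nonneg _),
      abs_of_nonneg hs] at h
    rw [inv_mul_le_iff₀ (by positivity)]
    have h1 : s ^ 2 ≤ (C * Real.sqrt x) ^ 2 := pow_le_pow_left₀ hs h 2
    rw [mul_pow, Real.sq_sqrt hx] at h1
    linarith
  refine ⟨(C1 ^ 2 + 1)⁻¹, |C2|, (C3 ^ 2 + 1)⁻¹, by positivity, abs_nonneg _, by positivity,
    fun J hJ h => ⟨key J.r_nonneg (hw0 ⟨J, hJ, h⟩) (hC1 ⟨J, hJ, h⟩), ?_,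
      key J.rho_nonneg (hN0 ⟨J, hJ, h⟩) (hC3 ⟨J, hJ, h⟩)⟩⟩
  have h1 := hC2 ⟨J, hJ, h⟩
  rw [Real.norm_eq_abs, Real.norm_eq_abs, abs_of_nonneg (sq_nonneg J.r)] at h1
  exact (le_abs_self _).trans (h1.trans (mul_le_mul_of_nonneg_right (le_abs_self _) (sq_nonneg _)))

end Jet

/-! ### Calculus at a maximum point -/

section LineDerivatives

variable {n : ℕ} {f : EuclideanSpace ℝ (Fin n) → ℝ} {y : EuclideanSpace ℝ (Fin n)}

lemma hasDerivAt_line (ξ : EuclideanSpace ℝ (Fin n)) {s : ℝ}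
    (hf : DifferentiableAt ℝ f (y + s • ξ)) :
    HasDerivAt (fun s : ℝ => f (y + s • ξ)) (∑ i, ξ i * pd i f (y + s • ξ)) s := by
  have h1 : HasDerivAt (fun s : ℝ => y + s • ξ) ξ s := by
    simpa using ((hasDerivAt_id s).smul_const ξ).const_add y
  have h2 := hf.hasFDerivAt.comp_hasDerivAt s h1
  rw [fderiv_apply_eq_sum_pd] at h2
  exact h2

lemma hasDerivAt_line_zero (ξ : EuclideanSpace ℝ (Fin n)) (hf : DifferentiableAt ℝ f y) :
    HasDerivAt (fun s : ℝ => f (y + s • ξ)) (∑ i, ξ i * pd i f y) 0 := by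
  have h := hasDerivAt_line (f := f) (y := y) ξ (s := 0) (by simpa using hf)
  simpa using h

lemma eventually_line_mem {O : Set (EuclideanSpace ℝ (Fin n))} (hO : IsOpen O) (hy : y ∈ O)
    (ξ : EuclideanSpace ℝ (Fin n)) : ∀ᶠ s : ℝ in nhds 0, y + s • ξ ∈ O := by
  have h1 : ContinuousAt (fun s : ℝ => y + s • ξ) 0 := by fun_prop
  exact h1.eventually_mem (by simpa using hO.mem_nhds hy)

lemma eventually_hasDerivAt_line {O : Set (EuclideanSpace ℝ (Fin n))} (hO : IsOpen O) (hy : y ∈ O)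
    (hf : DifferentiableOn ℝ f O) (ξ : EuclideanSpace ℝ (Fin n)) :
    ∀ᶠ s : ℝ in nhds 0,
      HasDerivAt (fun s : ℝ => f (y + s • ξ)) (∑ i, ξ i * pd i f (y + s • ξ)) s := by
  filter_upwards [eventually_line_mem hO hy ξ] with s hs
  exact hasDerivAt_line ξ (hf.differentiableAt (hO.mem_nhds hs))

/-- The second derivative of a `C²` function along a line. -/
lemma hasDerivAt_line_deriv {O : Set (EuclideanSpace ℝ (Fin n))} (hO : IsOpen O) (hy : y ∈ O)
    (hf : ContDiffOn ℝ 2 f O) (ξ : EuclideanSpace ℝ (Fin n)) :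
    HasDerivAt (fun s : ℝ => ∑ j, ξ j * pd j f (y + s • ξ))
      (∑ i, ∑ j, ξ i * ξ j * pd i (pd j f) y) 0 := by
  have h1 : ∀ j, DifferentiableAt ℝ (pd j f) y := fun j =>
    ((contDiffOn_pd (m := 1) hO hf (by norm_num) j).contDiffAt (hO.mem_nhds hy)).differentiableAt
      (by norm_num)
  have h2 := HasDerivAt.fun_sum fun j (_ : j ∈ Finset.univ) =>
    (hasDerivAt_line_zero ξ (h1 j)).const_mul (ξ j)
  refine h2.congr_deriv ?_
  simp only [Finset.mul_sum]
  rw [Finset.sum_comm]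
  exact Finset.sum_congr rfl fun i _ => Finset.sum_congr rfl fun j _ => by ring

end LineDerivatives

section MaximumPrinciple

/-- The second derivative test, as a necessary condition. -/
lemma second_deriv_nonpos_of_isLocalMax {H H' : ℝ → ℝ} {H'' s₀ : ℝ} (hmax : IsLocalMax H s₀)
    (h1 : ∀ᶠ s in nhds s₀, HasDerivAt H (H' s) s) (h2 : HasDerivAt H' H'' s₀) : H'' ≤ 0 := by
  by_contra! hpos
  have e1 : deriv H =ᶠ[nhds s₀] H' := h1.mono fun s hs => hs.deriv
  have d2 : deriv (deriv H) s₀ = H'' := by rw [e1.deriv_eq, h2.deriv]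
  have hmin := isLocalMin_of_deriv_deriv_pos (by rw [d2]; exact hpos) hmax.deriv_eq_zero
    h1.self_of_nhds.continuousAt
  -- at a maximum and minimum point the function is locally constant
  have hconst : H =ᶠ[nhds s₀] fun _ => H s₀ := by
    filter_upwards [hmax, hmin] with s a b using le_antisymm a b
  have e2 : H' =ᶠ[nhds s₀] fun _ => 0 := by
    filter_upwards [hconst.eventuallyEq_nhds, h1] with s a b
    rw [← b.deriv, a.deriv_eq, deriv_const]
  have : H'' = 0 := by rw [← h2.deriv, e2.deriv_eq, deriv_const]
  exact hpos.ne' this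

/-- The first and second order conditions at a maximum point of `w * exp (½ exp (2 (u - K)))`, in
terms of the derivatives of `w` and `u`. -/
lemma conditions_of_isLocalMax {w w₁ u u₁ : ℝ → ℝ} {w₂ u₂ K p s₀ : ℝ}
    (hp : p = Real.exp (2 * (u s₀ - K)))
    (hmax : IsLocalMax (fun s => w s * Real.exp (1 / 2 * Real.exp (2 * (u s - K)))) s₀)
    (hw : ∀ᶠ s in nhds s₀, HasDerivAt w (w₁ s) s) (hu : ∀ᶠ s in nhds s₀, HasDerivAt u (u₁ s) s)
    (hw₁ : HasDerivAt w₁ w₂ s₀) (hu₁ : HasDerivAt u₁ u₂ s₀) :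
    w₁ s₀ = -(p * w s₀ * u₁ s₀) ∧
      w₂ + w s₀ * (2 * p - p ^ 2) * u₁ s₀ ^ 2 + w s₀ * p * u₂ ≤ 0 := by
  have hE : ∀ s, HasDerivAt u (u₁ s) s →
      HasDerivAt (fun s => Real.exp (2 * (u s - K)))
        (Real.exp (2 * (u s - K)) * (2 * u₁ s)) s := fun s hs =>
    ((hs.sub_const K).const_mul 2).exp
  have hE2 : ∀ s, HasDerivAt u (u₁ s) s →
      HasDerivAt (fun s => Real.exp (1 / 2 * Real.exp (2 * (u s - K))))
        (Real.exp (1 / 2 * Real.exp (2 * (u s - K))) *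
          (Real.exp (2 * (u s - K)) * u₁ s)) s := fun s hs => by
    refine ((hE s hs).const_mul (1 / 2)).exp.congr_deriv ?_
    ring
  have h1 : ∀ᶠ s in nhds s₀, HasDerivAt
      (fun s => w s * Real.exp (1 / 2 * Real.exp (2 * (u s - K))))
      ((w₁ s + w s * (Real.exp (2 * (u s - K)) * u₁ s)) *
        Real.exp (1 / 2 * Real.exp (2 * (u s - K)))) s := by
    filter_upwards [hw, hu] with s a b
    refine (a.fun_mul (hE2 s b)).congr_deriv ?_
    ring
  have hu0 := hu.self_of_nhds
  have hw0 := hw.self_of_nhds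
  have h2 := ((hw₁.fun_add (hw0.fun_mul ((hE s₀ hu0).fun_mul hu₁))).fun_mul (hE2 s₀ hu0))
  have hcrit := hmax.hasDerivAt_eq_zero h1.self_of_nhds
  have hEpos := Real.exp_pos (1 / 2 * Real.exp (2 * (u s₀ - K)))
  have hsnd := second_deriv_nonpos_of_isLocalMax hmax h1 h2
  rw [← hp] at *
  have hF : w₁ s₀ + w s₀ * (p * u₁ s₀) = 0 := by
    rcases mul_eq_zero.1 hcrit with h | h
    · exact h
    · exact absurd h hEpos.ne'
  rw [hF, zero_mul, add_zero] at hsnd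
  have hsnd' := nonpos_of_mul_nonpos_left hsnd hEpos
  have hw1 : w₁ s₀ = -(p * w s₀ * u₁ s₀) := by linarith
  refine ⟨hw1, ?_⟩
  rw [hw1] at hsnd'
  linarith

variable {n : ℕ}

/-- The conditions of `conditions_of_isLocalMax` for `w = ∑ S k l * v k * v l`, in terms of the first
and second derivatives (with subscripts `1` and `2`) of `S`, `v` and `u` along a curve. -/
lemma conditions_of_isLocalMax_quadratic {S S₁ : Fin n → Fin n → ℝ → ℝ} {v v₁ : Fin n → ℝ → ℝ}
    {u u₁ : ℝ → ℝ} {S₂ : Fin n → Fin n → ℝ} {v₂ : Fin n → ℝ} {u₂ K p s₀ W : ℝ}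
    (hp : p = Real.exp (2 * (u s₀ - K))) (hW : W = ∑ k, ∑ l, S k l s₀ * v k s₀ * v l s₀)
    (hsymm : ∀ k l, S k l s₀ = S l k s₀)
    (hsymm₁ : ∀ k l, S₁ k l s₀ = S₁ l k s₀)
    (hmax : IsLocalMax (fun s => (∑ k, ∑ l, S k l s * v k s * v l s) *
      Real.exp (1 / 2 * Real.exp (2 * (u s - K)))) s₀)
    (hS : ∀ k l, ∀ᶠ s in nhds s₀, HasDerivAt (S k l) (S₁ k l s) s)
    (hv : ∀ k, ∀ᶠ s in nhds s₀, HasDerivAt (v k) (v₁ k s) s)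
    (hu : ∀ᶠ s in nhds s₀, HasDerivAt u (u₁ s) s)
    (hS₁ : ∀ k l, HasDerivAt (S₁ k l) (S₂ k l) s₀) (hv₁ : ∀ k, HasDerivAt (v₁ k) (v₂ k) s₀)
    (hu₁ : HasDerivAt u₁ u₂ s₀) :
    ∑ k, ∑ l, S₁ k l s₀ * v k s₀ * v l s₀ + 2 * ∑ k, ∑ l, S k l s₀ * v₁ k s₀ * v l s₀
        = -(p * W * u₁ s₀) ∧
      2 * ∑ k, ∑ l, S k l s₀ * v₂ k * v l s₀ + 2 * ∑ k, ∑ l, S k l s₀ * v₁ k s₀ * v₁ l s₀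
        + ∑ k, ∑ l, (S₂ k l * v k s₀ * v l s₀ + 4 * (S₁ k l s₀ * v₁ k s₀ * v l s₀))
        + W * (2 * p - p ^ 2) * u₁ s₀ ^ 2 + W * p * u₂ ≤ 0 := by
  have hw : ∀ᶠ s in nhds s₀, HasDerivAt (fun s => ∑ k, ∑ l, S k l s * v k s * v l s)
      (∑ k, ∑ l, ((S₁ k l s * v k s + S k l s * v₁ k s) * v l s + S k l s * v k s * v₁ l s)) s := by
    have hS' := Filter.eventually_all.2 fun k => Filter.eventually_all.2 (hS k)
    filter_upwards [hS', Filter.eventually_all.2 hv] with s a b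
    exact HasDerivAt.fun_sum fun k _ => HasDerivAt.fun_sum fun l _ =>
      ((a k l).fun_mul (b k)).fun_mul (b l)
  have hS0 := fun k l => (hS k l).self_of_nhds
  have hv0 := fun k => (hv k).self_of_nhds
  have hw₁ := HasDerivAt.fun_sum fun k (_ : k ∈ Finset.univ) =>
    HasDerivAt.fun_sum fun l (_ : l ∈ Finset.univ) =>
    ((((hS₁ k l).fun_mul (hv0 k)).fun_add ((hS0 k l).fun_mul (hv₁ k))).fun_mul (hv0 l)).fun_add
      (((hS0 k l).fun_mul (hv0 k)).fun_mul (hv₁ l))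
  obtain ⟨h1, h2⟩ := conditions_of_isLocalMax hp hmax hw hu hw₁ hu₁
  rw [← hW] at h1 h2
  have swap : ∀ F : Fin n → Fin n → ℝ, ∑ k, ∑ l, F k l = ∑ k, ∑ l, F l k :=
    fun F => Finset.sum_comm
  have c1 : ∑ k, ∑ l, S k l s₀ * v k s₀ * v₁ l s₀ = ∑ k, ∑ l, S k l s₀ * v₁ k s₀ * v l s₀ := by
    rw [swap]
    exact Finset.sum_congr rfl fun k _ => Finset.sum_congr rfl fun l _ => by
      rw [hsymm l k]; ring
  have c2 : ∑ k, ∑ l, S k l s₀ * v k s₀ * v₂ l = ∑ k, ∑ l, S k l s₀ * v₂ k * v l s₀ := by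
    rw [swap]
    exact Finset.sum_congr rfl fun k _ => Finset.sum_congr rfl fun l _ => by
      rw [hsymm l k]; ring
  have c3 : ∑ k, ∑ l, S₁ k l s₀ * v k s₀ * v₁ l s₀ = ∑ k, ∑ l, S₁ k l s₀ * v₁ k s₀ * v l s₀ := by
    rw [swap]
    exact Finset.sum_congr rfl fun k _ => Finset.sum_congr rfl fun l _ => by
      rw [hsymm₁ l k]; ring
  constructor
  · rw [← h1]
    simp only [add_mul, Finset.sum_add_distrib]
    rw [c1]; ring
  · refine le_of_eq_of_le ?_ h2
    simp only [add_mul, Finset.sum_add_distrib, ← Finset.mul_sum]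
    rw [c2, c3]; ring

end MaximumPrinciple

/-! ### The derivatives of a solution in a chart -/

section JetOfSolution

open Matrix

variable {n : ℕ} {M : Type*} [TopologicalSpace M] [ChartedSpace (EuclideanSpace ℝ (Fin n)) M]
  [IsManifold (𝓡 n) ∞ M] (g : Metric n M)
  (φ : OpenPartialHomeomorph M (EuclideanSpace ℝ (Fin n)))

/-- The jet, at the point with coordinates `y`, of the metric and the function `u`. -/
noncomputable def jetAt (τ t : ℝ) (u : M → ℝ) (T : Matrix (Fin n) (Fin n) ℝ)
    (y : EuclideanSpace ℝ (Fin n)) : Jet n where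
  g i j := gMat g φ y i j
  S i j := (gMat g φ y)⁻¹ i j
  A i j := schoutenMat g φ τ y i j
  T i j := T i j
  V i j := pd i (fun z => duVec φ u z j) y
  Dg k i j := pd k (fun z => gMat g φ z i j) y
  DS k i j := pd k (fun z => (gMat g φ z)⁻¹ i j) y
  DA k i j := pd k (fun z => schoutenMat g φ τ z i j) y
  Γ m i j := christoffel g φ m i j y
  W k i j := pd k (pd i (fun z => duVec φ u z j)) y
  DDS i j k l := pd i (pd j (fun z => (gMat g φ z)⁻¹ k l)) y
  DΓ k m i j := pd k (christoffel g φ m i j) y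
  v i := duVec φ u y i
  t := t

lemma exists_bound_of_continuousOn {X ι : Type*} [TopologicalSpace X] [Finite ι] {s : Set X}
    (hs : IsCompact s) {F : ι → X → ℝ} (hF : ∀ i, ContinuousOn (F i) s) :
    ∃ C : ℝ, ∀ i, ∀ x ∈ s, |F i x| ≤ C := by
  have := Fintype.ofFinite ι
  choose C hC using fun i => hs.exists_bound_of_continuousOn (hF i)
  refine ⟨∑ i, |C i|, fun i x hx => (hC i x hx).trans ((le_abs_self _).trans ?_)⟩
  exact Finset.single_le_sum (f := fun i => |C i|) (fun _ _ => abs_nonneg _) (Finset.mem_univ i)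

variable {g φ}

/-- In a compact part of a chart the jets of the solutions are bounded. -/
lemma exists_bounded_jetAt (hφ : φ ∈ IsManifold.maximalAtlas (𝓡 n) ∞ M) (τ : ℝ)
    {s : Set (EuclideanSpace ℝ (Fin n))} (hs : IsCompact s) (hsφ : s ⊆ φ.target) :
    ∃ Λ : ℝ, ∀ y ∈ s, ∀ t ∈ Set.Icc (0 : ℝ) 1, ∀ u : M → ℝ, ContMDiff (𝓡 n) 𝓘(ℝ, ℝ) 3 u →
      ∀ T : Matrix (Fin n) (Fin n) ℝ, Tᵀ * gMat g φ y * T = 1 → T * Tᵀ = (gMat g φ y)⁻¹ →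
        (jetAt g φ τ t u T y).Bounded Λ := by
  have cg := contDiffOn_gMat g hφ
  have cS := contDiffOn_gInv g hφ
  have cA := contDiffOn_schoutenMat g hφ τ
  have cΓ := contDiffOn_christoffel g hφ
  have hD : ∀ {f : EuclideanSpace ℝ (Fin n) → ℝ}, ContDiffOn ℝ ∞ f φ.target → ∀ k,
      ContDiffOn ℝ ∞ (pd k f) φ.target := fun hf k =>
    contDiffOn_pd φ.open_target hf (by simp) k
  have hc : ∀ {f : EuclideanSpace ℝ (Fin n) → ℝ}, ContDiffOn ℝ ∞ f φ.target →
      ContinuousOn f s := fun hf => hf.continuousOn.mono hsφ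
  obtain ⟨C₁, h₁⟩ := exists_bound_of_continuousOn (ι := Fin n × Fin n) hs
    fun i => hc (cg i.1 i.2)
  obtain ⟨C₂, h₂⟩ := exists_bound_of_continuousOn (ι := Fin n × Fin n) hs
    fun i => hc (cS i.1 i.2)
  obtain ⟨C₃, h₃⟩ := exists_bound_of_continuousOn (ι := Fin n × Fin n) hs
    fun i => hc (cA i.1 i.2)
  obtain ⟨C₄, h₄⟩ := exists_bound_of_continuousOn (ι := Fin n × Fin n × Fin n) hs
    fun i => hc (cΓ i.1 i.2.1 i.2.2)
  obtain ⟨C₅, h₅⟩ := exists_bound_of_continuousOn (ι := Fin n × Fin n × Fin n) hs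
    fun i => hc (hD (cg i.2.1 i.2.2) i.1)
  obtain ⟨C₆, h₆⟩ := exists_bound_of_continuousOn (ι := Fin n × Fin n × Fin n) hs
    fun i => hc (hD (cS i.2.1 i.2.2) i.1)
  obtain ⟨C₇, h₇⟩ := exists_bound_of_continuousOn (ι := Fin n × Fin n × Fin n) hs
    fun i => hc (hD (cA i.2.1 i.2.2) i.1)
  obtain ⟨C₈, h₈⟩ := exists_bound_of_continuousOn (ι := Fin n × Fin n × Fin n × Fin n) hs
    fun i => hc (hD (hD (cS i.2.2.1 i.2.2.2) i.2.1) i.1)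
  obtain ⟨C₉, h₉⟩ := exists_bound_of_continuousOn (ι := Fin n × Fin n × Fin n × Fin n) hs
    fun i => hc (hD (cΓ i.2.1 i.2.2.1 i.2.2.2) i.1)
  have l1 := le_abs_self C₁; have l2 := le_abs_self C₂; have l3 := le_abs_self C₃
  have l4 := le_abs_self C₄; have l5 := le_abs_self C₅; have l6 := le_abs_self C₆
  have l7 := le_abs_self C₇; have l8 := le_abs_self C₈; have l9 := le_abs_self C₉
  have p1 := abs_nonneg C₁; have p2 := abs_nonneg C₂; have p3 := abs_nonneg C₃
  have p4 := abs_nonneg C₄; have p5 := abs_nonneg C₅; have p6 := abs_nonneg C₆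
  have p7 := abs_nonneg C₇; have p8 := abs_nonneg C₈; have p9 := abs_nonneg C₉
  refine ⟨|C₁| + |C₂| + |C₃| + |C₄| + |C₅| + |C₆| + |C₇| + |C₈| + |C₉|,
    fun y hy t ht u hu T hT hT' => ?_⟩
  have hyφ := hsφ hy
  have cu := contDiffOn_comp_symm hφ (by norm_cast) hu
  have hdet : IsUnit (gMat g φ y).det := (isUnit_iff_isUnit_det _).1 (posDef_gMat g hφ hyφ).isUnit
  exact {
    g_le := fun i j => (h₁ (i, j) y hy).trans (by linarith)
    S_le := fun i j => (h₂ (i, j) y hy).trans (by linarith)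
    A_le := fun i j => (h₃ (i, j) y hy).trans (by linarith)
    Γ_le := fun m i j => (h₄ (m, i, j) y hy).trans (by linarith)
    Dg_le := fun k i j => (h₅ (k, i, j) y hy).trans (by linarith)
    DS_le := fun k i j => (h₆ (k, i, j) y hy).trans (by linarith)
    DA_le := fun k i j => (h₇ (k, i, j) y hy).trans (by linarith)
    DDS_le := fun k l i j => (h₈ (k, l, i, j) y hy).trans (by linarith)
    DΓ_le := fun k m i j => (h₉ (k, m, i, j) y hy).trans (by linarith)
    t_mem := ht
    S_symm := gInv_symm g y
    V_symm := fun i j => pd_comm φ.open_target (cu.of_le (by norm_num)) hyφ i j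
    W_symm := fun i j k => by
      have h1 : pd j (fun z => duVec φ u z k) =ᶠ[nhds y] pd k (fun z => duVec φ u z j) := by
        filter_upwards [φ.open_target.mem_nhds hyφ] with z hz
        exact pd_comm φ.open_target (cu.of_le (by norm_num)) hz j k
      refine (pd_congr i h1).trans ?_
      exact pd_comm φ.open_target (contDiffOn_pd φ.open_target cu (by norm_num) j) hyφ i k
    frame_g := fun m p => by
      have := congrFun (congrFun hT m) p
      rw [Matrix.one_apply] at this
      rw [← this]
      simp only [jetAt, mul_apply, transpose_apply, Finset.sum_mul]
      exact Finset.sum_comm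
    sum_T := fun i j => congrFun (congrFun hT' i) j
    sum_gT := fun i j => by
      have : gMat g φ y * T * Tᵀ = 1 := by rw [Matrix.mul_assoc, hT', mul_nonsing_inv _ hdet]
      have := congrFun (congrFun this i) j
      rw [Matrix.one_apply] at this
      rw [← this]
      simp only [jetAt, mul_apply, transpose_apply] }

/-- The first and second order conditions at a maximum point of the test function
`|∇u|² exp (½ exp (2 (u - K)))`. -/
lemma jet_conditions_of_isLocalMax (hφ : φ ∈ IsManifold.maximalAtlas (𝓡 n) ∞ M) {τ t K Λ p : ℝ}
    {y : EuclideanSpace ℝ (Fin n)} (hy : y ∈ φ.target) {u : M → ℝ}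
    (hu : ContMDiff (𝓡 n) 𝓘(ℝ, ℝ) 3 u) {T : Matrix (Fin n) (Fin n) ℝ} {J : Jet n}
    (hJ : J = jetAt g φ τ t u T y) (hb : J.Bounded Λ)
    (hp : p = Real.exp (2 * (u (φ.symm y) - K)))
    (hmax : IsLocalMax (fun z => gradSq g φ u z *
      Real.exp (1 / 2 * Real.exp (2 * (u (φ.symm z) - K)))) y) :
    (∀ i, ∑ k, ∑ l, J.DS i k l * J.v k * J.v l + 2 * J.dv i = -(p * J.w * J.v i)) ∧
    ∀ m, 2 * J.frame J.dV m + 2 * J.N m + J.e₃ m + J.w * (2 * p - p ^ 2) * J.y m ^ 2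
      + J.w * p * J.frame J.V m ≤ 0 := by
  have cu := contDiffOn_comp_symm hφ (by norm_cast) hu
  have cS := contDiffOn_gInv g hφ
  have cv : ∀ k, ContDiffOn ℝ 2 (fun z => duVec φ u z k) φ.target := fun k =>
    contDiffOn_pd φ.open_target cu (by norm_num) k
  have main : ∀ ξ : EuclideanSpace ℝ (Fin n), _ := fun ξ =>
    conditions_of_isLocalMax_quadratic (s₀ := 0) (K := K) (p := p) (W := J.w)
      (S := fun k l s => (gMat g φ (y + s • ξ))⁻¹ k l)
      (S₁ := fun k l s => ∑ i, ξ i * pd i (fun z => (gMat g φ z)⁻¹ k l) (y + s • ξ))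
      (v := fun k s => duVec φ u (y + s • ξ) k)
      (v₁ := fun k s => ∑ i, ξ i * pd i (fun z => duVec φ u z k) (y + s • ξ))
      (u := fun s => u (φ.symm (y + s • ξ)))
      (u₁ := fun s => ∑ i, ξ i * duVec φ u (y + s • ξ) i)
      (by simpa using hp) (by rw [hJ]; simp only [zero_smul, add_zero]; rfl)
      (fun k l => gInv_symm g _ k l)
      (fun k l => by
        have : (fun z => (gMat g φ z)⁻¹ k l) = fun z => (gMat g φ z)⁻¹ l k :=
          funext fun z => gInv_symm g z k l
        simp only [this])
      (by
        have h1 : Filter.Tendsto (fun s : ℝ => y + s • ξ) (nhds 0) (nhds y) := by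
          have : ContinuousAt (fun s : ℝ => y + s • ξ) 0 := by fun_prop
          simpa [ContinuousAt] using this
        have h2 := h1.eventually hmax
        filter_upwards [h2] with s hs
        simp only [zero_smul, add_zero]
        exact hs)
      (fun k l => eventually_hasDerivAt_line φ.open_target hy
        ((cS k l).differentiableOn (by simp)) ξ)
      (fun k => eventually_hasDerivAt_line φ.open_target hy
        ((cv k).differentiableOn (by norm_num)) ξ)
      (eventually_hasDerivAt_line φ.open_target hy (cu.differentiableOn (by norm_num)) ξ)
      (fun k l => hasDerivAt_line_deriv φ.open_target hy ((cS k l).of_le (by norm_cast)) ξ)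
      (fun k => hasDerivAt_line_deriv φ.open_target hy (cv k) ξ)
      (hasDerivAt_line_deriv φ.open_target hy (cu.of_le (by norm_num)) ξ)
  simp only [zero_smul, add_zero] at main
  constructor
  · intro i
    have h := (main (EuclideanSpace.single i 1)).1
    simp only [PiLp.single_apply, ite_mul, one_mul, zero_mul, Finset.sum_ite_eq',
      Finset.mem_univ, if_true] at h
    have h2 : J.dv i = ∑ k, ∑ l, J.S k l * J.V i k * J.v l := by
      simp only [Jet.dv, Jet.along, Jet.q, Finset.sum_mul]
      exact Finset.sum_congr rfl fun k _ => Finset.sum_congr rfl fun l _ => by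
        rw [hb.V_symm i k]; ring
    rw [h2]
    subst hJ
    exact h
  · intro m
    have h := (main (WithLp.toLp 2 fun i => T i m)).2
    have h2 : J.frame J.V m = ∑ i, ∑ j, J.T i m * J.T j m * J.V i j :=
      Finset.sum_congr rfl fun i _ => Finset.sum_congr rfl fun j _ => by ring
    rw [← Jet.sum_S_mul_Wτ hb, h2]
    subst hJ
    exact h

end JetOfSolution

/-! ### The derivative of the equation along the gradient -/

section DifferentiatedEquation

open Matrix

variable {n : ℕ} {M : Type*} [TopologicalSpace M] [ChartedSpace (EuclideanSpace ℝ (Fin n)) M]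
  [IsManifold (𝓡 n) ∞ M] {g : Metric n M}
  {φ : OpenPartialHomeomorph M (EuclideanSpace ℝ (Fin n))}

/-- The derivative of `U^t` along the gradient of `u`. -/
lemma hasDerivAt_UMat (hφ : φ ∈ IsManifold.maximalAtlas (𝓡 n) ∞ M) {τ t : ℝ}
    {y : EuclideanSpace ℝ (Fin n)} (hy : y ∈ φ.target) {u : M → ℝ}
    (hu : ContMDiff (𝓡 n) 𝓘(ℝ, ℝ) 3 u) {T : Matrix (Fin n) (Fin n) ℝ} {J : Jet n}
    (hJ : J = jetAt g φ τ t u T y) (i j : Fin n) :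
    HasDerivAt (fun s : ℝ => UMat g φ τ t u (y + s • (WithLp.toLp 2 J.q)) i j)
      (J.dU ((1 - τ) / ((n : ℝ) - 2)) ((2 - τ) / 2) i j) 0 := by
  have cu := contDiffOn_comp_symm hφ (by norm_cast) hu
  have cv : ∀ k, ContDiffOn ℝ 2 (fun z => duVec φ u z k) φ.target := fun k =>
    contDiffOn_pd φ.open_target cu (by norm_num) k
  have line : ∀ {f : EuclideanSpace ℝ (Fin n) → ℝ}, ContDiffOn ℝ 1 f φ.target →
      HasDerivAt (fun s : ℝ => f (y + s • (WithLp.toLp 2 J.q))) (J.along fun k => pd k f y) 0 :=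
    fun hf => hasDerivAt_line_zero _
      ((hf.differentiableOn (by norm_num)).differentiableAt (φ.open_target.mem_nhds hy))
  have hg : ∀ i j, HasDerivAt (fun s : ℝ => gMat g φ (y + s • (WithLp.toLp 2 J.q)) i j)
      (J.dg i j) 0 := fun i j => by
    have := line ((contDiffOn_gMat g hφ i j).of_le (by norm_cast))
    subst hJ; exact this
  have hS : ∀ i j, HasDerivAt (fun s : ℝ => (gMat g φ (y + s • (WithLp.toLp 2 J.q)))⁻¹ i j)
      (J.dS i j) 0 := fun i j => by
    have := line ((contDiffOn_gInv g hφ i j).of_le (by norm_cast))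
    subst hJ; exact this
  have hA : ∀ i j, HasDerivAt (fun s : ℝ => schoutenMat g φ τ (y + s • (WithLp.toLp 2 J.q)) i j)
      (J.dA i j) 0 := fun i j => by
    have := line ((contDiffOn_schoutenMat g hφ τ i j).of_le (by norm_cast))
    subst hJ; exact this
  have hv : ∀ i, HasDerivAt (fun s : ℝ => duVec φ u (y + s • (WithLp.toLp 2 J.q)) i)
      (J.dv i) 0 := fun i => by
    have := line ((cv i).of_le (by norm_num))
    subst hJ; exact this
  have hh : ∀ i j, HasDerivAt (fun s : ℝ => hessMat g φ u (y + s • (WithLp.toLp 2 J.q)) i j)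
      (J.dV i j - J.dΓv i j) 0 := fun i j => by
    have h1 := line (contDiffOn_pd (m := 1) φ.open_target (cv j) (by norm_num) i)
    have h2 := h1.fun_sub (HasDerivAt.fun_sum fun m (_ : m ∈ Finset.univ) =>
      (line ((contDiffOn_christoffel g hφ m i j).of_le (by norm_cast))).fun_mul (hv m))
    subst hJ
    simp only [zero_smul, add_zero] at h2
    exact h2
  have hlap : HasDerivAt (fun s : ℝ => lap g φ u (y + s • (WithLp.toLp 2 J.q))) J.dlap 0 := by
    have h1 := HasDerivAt.fun_sum fun i (_ : i ∈ Finset.univ) =>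
      HasDerivAt.fun_sum fun j (_ : j ∈ Finset.univ) => (hS i j).fun_mul (hh i j)
    subst hJ
    simp only [zero_smul, add_zero] at h1
    exact h1
  have hw : HasDerivAt (fun s : ℝ => gradSq g φ u (y + s • (WithLp.toLp 2 J.q))) J.dw 0 := by
    have h1 := HasDerivAt.fun_sum fun i (_ : i ∈ Finset.univ) =>
      HasDerivAt.fun_sum fun j (_ : j ∈ Finset.univ) =>
        ((hS i j).fun_mul (hv i)).fun_mul (hv j)
    subst hJ
    simp only [zero_smul, add_zero] at h1
    exact h1
  have h1 := (((((hh i j).fun_add ((hlap.const_mul ((1 - τ) / ((n : ℝ) - 2))).fun_mul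
    (hg i j))).fun_add ((hw.const_mul ((2 - τ) / 2)).fun_mul (hg i j))).fun_sub
    ((hv i).fun_mul (hv j))).fun_sub ((hA i j).const_mul t)).fun_add ((hg i j).const_mul (1 - t))
  subst hJ
  simp only [zero_smul, add_zero] at h1
  exact h1

/-- The derivatives of the `σ_j(U^t)` along the gradient of `u`. -/
lemma hasDerivAt_esymm_lamU (hφ : φ ∈ IsManifold.maximalAtlas (𝓡 n) ∞ M) {τ t : ℝ}
    {y : EuclideanSpace ℝ (Fin n)} (hy : y ∈ φ.target) {u : M → ℝ}
    (hu : ContMDiff (𝓡 n) 𝓘(ℝ, ℝ) 3 u) {T : Matrix (Fin n) (Fin n) ℝ} {x : Fin n → ℝ}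
    (hT : Tᵀ * gMat g φ y * T = 1) (hx : Tᵀ * UMat g φ τ t u y * T = diagonal x) {J : Jet n}
    (hJ : J = jetAt g φ τ t u T y) {a b : ℝ} (ha : a = (1 - τ) / ((n : ℝ) - 2))
    (hb : b = (2 - τ) / 2) {j : ℕ} (hj : j ≤ n) :
    HasDerivAt (fun s : ℝ => (lamU g φ τ t u (y + s • (WithLp.toLp 2 J.q))).esymm j)
      (∑ m, sigDeriv x j m *
        J.frame (fun i j => (∑ k, ∑ l, J.g i k * J.dS k l * J.U a b l j) + J.dU a b i j) m) 0 := by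
  have hdet : IsUnit (gMat g φ y).det := (isUnit_iff_isUnit_det _).1 (posDef_gMat g hφ hy).isUnit
  have hS : ∀ i j, HasDerivAt (fun s : ℝ => (gMat g φ (y + s • (WithLp.toLp 2 J.q)))⁻¹ i j)
      (J.dS i j) 0 := fun i j => by
    have := hasDerivAt_line_zero (WithLp.toLp 2 J.q) (((contDiffOn_gInv g hφ i j).differentiableOn
      (by simp)).differentiableAt (φ.open_target.mem_nhds hy))
    subst hJ; exact this
  set B' : Matrix (Fin n) (Fin n) ℝ :=
    of J.dS * UMat g φ τ t u y + (gMat g φ y)⁻¹ * of (J.dU a b) with hB'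
  have hB : ∀ i j, HasDerivAt (fun s : ℝ => ((gMat g φ (y + s • (WithLp.toLp 2 J.q)))⁻¹ *
      UMat g φ τ t u (y + s • (WithLp.toLp 2 J.q))) i j) (B' i j) 0 := fun i j => by
    have h1 := HasDerivAt.fun_sum fun k (_ : k ∈ Finset.univ) =>
      (hS i k).fun_mul (hasDerivAt_UMat hφ hy hu hJ k j)
    simp only [zero_smul, add_zero, Finset.sum_add_distrib] at h1
    rw [← ha, ← hb] at h1
    simp only [mul_apply]
    exact h1
  have hsplit : ∀ᶠ s : ℝ in nhds 0, ((gMat g φ (y + s • (WithLp.toLp 2 J.q)))⁻¹ *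
      UMat g φ τ t u (y + s • (WithLp.toLp 2 J.q))).charpoly.Splits := by
    filter_upwards [eventually_line_mem φ.open_target hy (WithLp.toLp 2 J.q)] with s hs
    exact splits_charpoly_inv_mul (posDef_gMat g hφ hs)
      (transpose_UMat g hφ hs hu τ t)
  have h := hasDerivAt_esymm_eigenvalues (R := Tᵀ * gMat g φ y) (x := x) (mul_eq_one_comm.1 hT)
    (by
      simp only [zero_smul, add_zero]
      rw [← hx, Matrix.mul_assoc Tᵀ, ← Matrix.mul_assoc (gMat g φ y), mul_nonsing_inv _ hdet,
        Matrix.one_mul]) hB hsplit hj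
  refine h.congr_deriv (Finset.sum_congr rfl fun m _ => ?_)
  congr 1
  have h2 : Tᵀ * gMat g φ y * B' * T =
      Tᵀ * (gMat g φ y * of J.dS * UMat g φ τ t u y + of (J.dU a b)) * T := by
    rw [hB', Matrix.mul_assoc Tᵀ, Matrix.mul_add, ← Matrix.mul_assoc (gMat g φ y),
      ← Matrix.mul_assoc (gMat g φ y), mul_nonsing_inv _ hdet, Matrix.one_mul]
  have h3 : ∀ i j, (gMat g φ y * of J.dS * UMat g φ τ t u y + of (J.dU a b)) i j =
      (∑ k, ∑ l, J.g i k * J.dS k l * J.U a b l j) + J.dU a b i j := fun i j => by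
    have hU : ∀ l, UMat g φ τ t u y l j = J.U a b l j := fun l => by
      subst hJ ha hb; rfl
    have hg : ∀ k, gMat g φ y i k = J.g i k := fun k => by subst hJ; rfl
    simp only [Matrix.add_apply, mul_apply, of_apply, Finset.sum_mul, hU, hg]
    rw [Finset.sum_comm]
  have hTT : ∀ i j, J.T i j = T i j := fun i j => by subst hJ; rfl
  rw [h2]
  generalize (gMat g φ y * of J.dS * UMat g φ τ t u y + of (J.dU a b)) = X at h3
  simp only [mul_apply, transpose_apply, Jet.frame, Finset.sum_mul, h3, hTT]
  exact Finset.sum_comm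

/-- The coefficients `[(1-t)c + t α_l] e^{2(k-l)u}` of the equation. -/
noncomputable def lowerCoef (n k : ℕ) (t : ℝ) (αl : ℕ → M → ℝ) (u : M → ℝ) (l : ℕ) (x : M) : ℝ :=
  ((1 - t) * cConst n k + t * αl l x) * Real.exp (2 * ((k : ℝ) - l) * u x)

/-- The equation without denominators. -/
lemma IsAdmissibleSolution.polynomial_equation {m : ℕ} {τ t : ℝ} {α : M → ℝ} {αl : ℕ → M → ℝ}
    {u : M → ℝ} (h : IsAdmissibleSolution g (m + 2) τ t α αl u)
    (hφ : φ ∈ IsManifold.maximalAtlas (𝓡 n) ∞ M) {y : EuclideanSpace ℝ (Fin n)}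
    (hy : y ∈ φ.target) :
    (lamU g φ τ t u y).esymm (m + 2)
      - ∑ l ∈ Finset.range (m + 1), lowerCoef n (m + 2) t αl u l (φ.symm y) *
          (lamU g φ τ t u y).esymm l
      + t * α (φ.symm y) * Real.exp (2 * u (φ.symm y)) * (lamU g φ τ t u y).esymm (m + 1) = 0 := by
  obtain ⟨h1, h2⟩ := h φ hφ (φ.symm y) (φ.map_target hy)
  rw [φ.right_inv hy] at h1 h2
  have hpos := h1 (m + 1) (by omega) (by omega)
  rw [show m + 2 - 1 = m + 1 by omega, ← sub_div, div_eq_iff hpos.ne'] at h2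
  simp only [lowerCoef]
  linarith

/-- `linCoef` as the derivative of the equation in the direction `z`. -/
lemma sum_linCoef_mul {x z : Fin n → ℝ} {m : ℕ} {β : ℕ → ℝ} {ψ : ℝ} (h : sig x (m + 1) ≠ 0) :
    (∑ i, linCoef x m β ψ i * z i) * sig x (m + 1) = ∑ i, sigDeriv x (m + 2) i * z i
      - ∑ l ∈ Finset.range (m + 1), β l * ∑ i, sigDeriv x l i * z i
      + ψ * ∑ i, sigDeriv x (m + 1) i * z i := by
  have h1 : ∑ l ∈ Finset.range (m + 1), β l * ∑ i, sigDeriv x l i * z i =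
      ∑ i, (∑ l ∈ Finset.range (m + 1), β l * sigDeriv x l i) * z i := by
    simp only [Finset.mul_sum, Finset.sum_mul]
    rw [Finset.sum_comm]
    exact Finset.sum_congr rfl fun i _ => Finset.sum_congr rfl fun l _ => by ring
  rw [h1, Finset.mul_sum, ← Finset.sum_sub_distrib, ← Finset.sum_add_distrib, Finset.sum_mul]
  refine Finset.sum_congr rfl fun i _ => ?_
  rw [linCoef]
  field_simp

/-- The linearized operator, applied to the derivative of `U^t` along the gradient, is bounded from
below: the coefficients of the `σ_l` with `l ≤ k - 2` increase along the gradient as soon as it is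
large, because of the factors `e^{2(k-l)u}`. -/
lemma neg_le_sum_linCoef_mul_frame {m : ℕ} (hn : m + 2 ≤ n)
    (hφ : φ ∈ IsManifold.maximalAtlas (𝓡 n) ∞ M) {τ t : ℝ} (ht : t ∈ Set.Icc (0 : ℝ) 1)
    {y : EuclideanSpace ℝ (Fin n)} (hy : y ∈ φ.target) {α u : M → ℝ} {αl : ℕ → M → ℝ}
    (hα : MDifferentiableAt (𝓡 n) 𝓘(ℝ, ℝ) α (φ.symm y))
    (hαl : ∀ l ≤ m, MDifferentiableAt (𝓡 n) 𝓘(ℝ, ℝ) (αl l) (φ.symm y))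
    (hu : ContMDiff (𝓡 n) 𝓘(ℝ, ℝ) 3 u) {A B K : ℝ≥0} {δ c₀ : ℝ}
    (hαA : |α (φ.symm y)| ≤ A) (hαA' : gradNorm g α (φ.symm y) ≤ A)
    (hαB : ∀ l ≤ m, gradNorm g (αl l) (φ.symm y) ≤ B)
    (hδ : ∀ l ≤ m, δ ≤ αl l (φ.symm y)) (huK : |u (φ.symm y)| ≤ K)
    (hsol : IsAdmissibleSolution g (m + 2) τ t α αl u)
    (hc₀ : 0 ≤ c₀) (hc₀c : c₀ ≤ cConst n (m + 2)) (hc₀δ : c₀ ≤ δ)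
    {T : Matrix (Fin n) (Fin n) ℝ} {x : Fin n → ℝ}
    (hT : Tᵀ * gMat g φ y * T = 1) (hT' : T * Tᵀ = (gMat g φ y)⁻¹)
    (hx : Tᵀ * UMat g φ τ t u y * T = diagonal x)
    {J : Jet n} (hJ : J = jetAt g φ τ t u T y) {a b : ℝ} (ha : a = (1 - τ) / ((n : ℝ) - 2))
    (hb : b = (2 - τ) / 2) (hw1 : 1 ≤ J.w) (hwB : B * √J.w ≤ 4 * c₀ * J.w) :
    -(3 * A * Real.exp (2 * K) * J.w) ≤
      ∑ i, linCoef x m (fun l => lowerCoef n (m + 2) t αl u l (φ.symm y))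
        (t * α (φ.symm y) * Real.exp (2 * u (φ.symm y))) i *
        J.frame (fun i j => (∑ k, ∑ l, J.g i k * J.dS k l * J.U a b l j) + J.dU a b i j) i := by
  set z := J.frame (fun i j => (∑ k, ∑ l, J.g i k * J.dS k l * J.U a b l j) + J.dU a b i j) with hz
  set ξ : EuclideanSpace ℝ (Fin n) := WithLp.toLp 2 J.q with hξ
  have hsig : ∀ j, (lamU g φ τ t u y).esymm j = sig x j := fun j =>
    esymm_eigenvalues_inv_mul hT' hx j
  have hΓ : ∀ j, 1 ≤ j → j ≤ m + 1 → 0 < sig x j := fun j h1 h2 => by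
    have := (hsol φ hφ (φ.symm y) (φ.map_target hy)).1 j h1 h2
    rwa [φ.right_inv hy, hsig] at this
  have hpos := hΓ (m + 1) (by omega) le_rfl
  have hJw : J.w = gradSq g φ u y := by subst hJ; rfl
  -- derivatives along the gradient
  have line : ∀ {f : M → ℝ}, MDifferentiableAt (𝓡 n) 𝓘(ℝ, ℝ) f (φ.symm y) →
      HasDerivAt (fun s : ℝ => f (φ.symm (y + s • ξ)))
        (∑ i, J.q i * duVec φ f y i) 0 := fun {f} hf => by
    have h1 := (mdifferentiable_of_mem_maximalAtlas hφ).mdifferentiableAt_symm hy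
    have h2 : DifferentiableAt ℝ (fun z => f (φ.symm z)) y :=
      mdifferentiableAt_iff_differentiableAt.1 (hf.comp y h1)
    exact hasDerivAt_line_zero ξ h2
  have bound : ∀ {f : M → ℝ} {D : ℝ≥0}, MDifferentiableAt (𝓡 n) 𝓘(ℝ, ℝ) f (φ.symm y) →
      gradNorm g f (φ.symm y) ≤ D → |∑ i, J.q i * duVec φ f y i| ≤ D * √J.w := fun hf hD => by
    have := abs_sum_mul_duVec_le g hφ hy hf hD u
    rw [hJw]
    subst hJ
    exact this
  have hu1 : HasDerivAt (fun s : ℝ => u (φ.symm (y + s • ξ))) J.w 0 := by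
    have := line (hu.mdifferentiableAt (by norm_num) (x := φ.symm y))
    rw [← Jet.sum_q_mul_v]
    subst hJ
    exact this
  set U₀ := u (φ.symm y) with hU₀
  set Dα := ∑ i, J.q i * duVec φ α y i with hDα
  set β : ℕ → ℝ := fun l => lowerCoef n (m + 2) t αl u l (φ.symm y) with hβ
  set β' : ℕ → ℝ := fun l => t * (∑ i, J.q i * duVec φ (αl l) y i) *
      Real.exp (2 * (((m + 2 : ℕ) : ℝ) - l) * U₀) +
    ((1 - t) * cConst n (m + 2) + t * αl l (φ.symm y)) *
      (Real.exp (2 * (((m + 2 : ℕ) : ℝ) - l) * U₀) * (2 * (((m + 2 : ℕ) : ℝ) - l) * J.w)) with hβ'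
  set ψ := t * α (φ.symm y) * Real.exp (2 * U₀) with hψ
  set ψ' := t * Dα * Real.exp (2 * U₀) + t * α (φ.symm y) * (Real.exp (2 * U₀) * (2 * J.w)) with hψ'
  have dβ : ∀ l ≤ m, HasDerivAt (fun s : ℝ => lowerCoef n (m + 2) t αl u l (φ.symm (y + s • ξ)))
      (β' l) 0 := fun l hl => by
    have h1 := (((line (hαl l hl)).const_mul t).const_add ((1 - t) * cConst n (m + 2))).fun_mul
      (hu1.const_mul (2 * (((m + 2 : ℕ) : ℝ) - l))).exp
    simp only [zero_smul, add_zero] at h1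
    exact h1
  have dψ : HasDerivAt (fun s : ℝ => t * α (φ.symm (y + s • ξ)) *
      Real.exp (2 * u (φ.symm (y + s • ξ)))) ψ' 0 := by
    have h1 := ((line hα).const_mul t).fun_mul (hu1.const_mul 2).exp
    simp only [zero_smul, add_zero] at h1
    exact h1
  have dE : ∀ j ≤ n, HasDerivAt (fun s : ℝ => (lamU g φ τ t u (y + s • ξ)).esymm j)
      (∑ i, sigDeriv x j i * z i) 0 := fun j hj =>
    hasDerivAt_esymm_lamU hφ hy hu hT hx hJ ha hb hj
  have dF := ((dE (m + 2) hn).fun_sub (HasDerivAt.fun_sum fun l (hl : l ∈ Finset.range (m + 1)) =>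
    (dβ l (by have := Finset.mem_range.1 hl; omega)).fun_mul
      (dE l (by have := Finset.mem_range.1 hl; omega)))).fun_add
    (dψ.fun_mul (dE (m + 1) (by omega)))
  have hzero : (fun s : ℝ => (lamU g φ τ t u (y + s • ξ)).esymm (m + 2)
      - ∑ l ∈ Finset.range (m + 1), lowerCoef n (m + 2) t αl u l (φ.symm (y + s • ξ)) *
          (lamU g φ τ t u (y + s • ξ)).esymm l
      + t * α (φ.symm (y + s • ξ)) * Real.exp (2 * u (φ.symm (y + s • ξ))) *
          (lamU g φ τ t u (y + s • ξ)).esymm (m + 1)) =ᶠ[nhds 0] fun _ => (0 : ℝ) := by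
    filter_upwards [eventually_line_mem φ.open_target hy ξ] with s hs
    exact hsol.polynomial_equation hφ hs
  have heq := dF.unique ((hasDerivAt_const (0 : ℝ) (0 : ℝ)).congr_of_eventuallyEq hzero)
  simp only [zero_smul, add_zero, hsig, Finset.sum_add_distrib] at heq
  have hkey := sum_linCoef_mul (x := x) (z := z) (β := β) (ψ := ψ) hpos.ne'
  -- the lower order coefficients increase
  have hβpos : ∀ l ≤ m, 0 ≤ β' l := fun l hl => by
    have hlk : (2 : ℝ) ≤ ((m + 2 : ℕ) : ℝ) - l := by
      have : (l : ℝ) ≤ m := by exact_mod_cast hl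
      push_cast; linarith
    have h1 : c₀ ≤ (1 - t) * cConst n (m + 2) + t * αl l (φ.symm y) := by
      have h3 := mul_le_mul_of_nonneg_left (hc₀δ.trans (hδ l hl)) ht.1
      have h4 := mul_le_mul_of_nonneg_left hc₀c (sub_nonneg.2 ht.2)
      linarith
    have h2 := (abs_le.1 (bound (hαl l hl) (hαB l hl))).1
    have h3 : (4 : ℝ) * c₀ * J.w ≤
        ((1 - t) * cConst n (m + 2) + t * αl l (φ.symm y)) *
          (2 * (((m + 2 : ℕ) : ℝ) - l) * J.w) := by
      have : c₀ * 4 ≤ ((1 - t) * cConst n (m + 2) + t * αl l (φ.symm y)) *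
          (2 * (((m + 2 : ℕ) : ℝ) - l)) :=
        mul_le_mul h1 (by linarith) (by norm_num) (hc₀.trans h1)
      have := mul_le_mul_of_nonneg_right this (zero_le_one.trans hw1)
      linarith
    have h4 : -(B * √J.w) ≤ t * ∑ i, J.q i * duVec φ (αl l) y i := by
      have h5 : 0 ≤ B * √J.w := by positivity
      have h6 := mul_le_mul_of_nonneg_left h2 ht.1
      have h7 := mul_le_of_le_one_left h5 ht.2
      linarith
    have h6 : β' l = Real.exp (2 * (((m + 2 : ℕ) : ℝ) - l) * U₀) *
        (t * (∑ i, J.q i * duVec φ (αl l) y i) +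
        ((1 - t) * cConst n (m + 2) + t * αl l (φ.symm y)) *
          (2 * (((m + 2 : ℕ) : ℝ) - l) * J.w)) := by
      simp only [hβ']; ring
    rw [h6]
    exact mul_nonneg (Real.exp_pos _).le (by linarith)
  have hsum : 0 ≤ ∑ l ∈ Finset.range (m + 1), β' l * sig x l :=
    Finset.sum_nonneg fun l hl => by
      have hl' : l ≤ m := by have := Finset.mem_range.1 hl; omega
      refine mul_nonneg (hβpos l hl') ?_
      rcases Nat.eq_zero_or_pos l with rfl | h
      · rw [sig_zero]; exact zero_le_one
      · exact (hΓ l h (by omega)).le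
  have hψle : ψ' ≤ 3 * A * Real.exp (2 * K) * J.w := by
    have h1 := (abs_le.1 (bound hα hαA')).2
    have h2 : √J.w ≤ J.w :=
      Real.sqrt_le_iff.2 ⟨zero_le_one.trans hw1, le_self_pow₀ hw1 two_ne_zero⟩
    have h3 : Dα ≤ A * J.w := h1.trans (mul_le_mul_of_nonneg_left h2 A.2)
    have h4 : α (φ.symm y) ≤ A := (le_abs_self _).trans hαA
    have h5 : Dα + α (φ.symm y) * (2 * J.w) ≤ 3 * A * J.w := by
      have := mul_le_mul_of_nonneg_right h4 (show 0 ≤ 2 * J.w by linarith)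
      linarith
    have h6 : Real.exp (2 * U₀) ≤ Real.exp (2 * K) :=
      Real.exp_le_exp.2 (by linarith [(abs_le.1 huK).2])
    have h7 : (0 : ℝ) ≤ 3 * A * J.w := by positivity
    have h8 : t * (Dα + α (φ.symm y) * (2 * J.w)) ≤ 3 * A * J.w :=
      (mul_le_mul_of_nonneg_left h5 ht.1).trans (mul_le_of_le_one_left h7 ht.2)
    calc ψ' = (t * (Dα + α (φ.symm y) * (2 * J.w))) * Real.exp (2 * U₀) := by rw [hψ']; ring
      _ ≤ (3 * A * J.w) * Real.exp (2 * U₀) := mul_le_mul_of_nonneg_right h8 (Real.exp_pos _).le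
      _ ≤ (3 * A * J.w) * Real.exp (2 * K) := mul_le_mul_of_nonneg_left h6 h7
      _ = _ := by ring
  have hfin : -ψ' * sig x (m + 1) ≤ (∑ i, linCoef x m β ψ i * z i) * sig x (m + 1) := by
    rw [hkey]
    have : ∑ l ∈ Finset.range (m + 1), β l * ∑ i, sigDeriv x l i * z i
      = ∑ l ∈ Finset.range (m + 1), lowerCoef n (m + 2) t αl u l (φ.symm y) *
        ∑ i, sigDeriv x l i * z i := rfl
    linarith
  have := le_of_mul_le_mul_right hfin hpos
  linarith

end DifferentiatedEquation

/-! ### The bound at a maximum point -/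

lemma esymm_replicate_one (n k : ℕ) : (Multiset.replicate n (1 : ℝ)).esymm k = n.choose k := by
  induction n generalizing k with
  | zero =>
    cases k with
    | zero => simp [Multiset.esymm]
    | succ k => rw [esymm_eq_zero_of_card_lt (by simp)]; simp
  | succ n ih =>
    cases k with
    | zero => simp [Multiset.esymm]
    | succ k =>
      rw [Multiset.replicate_succ, esymm_cons, ih, ih, Nat.choose_succ_succ]
      push_cast
      ring

lemma cConst_pos {n m : ℕ} (h : m + 2 ≤ n) : 0 < cConst n (m + 2) := by
  simp only [cConst, esymm_replicate_one]
  refine div_pos (by exact_mod_cast Nat.choose_pos h) ?_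
  exact Finset.sum_pos (fun l hl => by
    have := Finset.mem_range.1 hl
    exact_mod_cast Nat.choose_pos (by omega)) ⟨0, Finset.mem_range.2 (by omega)⟩

lemma Jet.abs_w_le {n : ℕ} {J : Jet n} {Λ : ℝ} (hJ : J.Bounded Λ) : |J.w| ≤ Λ * J.r ^ 2 := by
  have h : Λ * J.r ^ 2 = ∑ k, ∑ l, Λ * |J.v k| * |J.v l| := by
    rw [Jet.r, sq, Finset.sum_mul_sum, Finset.mul_sum]
    exact Finset.sum_congr rfl fun k _ => by
      rw [Finset.mul_sum]; exact Finset.sum_congr rfl fun l _ => by ring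
  rw [h]
  refine (Finset.abs_sum_le_sum_abs _ _).trans (Finset.sum_le_sum fun k _ => ?_)
  refine (Finset.abs_sum_le_sum_abs _ _).trans (Finset.sum_le_sum fun l _ => ?_)
  rw [abs_mul, abs_mul]
  have := hJ.S_le k l
  gcongr

section LocalBound

open Matrix

variable {n : ℕ} {M : Type*} [TopologicalSpace M] [ChartedSpace (EuclideanSpace ℝ (Fin n)) M]
  [IsManifold (𝓡 n) ∞ M] {g : Metric n M}
  {φ : OpenPartialHomeomorph M (EuclideanSpace ℝ (Fin n))}

/-- At the maximum points of the test function in a compact part of a chart, the gradient of `u`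
is bounded. -/
lemma exists_gradSq_bound {m : ℕ} (hn : 3 ≤ n) (hmn : m + 2 ≤ n)
    (hφ : φ ∈ IsManifold.maximalAtlas (𝓡 n) ∞ M) {τ : ℝ} (hτ : τ < 1) (A B K : ℝ≥0) {δ : ℝ}
    (hδ : 0 < δ) {s : Set (EuclideanSpace ℝ (Fin n))} (hs : IsCompact s) (hsφ : s ⊆ φ.target) :
    ∃ C : ℝ, ∀ y ∈ s, ∀ t ∈ Set.Icc (0 : ℝ) 1, ∀ (α : M → ℝ) (αl : ℕ → M → ℝ) (u : M → ℝ),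
      MDifferentiableAt (𝓡 n) 𝓘(ℝ, ℝ) α (φ.symm y) →
      (∀ l ≤ m, MDifferentiableAt (𝓡 n) 𝓘(ℝ, ℝ) (αl l) (φ.symm y)) →
      ContMDiff (𝓡 n) 𝓘(ℝ, ℝ) 3 u →
      |α (φ.symm y)| ≤ A → gradNorm g α (φ.symm y) ≤ A →
      (∀ l ≤ m, gradNorm g (αl l) (φ.symm y) ≤ B) →
      (∀ l ≤ m, δ ≤ αl l (φ.symm y)) → |u (φ.symm y)| ≤ K →
      IsAdmissibleSolution g (m + 2) τ t α αl u →
      IsLocalMax (fun z => gradSq g φ u z *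
        Real.exp (1 / 2 * Real.exp (2 * (u (φ.symm z) - K)))) y →
      gradSq g φ u y ≤ C := by
  obtain ⟨Λ, hΛ⟩ := exists_bounded_jetAt (g := g) hφ τ hs hsφ
  set a : ℝ := (1 - τ) / ((n : ℝ) - 2) with ha
  set b : ℝ := (2 - τ) / 2 with hb
  have hn3 : (3 : ℝ) ≤ n := by exact_mod_cast hn
  have ha0 : 0 < a := div_pos (by linarith) (by linarith)
  have hb0 : 0 < b := by rw [hb]; linarith
  obtain ⟨C₀, hC₀, herr⟩ := Jet.exists_error_bound n a b Λ
  obtain ⟨c₁, C₂, cN, hc₁, hC₂, hcN, hcomp⟩ := Jet.exists_comparison n Λ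
  set c₀ := min (cConst n (m + 2)) δ with hc₀
  have hc₀pos : 0 < c₀ := lt_min (cConst_pos hmn) hδ
  have hC₁ : (0 : ℝ) ≤ 3 * A * Real.exp (2 * K) := by positivity
  obtain ⟨R, hR⟩ := exists_bound_of_frame_inequalities (n := n) (κ := Real.exp (-(4 * K)))
    (f₀ := (n : ℝ)⁻¹) ha0 hb0 (Real.exp_pos _) hc₁ hC₂ hcN (by positivity) hC₀ hC₁
  -- the square of the gradient beyond which the coefficients `β_l` increase along the gradient
  set w₀ := max 1 ((B / (4 * c₀)) ^ 2) with hw₀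
  refine ⟨max (max |Λ| w₀) (C₂ * R ^ 2), fun y hy t ht α αl u hα hαl hu hαA hαA' hαB hαδ huK hsol
    hmax => ?_⟩
  have hyφ := hsφ hy
  obtain ⟨T, x, hT, hT', hx⟩ := exists_simultaneous_diagonalization (posDef_gMat g hφ hyφ)
    (transpose_UMat g hφ hyφ hu τ t)
  obtain ⟨J, hJ⟩ : ∃ J, J = jetAt g φ τ t u T y := ⟨_, rfl⟩
  have hJb : J.Bounded Λ := by rw [hJ]; exact hΛ y hy t ht u hu T hT hT'
  have hw : gradSq g φ u y = J.w := by rw [hJ]; rfl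
  rw [hw]
  -- the estimates of the lower order terms need `1 ≤ J.r`; otherwise `J.w` is bounded directly
  rcases lt_or_ge J.r 1 with hr | hr
  · refine le_trans ?_ ((le_max_left _ _).trans (le_max_left _ _))
    have h1 := (le_abs_self _).trans (Jet.abs_w_le hJb)
    have h2 : J.r ^ 2 ≤ 1 := pow_le_one₀ J.r_nonneg hr.le
    calc J.w ≤ Λ * J.r ^ 2 := h1
      _ ≤ |Λ| * J.r ^ 2 := mul_le_mul_of_nonneg_right (le_abs_self _) (sq_nonneg _)
      _ ≤ |Λ| * 1 := mul_le_mul_of_nonneg_left h2 (abs_nonneg _)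
      _ = |Λ| := mul_one _
  rcases le_or_gt J.w w₀ with hww | hww
  · exact hww.trans ((le_max_right _ _).trans (le_max_left _ _))
  obtain ⟨hw1, hw2, hN⟩ := hcomp J hJb hr
  refine le_trans ?_ (le_max_right _ _)
  refine hw2.trans (mul_le_mul_of_nonneg_left (pow_le_pow_left₀ J.r_nonneg ?_ 2) hC₂)
  have h1w : 1 ≤ J.w := (le_max_left _ _).trans hww.le
  have hwB : B * √J.w ≤ 4 * c₀ * J.w := by
    have h1 : B / (4 * c₀) ≤ √J.w := Real.le_sqrt_of_sq_le ((le_max_right _ _).trans hww.le)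
    rw [div_le_iff₀ (by positivity)] at h1
    have h2 : √J.w * √J.w = J.w := Real.mul_self_sqrt (by linarith)
    calc B * √J.w ≤ √J.w * (4 * c₀) * √J.w := mul_le_mul_of_nonneg_right h1 (Real.sqrt_nonneg _)
      _ = 4 * c₀ * (√J.w * √J.w) := by ring
      _ = _ := by rw [h2]
  set p := Real.exp (2 * (u (φ.symm y) - K)) with hp
  have hp1 : p ≤ 1 := Real.exp_le_one_iff.2 (by linarith [(abs_le.1 huK).2])
  have hpκ : Real.exp (-(4 * K)) ≤ p := Real.exp_le_exp.2 (by linarith [(abs_le.1 huK).1])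
  have hp0 : 0 < p := Real.exp_pos _
  obtain ⟨hcrit, hsnd⟩ := jet_conditions_of_isLocalMax hφ hyφ hu hJ hJb hp hmax
  have hsig : ∀ j, (lamU g φ τ t u y).esymm j = sig x j := fun j =>
    esymm_eigenvalues_inv_mul hT' hx j
  have hΓ : ∀ j, 1 ≤ j → j ≤ m + 1 → 0 < sig x j := fun j h1 h2 => by
    have := (hsol φ hφ (φ.symm y) (φ.map_target hyφ)).1 j h1 h2
    rwa [φ.right_inv hyφ, hsig] at this
  set β : ℕ → ℝ := fun l => lowerCoef n (m + 2) t αl u l (φ.symm y) with hβ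
  set ψ := t * α (φ.symm y) * Real.exp (2 * u (φ.symm y)) with hψ
  have heq : sig x (m + 2) - ∑ l ∈ Finset.range (m + 1), β l * sig x l + ψ * sig x (m + 1) = 0 := by
    have := hsol.polynomial_equation hφ hyφ
    simpa only [hsig] using this
  have hβ0 : ∀ l ≤ m, 0 ≤ β l := fun l hl => by
    refine mul_nonneg (add_nonneg (mul_nonneg (sub_nonneg.2 ht.2) (cConst_pos hmn).le)
      (mul_nonneg ht.1 (hδ.le.trans (hαδ l hl)))) (Real.exp_pos _).le
  have hψle : ψ ≤ 3 * A * Real.exp (2 * K) := by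
    have h1 : t * α (φ.symm y) ≤ A := by
      have h2 := mul_le_mul_of_nonneg_left ((le_abs_self _).trans hαA) ht.1
      exact h2.trans (mul_le_of_le_one_left A.2 ht.2)
    have h2 : Real.exp (2 * u (φ.symm y)) ≤ Real.exp (2 * K) :=
      Real.exp_le_exp.2 (by linarith [(abs_le.1 huK).2])
    have h3 : (0 : ℝ) ≤ A * Real.exp (2 * K) := by positivity
    calc ψ ≤ A * Real.exp (2 * u (φ.symm y)) := mul_le_mul_of_nonneg_right h1 (Real.exp_pos _).le
      _ ≤ A * Real.exp (2 * K) := mul_le_mul_of_nonneg_left h2 A.2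
      _ ≤ _ := by linarith
  have hxU : ∀ i, J.frame (J.U a b) i = x i := fun i => by
    have h1 := congrFun (congrFun hx i) i
    rw [diagonal_apply_eq] at h1
    rw [← h1, hJ]
    simp only [Jet.frame, mul_apply, transpose_apply, Finset.sum_mul]
    exact Finset.sum_comm
  refine hR (linCoef x m β ψ) (J.frame J.dV) (J.frame J.V) J.N J.y (J.e₁ a b) (J.e₂ a) J.e₃
    (J.frame (fun i j => (∑ k, ∑ l, J.g i k * J.dS k l * J.U a b l j) + J.dU a b i j))
    x J.r J.ρ J.w p (2 * p - p ^ 2) (linCoef_nonneg hmn hΓ hβ0 heq)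
    (inv_le_sum_linCoef hmn hΓ hβ0 heq) hr J.rho_nonneg hw1 hw2 (Jet.w_eq_sum_sq hJb) hpκ hp1
    (by nlinarith) (fun i => by
      rw [Jet.N_eq_sum_sq hJb]; exact Finset.sum_nonneg fun _ _ => sq_nonneg _) hN
    (fun i => (herr J hJb hr i).1) (fun i => (herr J hJb hr i).2.1)
    (fun i => (herr J hJb hr i).2.2) (fun i => by rw [← hxU, Jet.frame_U hJb])
    (fun i => Jet.frame_dU hJb hcrit i) hsnd ?_ ?_
  · have := neg_le_sum_mul_linCoef hΓ hβ0 heq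
    simp only [mul_comm (linCoef x m β ψ _)]
    linarith
  · exact neg_le_sum_linCoef_mul_frame hmn hφ ht hyφ hα hαl hu hαA hαA' hαB hαδ huK hsol hc₀pos.le
      (min_le_left _ _) (min_le_right _ _) hT hT' hx hJ ha hb h1w hwB

end LocalBound

/-! ### From the charts to the manifold -/

section Global

/-- On a compact space bounds that are locally uniform in a parameter are uniform. -/
lemma exists_uniform_bound {X ι : Type*} [TopologicalSpace X] [CompactSpace X]
    {P : ι → X → Prop} {G : ι → X → ℝ}
    (h : ∀ x, ∃ V ∈ nhds x, ∃ C : ℝ, ∀ i, ∀ z ∈ V, P i z → G i z ≤ C) :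
    ∃ C : ℝ, ∀ i z, P i z → G i z ≤ C := by
  obtain ⟨C, hC⟩ := isCompact_univ.induction_on
    (p := fun S : Set X => ∃ C : ℝ, ∀ i, ∀ z ∈ S, P i z → G i z ≤ C)
    ⟨0, fun i z hz => absurd hz (Set.notMem_empty z)⟩
    (fun S T hST ⟨C, hC⟩ => ⟨C, fun i z hz => hC i z (hST hz)⟩)
    (fun S T ⟨C, hC⟩ ⟨D, hD⟩ => ⟨max C D, fun i z hz hP => hz.elim
      (fun h => (hC i z h hP).trans (le_max_left _ _))
      (fun h => (hD i z h hP).trans (le_max_right _ _))⟩)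
    (fun x _ => by
      obtain ⟨V, hV, C, hC⟩ := h x
      exact ⟨V, mem_nhdsWithin_of_mem_nhds hV, C, hC⟩)
  exact ⟨C, fun i z => hC i z (Set.mem_univ z)⟩

lemma abs_le_of_C0Norm_le {M : Type*} {f : M → ℝ} {A : ℝ≥0} (h : C0Norm f ≤ A) (x : M) : |f x| ≤ A := by
  have h1 : ‖f x‖ₑ ≤ A := (le_iSup (fun x => ‖f x‖ₑ) x).trans h
  rw [enorm_le_coe] at h1
  exact_mod_cast h1

variable {n : ℕ} {M : Type*} [TopologicalSpace M] [ChartedSpace (EuclideanSpace ℝ (Fin n)) M]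
  [IsManifold (𝓡 n) ∞ M] (g : Metric n M)

/-- `|∇u|²` as a real function on `M`. For differentiable `u` the norm of the gradient is finite, so
that its real value is the true one. -/
noncomputable def normSqGrad (u : M → ℝ) (x : M) : ℝ := (gradNorm g u x).toReal ^ 2

/-- The test function `|∇u|² exp (½ exp (2 (u - K)))` of the maximum principle. -/
noncomputable def testFunction (K : ℝ) (u : M → ℝ) (x : M) : ℝ :=
  normSqGrad g u x * Real.exp (1 / 2 * Real.exp (2 * (u x - K)))

variable {g} {φ : OpenPartialHomeomorph M (EuclideanSpace ℝ (Fin n))}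

lemma normSqGrad_eq_gradSq (hφ : φ ∈ IsManifold.maximalAtlas (𝓡 n) ∞ M)
    {y : EuclideanSpace ℝ (Fin n)} (hy : y ∈ φ.target) {u : M → ℝ}
    (hu : MDifferentiableAt (𝓡 n) 𝓘(ℝ, ℝ) u (φ.symm y)) :
    normSqGrad g u (φ.symm y) = gradSq g φ u y := by
  rw [normSqGrad, gradNorm_eq_sqrt_gradSq g hφ hy hu, ENNReal.toReal_ofReal (Real.sqrt_nonneg _),
    Real.sq_sqrt (gradSq_nonneg g hφ hy u)]

lemma gradNorm_ne_top {u : M → ℝ} (hu : MDifferentiable (𝓡 n) 𝓘(ℝ, ℝ) u) (x : M) :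
    gradNorm g u x ≠ ⊤ := by
  have h := gradNorm_eq_sqrt_gradSq g (IsManifold.chart_mem_maximalAtlas x)
    (mem_chart_target (EuclideanSpace ℝ (Fin n)) x) (u := u) (hu _)
  rw [(chartAt (EuclideanSpace ℝ (Fin n)) x).left_inv (mem_chart_source _ x)] at h
  rw [h]
  exact ENNReal.ofReal_ne_top

lemma continuous_normSqGrad {u : M → ℝ} (hu : ContMDiff (𝓡 n) 𝓘(ℝ, ℝ) 3 u) :
    Continuous (normSqGrad g u) := by
  rw [continuous_iff_continuousAt]
  intro x
  set φ := chartAt (EuclideanSpace ℝ (Fin n)) x with hφdef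
  have hφ : φ ∈ IsManifold.maximalAtlas (𝓡 n) ∞ M := IsManifold.chart_mem_maximalAtlas x
  have hxs : x ∈ φ.source := mem_chart_source _ x
  have cu := contDiffOn_comp_symm hφ (by norm_cast) hu
  have cv : ∀ k, ContinuousOn (fun z => duVec φ u z k) φ.target := fun k =>
    (contDiffOn_pd (m := 2) φ.open_target cu (by norm_num) k).continuousOn
  have hcont : ContinuousOn (gradSq g φ u) φ.target := by
    unfold gradSq
    exact continuousOn_finsetSum _ fun i _ => continuousOn_finsetSum _ fun j _ =>
      ((contDiffOn_gInv g hφ i j).continuousOn.mul (cv i)).mul (cv j)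
  have h1 : ContinuousAt (fun z => gradSq g φ u (φ z)) x :=
    (hcont.continuousAt (φ.open_target.mem_nhds (φ.map_source hxs))).comp (φ.continuousAt hxs)
  refine h1.congr ?_
  filter_upwards [φ.open_source.mem_nhds hxs] with z hz
  rw [← normSqGrad_eq_gradSq hφ (φ.map_source hz) (hu.mdifferentiableAt (by norm_num)),
    φ.left_inv hz]

lemma abs_le_of_C2Norm_le {f : M → ℝ} {A : ℝ≥0} (h : C2Norm g f ≤ A) (x : M) : |f x| ≤ A :=
  abs_le_of_C0Norm_le ((le_self_add.trans le_self_add).trans h) x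

lemma gradNorm_le_of_C2Norm_le {f : M → ℝ} {A : ℝ≥0} (h : C2Norm g f ≤ A) (x : M) :
    gradNorm g f x ≤ A :=
  (le_iSup (gradNorm g f) x).trans ((le_add_self.trans le_self_add).trans h)

/-- The solutions to which the estimate applies, together with the functions in the equation, for
`k = m + 2`. -/
structure BoundedSolution (g : Metric n M) (m : ℕ) (τ : ℝ) (A B K : ℝ≥0) (δ : ℝ) where
  t : ℝ
  α : M → ℝ
  αl : ℕ → M → ℝ
  u : M → ℝ
  t_mem : t ∈ Set.Icc (0 : ℝ) 1
  contMDiff_α : ContMDiff (𝓡 n) 𝓘(ℝ, ℝ) ∞ α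
  contMDiff_αl : ∀ l ≤ m, ContMDiff (𝓡 n) 𝓘(ℝ, ℝ) ∞ (αl l)
  contMDiff_u : ContMDiff (𝓡 n) 𝓘(ℝ, ℝ) 3 u
  α_le : C2Norm g α ≤ A
  αl_le : ∀ l ≤ m, C2Norm g (αl l) ≤ B
  le_αl : ∀ l ≤ m, ∀ x, δ ≤ αl l x
  u_le : C0Norm u ≤ K
  isAdmissibleSolution : IsAdmissibleSolution g (m + 2) τ t α αl u

/-- At the maximum points of the test function `|∇u|²` has a bound that is uniform in the solution:
by compactness of `M` finitely many of the bounds in charts suffice. -/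
lemma exists_normSqGrad_bound_at_max [CompactSpace M] {m : ℕ} (hn : 3 ≤ n) (hmn : m + 2 ≤ n) {τ : ℝ}
    (hτ : τ < 1) (A B K : ℝ≥0) {δ : ℝ} (hδ : 0 < δ) :
    ∃ C : ℝ, ∀ (d : BoundedSolution g m τ A B K δ) (x : M),
      (∀ z, testFunction g K d.u z ≤ testFunction g K d.u x) → normSqGrad g d.u x ≤ C := by
  refine exists_uniform_bound fun x => ?_
  set φ := chartAt (EuclideanSpace ℝ (Fin n)) x with hφdef
  have hφ : φ ∈ IsManifold.maximalAtlas (𝓡 n) ∞ M := IsManifold.chart_mem_maximalAtlas x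
  have hxs : x ∈ φ.source := mem_chart_source _ x
  obtain ⟨s, hs, hsφ, hsc⟩ := local_compact_nhds (φ.open_target.mem_nhds (φ.map_source hxs))
  obtain ⟨C, hC⟩ := exists_gradSq_bound (g := g) hn hmn hφ hτ A B K hδ hsc hsφ
  refine ⟨φ.source ∩ φ ⁻¹' s, Filter.inter_mem (φ.open_source.mem_nhds hxs)
    ((φ.continuousAt hxs).preimage_mem_nhds hs), C, fun d z hz hmax => ?_⟩
  have hzt : φ z ∈ φ.target := φ.map_source hz.1
  have hzz : φ.symm (φ z) = z := φ.left_inv hz.1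
  have hdu : ∀ x, MDifferentiableAt (𝓡 n) 𝓘(ℝ, ℝ) d.u x := fun x =>
    d.contMDiff_u.mdifferentiableAt (by norm_num)
  have heq : ∀ y ∈ φ.target, testFunction g K d.u (φ.symm y) = gradSq g φ d.u y *
      Real.exp (1 / 2 * Real.exp (2 * (d.u (φ.symm y) - K))) := fun y hy => by
    rw [testFunction, normSqGrad_eq_gradSq hφ hy (hdu _)]
  have hloc : IsLocalMax (fun y => gradSq g φ d.u y *
      Real.exp (1 / 2 * Real.exp (2 * (d.u (φ.symm y) - K)))) (φ z) := by
    filter_upwards [φ.open_target.mem_nhds hzt] with y hy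
    rw [← heq y hy, ← heq _ hzt, hzz]
    exact hmax _
  have := hC (φ z) hz.2 d.t d.t_mem d.α d.αl d.u
    (d.contMDiff_α.mdifferentiableAt (by simp))
    (fun l hl => (d.contMDiff_αl l hl).mdifferentiableAt (by simp)) d.contMDiff_u
    (abs_le_of_C2Norm_le d.α_le _) (gradNorm_le_of_C2Norm_le d.α_le _)
    (fun l hl => gradNorm_le_of_C2Norm_le (d.αl_le l hl) _) (fun l hl => d.le_αl l hl _)
    (abs_le_of_C0Norm_le d.u_le _) d.isAdmissibleSolution hloc
  rwa [← normSqGrad_eq_gradSq hφ hzt (hdu _), hzz] at this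

variable (g) in
/-- The bound at a maximum point of the test function gives one everywhere, because for `|u| ≤ K` the
exponential factor lies between `1` and `exp (1 / 2)`. -/
lemma exists_gradNorm_bound [CompactSpace M] {m : ℕ} (hn : 3 ≤ n) (hmn : m + 2 ≤ n) {τ : ℝ}
    (hτ : τ < 1) (A B K : ℝ≥0) {δ : ℝ} (hδ : 0 < δ) :
    ∃ C : ℝ≥0, ∀ (d : BoundedSolution g m τ A B K δ) (x : M), gradNorm g d.u x ≤ C := by
  obtain ⟨C, hC⟩ := exists_normSqGrad_bound_at_max (g := g) hn hmn hτ A B K hδ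
  refine ⟨Real.toNNReal (√(C * Real.exp (1 / 2))), fun d x => ?_⟩
  have hcu := d.contMDiff_u.continuous
  have hcont : Continuous (testFunction g K d.u) := by
    have := continuous_normSqGrad (g := g) d.contMDiff_u
    unfold testFunction
    fun_prop
  obtain ⟨x₀, -, hx₀⟩ := isCompact_univ.exists_isMaxOn ⟨x, Set.mem_univ x⟩ hcont.continuousOn
  have hmax : ∀ z, testFunction g K d.u z ≤ testFunction g K d.u x₀ := fun z =>
    hx₀ (Set.mem_univ z)
  have hnn : ∀ z, 0 ≤ normSqGrad g d.u z := fun z => sq_nonneg _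
  have hle : normSqGrad g d.u x ≤ C * Real.exp (1 / 2) := by
    have h1 : normSqGrad g d.u x ≤ testFunction g K d.u x :=
      le_mul_of_one_le_right (hnn x) (Real.one_le_exp (by positivity))
    have h2 : Real.exp (2 * (d.u x₀ - K)) ≤ 1 := Real.exp_le_one_iff.2 (by
      linarith [(abs_le.1 (abs_le_of_C0Norm_le d.u_le x₀)).2])
    have h3 : testFunction g K d.u x₀ ≤ normSqGrad g d.u x₀ * Real.exp (1 / 2) :=
      mul_le_mul_of_nonneg_left (Real.exp_le_exp.2 (by linarith)) (hnn x₀)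
    exact h1.trans ((hmax x).trans (h3.trans
      (mul_le_mul_of_nonneg_right (hC d x₀ hmax) (Real.exp_pos _).le)))
  have hfin := gradNorm_ne_top (g := g) (d.contMDiff_u.mdifferentiable (by norm_num)) x
  rw [← ENNReal.ofReal_toReal hfin]
  exact ENNReal.ofReal_le_ofReal (Real.le_sqrt_of_sq_le hle)

end Global

end KrylovConformal

theorem lemma3p6 {n : ℕ} (hn : 3 ≤ n) {M : Type*} [TopologicalSpace M] [T2Space M] [CompactSpace M]
    [ChartedSpace (EuclideanSpace ℝ (Fin n)) M] [IsManifold (𝓡 n) ∞ M]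
    (g : KrylovConformal.Metric n M) (k : ℕ) (hk : 3 ≤ k) (hkn : k ≤ n) (τ : ℝ) (hτ : τ < 1)
    (A B K : ℝ≥0) (δ : ℝ) (hδ : 0 < δ) :
    ∃ C : ℝ≥0, ∀ (t : ℝ) (_ : t ∈ Set.Icc (0 : ℝ) 1) (α : M → ℝ) (αl : ℕ → M → ℝ) (u : M → ℝ),
      ContMDiff (𝓡 n) 𝓘(ℝ, ℝ) ∞ α →
      (∀ l : ℕ, l ≤ k - 2 → ContMDiff (𝓡 n) 𝓘(ℝ, ℝ) ∞ (αl l)) →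
      ContMDiff (𝓡 n) 𝓘(ℝ, ℝ) 3 u →
      KrylovConformal.C2Norm g α ≤ A →
      (∀ l : ℕ, l ≤ k - 2 → KrylovConformal.C2Norm g (αl l) ≤ B) →
      (∀ l : ℕ, l ≤ k - 2 → ∀ x, δ ≤ αl l x) →
      KrylovConformal.C0Norm u ≤ K →
      KrylovConformal.IsAdmissibleSolution g k τ t α αl u →
      (⨆ x, KrylovConformal.gradNorm g u x) ≤ C := by
  obtain ⟨m, rfl⟩ : ∃ m, k = m + 2 := ⟨k - 2, by omega⟩
  obtain ⟨C, hC⟩ := KrylovConformal.exists_gradNorm_bound g hn hkn hτ A B K hδ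
  refine ⟨C, fun t ht α αl u hα hαl hu hαA hαB hαδ huK hsol => iSup_le fun x => ?_⟩
  exact hC ⟨t, α, αl, u, ht, hα, hαl, hu, hαA, hαB, hαδ, huK, hsol⟩ x
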